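/- **Conventions.** A decision problem is a yes-or-no question about a set of finitely coded instances. It is *decidable* if some Turing machine answers all instances correctly (classical and quantum theory being Turing theories, this is also the meaning of "decidable in the theory"), and *non-trivially decidable* if moreover both answers occur. $P\le R$ means that a computable map sends instances of $P$ to instances of $R$ and preserves the answer. $\mathcal H$ is the halting problem. **Theories.** In *quantum theory* the states on $d\ge 1$ levels are the density matrices, and a measurement with $K$ outcomes is a tuple $A_1,\dots,A_K\in\mathbb C^{d\times d}$ of Kraus operators with $\sum_j A_j^\dagger A_j=I$; outcome $j$ changes the unnormalised state $\rho$ into $A_j\rho A_j^\dagger$. In *classical theory* the states are the probability vectors, and a measurement is a tuple $A_1,\dots,A_K$ of entrywise nonnegative matrices whose sum is column-stochastic; outcome $j$ changes $p$ into $A_jp$. The probability of a sequence of outcomes is the trace (resp. the sum of the coordinates) of the resulting unnormalised state. The entry $(A_{j_n}\cdots A_{j_1})_{x_n,x_0}$ is the sum, over all paths $x_0,x_1,\dots,x_n$ of levels with the given ends, of $\prod_{t}(A_{j_t})_{x_t,x_{t-1}}$; a measurement *prohibits destructive interference* if, whenever such a sum is $0$, all of its terms are $0$. Let $\mathbf Q$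 be the question: do all measurements of the theory prohibit destructive interference? **Problems.** * $\mathrm{MOP}_{\mathrm T}$ (QMOP for $\mathrm T$ quantum, CMOP for $\mathrm T$ classical): given a measurement of $\mathrm T$ with rational matrices, to be used repeatedly, is there a finite sequence of outcomes that has probability $0$ for every input state? * $\mathrm{MMP}$: given finitely many rational $d\times d$ matrices, $d\ge1$, is some nonempty finite product of them, with repetitions allowed, equal to $0$? Let $f$ replace every entry of the matrices of an instance by its absolute value; nonnegative MMP is MMP restricted to tuples of entrywise nonnegative matrices. * QOMDP reachability: given a nonempty finite list of actions, each a quantum measurement with the same finite set of observations, a starting density matrix and a goal density matrix that is absorbing (no possible observation changes it), all rational, is there a number $n$ and a policy (a choice of the next action from the observations so far) such that after $n$ steps the state is, with probability $1$, the goal state? * POMDP reachability: the same for a finite set of states with one absorbing goal state, rational transition probabilities $T(s,a,s')$, rational observation probabilities $O(s',a,o)$, and a rational starting belief. **Corollary.** $\mathbf Q$ is false in quantum theory and true in classical theory. $\mathcal H\le\mathrm{MMP}$, so MMP is undecidable; $f$ is computable and maps the instances of MMP onto those of nonnegative MMP, which is non-trivially decidable. For a theory $\mathrm T$ let $\mathcal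 D[f]_{\mathrm T}$ be the problem, on the instances $i$ of MMP, $$D_i[f]=(\neg\mathbf Q\wedge \mathrm{MMP}_i)\vee(\mathbf Q\wedge \mathrm{MMP}_{f(i)}),$$ with $\mathbf Q$ answered in $\mathrm T$. Then: 1. $\mathcal D[f]_{\rm quantum}\le$ QMOP and QMOP is undecidable, whereas $\mathcal D[f]_{\rm classical}\le$ CMOP $\le\mathcal D[f]_{\rm classical}$ and CMOP is non-trivially decidable. Moreover, for both theories $\mathrm T$ and every instance $i=(A_1,\dots,A_K)$ of $\mathrm{MOP}_{\mathrm T}$, the answer to $\mathrm{MOP}_{\mathrm T}$ at $i$ is $D_i[f]$. 2. $\mathcal D[f]_{\rm quantum}\le$ QOMDP reachability, which is undecidable, whereas $\mathcal D[f]_{\rm classical}\le$ POMDP reachability $\le\mathcal D[f]_{\rm classical}$ and POMDP reachability is non-trivially decidable. Moreover QMOP $\le$ QOMDP reachability. -/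

import Mathlib

open scoped Matrix ComplexOrder

noncomputable section

namespace ResUndec

/-! # Decision problems and computability -/

/-- A decision problem: finitely coded inputs, the inputs that are genuine instances (`valid`), and
the yes-or-no question that is asked about an instance. -/
structure DecisionProblem where
  Inst : Type
  code : Primcodable Inst
  valid : Inst → Prop
  yes : Inst → Prop

attribute [instance] DecisionProblem.code

namespace DecisionProblem

/-- Some algorithm answers every instance correctly. -/
def IsDecidable (P : DecisionProblem) : Prop :=
  ∃ g : P.Inst → Bool, Computable g ∧ ∀ i, P.valid i → (g i = true ↔ P.yes i)

/-- Decidable, and the answer is not the same for all instances. -/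
def NontriviallyDecidable (P : DecisionProblem) : Prop :=
  P.IsDecidable ∧ (∃ i, P.valid i ∧ P.yes i) ∧ (∃ i, P.valid i ∧ ¬ P.yes i)

/-- Computable many-one reducibility, instances being sent to instances. -/
def Reduces (P R : DecisionProblem) : Prop :=
  ∃ g : P.Inst → R.Inst, Computable g ∧
    ∀ i, P.valid i → R.valid (g i) ∧ (P.yes i ↔ R.yes (g i))

/-- The same question, asked about the instances in `S` only. -/
def restrict (P : DecisionProblem) (S : Set P.Inst) : DecisionProblem where
  Inst := P.Inst
  code := P.code
  valid i := P.valid i ∧ i ∈ S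
  yes := P.yes

/-- The problem `D[f]` with `D_i[f] = (¬ q ∧ H_i) ∨ (q ∧ H_{f(i)})`, where `q` is the answer that a
theory gives to the distinguishing question. -/
def resourceDependent (H : DecisionProblem) (f : H.Inst → H.Inst) (q : Prop) :
    DecisionProblem where
  Inst := H.Inst
  code := H.code
  valid := H.valid
  yes i := (¬ q ∧ H.yes i) ∨ (q ∧ H.yes (f i))

end DecisionProblem

/-- The halting problem: does a given program halt on a given input? -/
def Halting : DecisionProblem where
  Inst := Nat.Partrec.Code × ℕ
  code := inferInstance
  valid _ := True
  yes i := (i.1.eval i.2).Dom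

/-! # Codes for rational matrices -/

/-- `(a, b)` codes the rational number `a / (b + 1)`. -/
abbrev RatCode : Type := ℤ × ℕ

/-- A matrix is coded by the list of its rows; entries that are not listed are `0`. -/
abbrev MatCode : Type := List (List RatCode)

/-- A finite tuple of square matrices: their common dimension, and their list. -/
abbrev TupleCode : Type := ℕ × List MatCode

def RatCode.val (q : RatCode) : ℚ := (q.1 : ℚ) / ((q.2 : ℚ) + 1)

def MatCode.entry (m : MatCode) (x y : ℕ) : ℚ :=
  RatCode.val ((m.getD x []).getD y (0, 0))

def MatCode.toMatrix (m : MatCode) (d : ℕ) : Matrix (Fin d) (Fin d) ℚ :=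
  Matrix.of fun x y => m.entry x y

def MatCode.toComplex (m : MatCode) (d : ℕ) : Matrix (Fin d) (Fin d) ℂ :=
  (m.toMatrix d).map fun q => (q : ℂ)

def TupleCode.toMatrices (c : TupleCode) : Fin c.2.length → Matrix (Fin c.1) (Fin c.1) ℚ :=
  fun j => (c.2.get j).toMatrix c.1

def TupleCode.toComplex (c : TupleCode) : Fin c.2.length → Matrix (Fin c.1) (Fin c.1) ℂ :=
  fun j => (c.2.get j).toComplex c.1

/-! # Matrix mortality -/

/-- The matrix mortality problem: is some nonempty finite product, with repetitions, of the given
matrices equal to zero? -/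
def MMP : DecisionProblem where
  Inst := TupleCode
  code := inferInstance
  valid c := 0 < c.1
  yes c := ∃ w : List (Fin c.2.length), w ≠ [] ∧ (w.map c.toMatrices).prod = 0

/-- The tuples of matrices all of whose entries are nonnegative. -/
def nonnegTuples : Set TupleCode :=
  {c | ∀ m ∈ c.2, ∀ r ∈ m, ∀ q ∈ r, 0 ≤ RatCode.val q}

/-- Replace every entry of every matrix by its absolute value. -/
def entrywiseAbs (c : TupleCode) : TupleCode :=
  (c.1, c.2.map fun m => m.map fun r => r.map fun q => (|q.1|, q.2))

/-! # Physical theories -/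

/-- A physical theory for systems with finitely many levels: its states, its measurements (a
measurement on `d` levels with `K` outcomes is given by `K` transition matrices), and the
unnormalised state after an outcome with a given transition matrix, whose trace is the
probability of that outcome. -/
structure PhysicalTheory where
  states : (d : ℕ) → Set (Matrix (Fin d) (Fin d) ℂ)
  measurements : (d K : ℕ) → Set (Fin K → Matrix (Fin d) (Fin d) ℂ)
  act : {d : ℕ} → Matrix (Fin d) (Fin d) ℂ → Matrix (Fin d) (Fin d) ℂ → Matrix (Fin d) (Fin d) ℂ

/-- Quantum theory: density matrices, measurements given by Kraus operators `A_j` with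
`∑ j, A_jᴴ A_j = 1`, and the update `ρ ↦ A_j ρ A_jᴴ`. -/
def quantum : PhysicalTheory where
  states _ := {ρ | ρ.PosSemidef ∧ ρ.trace = 1}
  measurements _ _ := {A | ∑ j, (A j)ᴴ * A j = 1}
  act A ρ := A * ρ * Aᴴ

/-- Classical theory: probability vectors, written as diagonal density matrices, and measurements
given by entrywise nonnegative matrices `A_j` whose sum is (column) stochastic: `A_j x y` is the
probability to obtain outcome `j` and to move from level `y` to level `x`. -/
def classical : PhysicalTheory where
  states d := {ρ | ∃ p : Fin d → ℝ, (∀ x, 0 ≤ p x) ∧ ∑ x, p x = 1 ∧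
    ρ = Matrix.diagonal fun x => (p x : ℂ)}
  measurements _ _ := {A | (∀ j x y, 0 ≤ A j x y) ∧ ∀ y, ∑ j, ∑ x, A j x y = 1}
  act A ρ := Matrix.diagonal (A *ᵥ ρ.diag)

section

variable {d K : ℕ}

/-- The total transition matrix of a sequence of outcomes; the head of the list occurs first. -/
def totalMatrix (A : Fin K → Matrix (Fin d) (Fin d) ℂ) :
    List (Fin K) → Matrix (Fin d) (Fin d) ℂ
  | [] => 1
  | j :: w => totalMatrix A w * A j

/-- The contribution of a single path. A path starts at a level and is followed by the list of the
outcomes together with the levels reached. -/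
def pathWeight (A : Fin K → Matrix (Fin d) (Fin d) ℂ) : Fin d → List (Fin K × Fin d) → ℂ
  | _, [] => 1
  | y, (j, z) :: p => A j z y * pathWeight A z p

/-- The last level of a path. -/
def pathEnd (y : Fin d) (p : List (Fin K × Fin d)) : Fin d := (p.map Prod.snd).getLastD y

/-- The entries of `totalMatrix` are sums of the contributions of all paths with given ends and given
outcomes. Destructive interference is prohibited if such a sum never vanishes unless each of its
terms does. -/
def ProhibitsDestructiveInterference (A : Fin K → Matrix (Fin d) (Fin d) ℂ) : Prop :=
  ∀ (y : Fin d) (p : List (Fin K × Fin d)),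
    totalMatrix A (p.map Prod.fst) (pathEnd y p) y = 0 → pathWeight A y p = 0

/-- The unnormalised state after a sequence of outcomes, the head of the list occurring first. -/
def PhysicalTheory.after (T : PhysicalTheory) (A : Fin K → Matrix (Fin d) (Fin d) ℂ)
    (w : List (Fin K)) (ρ : Matrix (Fin d) (Fin d) ℂ) : Matrix (Fin d) (Fin d) ℂ :=
  w.foldl (fun σ j => T.act (A j) σ) ρ

end

/-- The question `Q`: do the measurements of the theory prohibit destructive interference? -/
def NoDestructiveInterference (T : PhysicalTheory) : Prop :=
  ∀ (d K : ℕ), ∀ A ∈ T.measurements d K, ProhibitsDestructiveInterference A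

/-- The measurement occurrence problem of a theory: for a given measurement device (with rational
transition matrices), which is used repeatedly, is there a finite sequence of outcomes that is
impossible, that is, has probability zero whatever the input state? -/
def MOP (T : PhysicalTheory) : DecisionProblem where
  Inst := TupleCode
  code := inferInstance
  valid c := 0 < c.1 ∧ c.toComplex ∈ T.measurements c.1 c.2.length
  yes c := ∃ w : List (Fin c.2.length),
    ∀ ρ ∈ T.states c.1, (T.after c.toComplex w ρ).trace = 0

/-! # Goal-state reachability for quantum observable Markov decision processes -/

/-- The data of a goal QOMDP: the dimension, the number of observations, for every action the list
of the Kraus operators of the observations, the starting state and the goal state. -/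
structure QOMDP where
  dim : ℕ
  numObs : ℕ
  numAct : ℕ
  kraus : Fin numAct → Fin numObs → Matrix (Fin dim) (Fin dim) ℂ
  start : Matrix (Fin dim) (Fin dim) ℂ
  goal : Matrix (Fin dim) (Fin dim) ℂ

namespace QOMDP

/-- Every action is a quantum measurement, and the goal state is absorbing: no observation that is
possible in the goal state changes it. -/
def IsGoalModel (M : QOMDP) : Prop :=
  0 < M.dim ∧ 0 < M.numAct ∧
  (∀ a, M.kraus a ∈ quantum.measurements M.dim M.numObs) ∧
  M.start ∈ quantum.states M.dim ∧ M.goal ∈ quantum.states M.dim ∧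
  ∀ a o, let σ := quantum.act (M.kraus a o) M.goal
    σ.trace ≠ 0 → σ.trace⁻¹ • σ = M.goal

/-- The unnormalised state after a history of observations (the latest one first) under a policy,
which chooses the next action from the history; its trace is the probability of the history. -/
def stateAfter (M : QOMDP) (π : List (Fin M.numObs) → Fin M.numAct) :
    List (Fin M.numObs) → Matrix (Fin M.dim) (Fin M.dim) ℂ
  | [] => M.start
  | o :: h => quantum.act (M.kraus (π h) o) (M.stateAfter π h)

/-- Some policy leads to the goal state in a finite number of steps with probability one. -/
def GoalReachable (M : QOMDP) : Prop :=
  ∃ (n : ℕ) (π : List (Fin M.numObs) → Fin M.numAct), ∀ h, h.length = n →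
    let σ := M.stateAfter π h
    σ.trace ≠ 0 → σ.trace⁻¹ • σ = M.goal

/-- Codes: `(dimension, number of observations, actions, starting state, goal state)`. -/
abbrev Code : Type := ℕ × ℕ × List (List MatCode) × MatCode × MatCode

def ofCode : Code → QOMDP
  | (d, K, acts, s, g) =>
    { dim := d
      numObs := K
      numAct := acts.length
      kraus := fun a o => ((acts.get a).getD o []).toComplex d
      start := s.toComplex d
      goal := g.toComplex d }

end QOMDP

/-- Goal-state reachability for QOMDPs (with rational matrices). -/
def QOMDPReachability : DecisionProblem where
  Inst := QOMDP.Code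
  code := inferInstance
  valid c := (QOMDP.ofCode c).IsGoalModel
  yes c := (QOMDP.ofCode c).GoalReachable

/-! # Goal-state reachability for partially observable Markov decision processes -/

/-- The data of a goal POMDP: `trans a s s'` is the probability that action `a` leads from state `s`
to state `s'`, and `obs a s' o` the probability that `o` is then observed. -/
structure POMDP where
  dim : ℕ
  numObs : ℕ
  numAct : ℕ
  trans : Fin numAct → Fin dim → Fin dim → ℚ
  obs : Fin numAct → Fin dim → Fin numObs → ℚ
  start : Fin dim → ℚ
  goal : Fin dim → Prop

namespace POMDP

/-- Transitions, observations and the starting belief are probability distributions; there is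
exactly one goal state, and it is absorbing. -/
def IsGoalModel (M : POMDP) : Prop :=
  0 < M.numAct ∧
  (∀ a s s', 0 ≤ M.trans a s s') ∧ (∀ a s, ∑ s', M.trans a s s' = 1) ∧
  (∀ a s o, 0 ≤ M.obs a s o) ∧ (∀ a s, ∑ o, M.obs a s o = 1) ∧
  (∀ s, 0 ≤ M.start s) ∧ ∑ s, M.start s = 1 ∧
  (∃! s, M.goal s) ∧ ∀ a s, M.goal s → M.trans a s s = 1

/-- The unnormalised belief after a history of observations (the latest one first) under a policy;
its total mass is the probability of the history. -/
def beliefAfter (M : POMDP) (π : List (Fin M.numObs) → Fin M.numAct) :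
    List (Fin M.numObs) → Fin M.dim → ℚ
  | [] => M.start
  | o :: h => fun s' => M.obs (π h) s' o * ∑ s, M.trans (π h) s s' * M.beliefAfter π h s

/-- Some policy leads to the goal state in a finite number of steps with probability one: after each
history of positive probability the normalised belief is concentrated on the goal. -/
def GoalReachable (M : POMDP) : Prop :=
  ∃ (n : ℕ) (π : List (Fin M.numObs) → Fin M.numAct), ∀ h, h.length = n →
    let b := M.beliefAfter π h
    ∑ s, b s ≠ 0 → ∀ s, M.goal s → b s / ∑ s', b s' = 1

/-- Codes: `(number of states, number of observations, actions, starting belief, goal state)`, where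
an action is coded by its transition matrix and its observation matrix. -/
abbrev Code : Type := ℕ × ℕ × List (MatCode × MatCode) × List RatCode × ℕ

def ofCode : Code → POMDP
  | (d, K, acts, b, g) =>
    { dim := d
      numObs := K
      numAct := acts.length
      trans := fun a s s' => (acts.get a).1.entry s s'
      obs := fun a s o => (acts.get a).2.entry s o
      start := fun s => RatCode.val (b.getD s (0, 0))
      goal := fun s => (s : ℕ) = g }

end POMDP

/-- Goal-state reachability for POMDPs (with rational probabilities). -/
def POMDPReachability : DecisionProblem where
  Inst := POMDP.Code
  code := inferInstance
  valid c := (POMDP.ofCode c).IsGoalModel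
  yes c := (POMDP.ofCode c).GoalReachable

/-! # The logical structure of resource-dependent undecidability -/

/-- The problem `D₁` of the theory `T₁` and the analogous problem `D₂` of the theory `T₂` fit the
scheme `D_i[f] = (¬ Q ∧ H_i) ∨ (Q ∧ H_{f(i)})`, where `Q` distinguishes the two theories, the halting
problem reduces to `H`, and `f` maps the instances of `H` onto a non-trivially decidable subset `S`
of them. -/
structure FitsResourceDependence (Q : PhysicalTheory → Prop) (T₁ T₂ : PhysicalTheory)
    (D₁ D₂ H : DecisionProblem) (S : Set H.Inst) (f : H.Inst → H.Inst) : Prop where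
  question_false : ¬ Q T₁
  question_true : Q T₂
  halting_reduces : Halting.Reduces H
  source_undecidable : ¬ H.IsDecidable
  map_computable : Computable f
  map_mapsTo : ∀ i, H.valid i → H.valid (f i) ∧ f i ∈ S
  map_onto : ∀ j, H.valid j → j ∈ S → ∃ i, H.valid i ∧ f i = j
  subset_decidable : (H.restrict S).NontriviallyDecidable
  /-- With the negative answer to `Q`, the scheme reduces to the problem of `T₁`. -/
  reduces_one : (H.resourceDependent f (Q T₁)).Reduces D₁
  /-- With the affirmative answer to `Q`, the scheme is equivalent to the problem of `T₂`. -/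
  reduces_two : (H.resourceDependent f (Q T₂)).Reduces D₂
  reduces_two' : D₂.Reduces (H.resourceDependent f (Q T₂))
  undecidable_one : ¬ D₁.IsDecidable
  decidable_two : D₂.NontriviallyDecidable

end ResUndec

end

namespace ResUndec

/-! # Primitive recursive arithmetic on codes -/

/-! The decidable half rests on absence of cancellation. For nonnegative matrices the support of a
product applied to a nonnegative vector depends only on which entries vanish, so mortality, hence
CMOP, becomes a game on the finitely many subsets of the levels: can the full support be emptied?
POMDP reachability is the same game with observations chosen by an adversary: can the support of the
belief be forced into the goal? Winning and losing positions both have finite, primitively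
recursively checkable certificates, and Post's theorem gives decidability
(`computablePred_exists_gameWin`). Since absolute values keep the zero pattern, mortality of |A| is
this game too. All classical reductions then hold because a decidable problem reduces to any problem
with both answers (`DecisionProblem.IsDecidable.reduces`).

In both theories a sequence of outcomes is impossible iff its total matrix is 0: the completely
mixed state detects this in the quantum case, the pure levels in the classical case. So QMOP is
mortality restricted to tuples with ∑ AᵀA = 1, and the task is to reduce the halting problem to that
restricted problem.

A fixed universal partial recursive function is computed by one nondeterministic register program
(`exists_regProg_of_partrec`), and the program becomes a finite automaton
(`RegProg.exists_automaton`). A configuration is an integer vector v on which instructions act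
linearly, and the conditions of a step (right source state, equal registers) are vanishing linear
forms. On v ⊗ v the squares of such forms are themselves linear, so an additional coordinate can
accumulate a sum of squares of all violations. Thus halting says that some word g in finitely many
integer matrices satisfies τ₀ · (g x) = 0, where only x depends on the input
(`exists_word_iff_automaton`).

To obtain a measurement, take multiples of the matrices g, the rank-one matrix s τ₀ᵀ with s = x/|x|,
and further rank-one matrices s τᵀ that complete the sum to the identity (`exists_kraus_family`).
The product (s τ₀ᵀ) g (s τ₀ᵀ) vanishes exactly when τ₀ · (g x) = 0. The completing rows must not
create other zero products: they are integer rows with an odd entry at a coordinate where every g x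
equals 1 and even entries elsewhere, so τ · (g x) is odd (`exists_odd_completion`, from Lagrange's
four squares). Since |s| = 1, the completion is independent of s and therefore of the input. The
length |x| is rational because |v ⊗ v| = |v|².

As mortality is recursively enumerable, it reduces to halting and hence to QMOP
(`MMP_reduces_MOP_quantum`). QMOP reduces to QOMDP reachability by adding a goal level and letting
action j be a bet on outcome j: a wrong bet sends the state to the goal, so the goal is certain iff
a sequence of correct bets has probability 0 (`MOP_quantum_reduces_QOMDPReachability`). -/

theorem encode_int_ofNat (n : ℕ) : Encodable.encode (n : ℤ) = 2 * n := rfl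

theorem encode_int_negSucc (n : ℕ) : Encodable.encode (Int.negSucc n) = 2 * n + 1 := rfl

theorem primrec_intCast : Primrec (fun n : ℕ => (n : ℤ)) :=
  Primrec.encode_iff.1 (Primrec.nat_double.of_eq fun _ => rfl)

theorem primrec_int_toNat : Primrec Int.toNat := by
  refine (Primrec.ite (c := fun z : ℤ => Encodable.encode z % 2 = 0)
    (f := fun z => Encodable.encode z / 2) (g := fun _ => 0) ?_ ?_ (Primrec.const 0)).of_eq ?_
  · exact Primrec.eq.comp (Primrec.nat_mod.comp Primrec.encode (Primrec.const 2)) (Primrec.const 0)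
  · exact Primrec.nat_div.comp Primrec.encode (Primrec.const 2)
  · rintro (n | n)
    · have := encode_int_ofNat n
      simp only [Int.ofNat_eq_natCast, this]; simp
    · simp only [encode_int_negSucc]
      simp [Nat.add_mod]

/-- The code of z is 2|z| for z ≥ 0 and 2|z| - 1 for z < 0, so in both cases half of its successor,
rounded down, is |z|. -/
theorem primrec_int_natAbs : Primrec Int.natAbs := by
  refine (Primrec.nat_div.comp (Primrec.succ.comp Primrec.encode) (Primrec.const 2)).of_eq ?_
  rintro (n | n)
  · have := encode_int_ofNat n
    simp only [Int.ofNat_eq_natCast, this]; simp; omega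
  · simp only [encode_int_negSucc]
    simp; omega

theorem primrec_int_neg_toNat : Primrec (fun z : ℤ => (-z).toNat) :=
  (Primrec.nat_sub.comp primrec_int_natAbs primrec_int_toNat).of_eq fun z => by
    show z.natAbs - z.toNat = (-z).toNat; omega

/-- Addition and multiplication of integers are obtained from this: split each argument into
positive and negative part, compute with natural numbers, and take one difference at the end. -/
theorem primrec_int_subNat : Primrec₂ (fun a b : ℕ => (a : ℤ) - b) := by
  refine Primrec.encode_iff.1 ((Primrec.ite (c := fun p : ℕ × ℕ => p.2 ≤ p.1)
    (f := fun p : ℕ × ℕ => 2 * (p.1 - p.2)) (g := fun p : ℕ × ℕ => 2 * (p.2 - p.1 - 1) + 1) ?_ ?_ ?_).of_eq ?_)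
  · exact Primrec.nat_le.comp Primrec.snd Primrec.fst
  · exact Primrec.nat_double.comp (Primrec.nat_sub.comp Primrec.fst Primrec.snd)
  · exact Primrec.nat_double_succ.comp
      (Primrec.nat_sub.comp (Primrec.nat_sub.comp Primrec.snd Primrec.fst) (Primrec.const 1))
  · rintro ⟨a, b⟩
    by_cases h : b ≤ a
    · simp only [h, if_true]
      rw [← encode_int_ofNat, Nat.cast_sub h]
    · simp only [h, if_false]
      rw [← encode_int_negSucc]
      congr 1
      omega

theorem primrec_int_add : Primrec₂ ((· + ·) : ℤ → ℤ → ℤ) := by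
  have h1 := primrec_int_toNat
  have h2 := primrec_int_neg_toNat
  refine (primrec_int_subNat.comp
    (Primrec.nat_add.comp (h1.comp Primrec.fst) (h1.comp Primrec.snd))
    (Primrec.nat_add.comp (h2.comp Primrec.fst) (h2.comp Primrec.snd))).of_eq ?_
  rintro ⟨a, b⟩
  simp only
  omega

theorem primrec_int_mul : Primrec₂ ((· * ·) : ℤ → ℤ → ℤ) := by
  have h1 := primrec_int_toNat
  have h2 := primrec_int_neg_toNat
  refine (primrec_int_subNat.comp
    (Primrec.nat_add.comp (Primrec.nat_mul.comp (h1.comp Primrec.fst) (h1.comp Primrec.snd))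
      (Primrec.nat_mul.comp (h2.comp Primrec.fst) (h2.comp Primrec.snd)))
    (Primrec.nat_add.comp (Primrec.nat_mul.comp (h1.comp Primrec.fst) (h2.comp Primrec.snd))
      (Primrec.nat_mul.comp (h2.comp Primrec.fst) (h1.comp Primrec.snd)))).of_eq ?_
  rintro ⟨a, b⟩
  have ha : (a.toNat : ℤ) - ((-a).toNat : ℤ) = a := by omega
  have hb : (b.toNat : ℤ) - ((-b).toNat : ℤ) = b := by omega
  simp only
  push_cast
  conv_rhs => rw [← ha, ← hb]
  ring

theorem primrec_int_abs : Primrec (fun z : ℤ => |z|) :=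
  (primrec_intCast.comp primrec_int_natAbs).of_eq fun z => by simp

/-- Addition of codes of rational numbers. -/
def RatCode.add (p q : RatCode) : RatCode :=
  (p.1 * ((q.2 + 1 : ℕ) : ℤ) + q.1 * ((p.2 + 1 : ℕ) : ℤ), p.2 * q.2 + p.2 + q.2)

/-- Multiplication of codes of rational numbers. -/
def RatCode.mul (p q : RatCode) : RatCode :=
  (p.1 * q.1, p.2 * q.2 + p.2 + q.2)

/-- A code of a given rational number. -/
def RatCode.ofRat (q : ℚ) : RatCode := (q.num, q.den - 1)

theorem RatCode.val_add (p q : RatCode) : (RatCode.add p q).val = p.val + q.val := by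
  have h1 : (p.2 : ℚ) + 1 ≠ 0 := by positivity
  have h2 : (q.2 : ℚ) + 1 ≠ 0 := by positivity
  have h3 : ((p.2 * q.2 + p.2 + q.2 : ℕ) : ℚ) + 1 = ((p.2 : ℚ) + 1) * ((q.2 : ℚ) + 1) := by
    push_cast; ring
  simp only [RatCode.val, RatCode.add, h3]
  push_cast
  field_simp

theorem RatCode.val_mul (p q : RatCode) : (RatCode.mul p q).val = p.val * q.val := by
  have h1 : (p.2 : ℚ) + 1 ≠ 0 := by positivity
  have h2 : (q.2 : ℚ) + 1 ≠ 0 := by positivity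
  have h3 : ((p.2 * q.2 + p.2 + q.2 : ℕ) : ℚ) + 1 = ((p.2 : ℚ) + 1) * ((q.2 : ℚ) + 1) := by
    push_cast; ring
  simp only [RatCode.val, RatCode.mul, h3]
  push_cast
  field_simp

theorem RatCode.val_ofRat (q : ℚ) : (RatCode.ofRat q).val = q := by
  have h : ((q.den - 1 : ℕ) : ℚ) + 1 = q.den := by
    rw [Nat.cast_sub q.den_pos]; simp
  simp only [RatCode.val, RatCode.ofRat, h, Rat.num_div_den]

theorem RatCode.val_eq_zero_iff (q : RatCode) : q.val = 0 ↔ q.1 = 0 := by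
  have h1 : (q.2 : ℚ) + 1 ≠ 0 := by positivity
  simp [RatCode.val, h1]

theorem RatCode.val_nonneg_iff (q : RatCode) : 0 ≤ q.val ↔ 0 ≤ q.1 := by
  have h1 : (0 : ℚ) < (q.2 : ℚ) + 1 := by positivity
  rw [RatCode.val, le_div_iff₀ h1, zero_mul]
  exact_mod_cast Iff.rfl

theorem RatCode.val_zero (n : ℕ) : RatCode.val (0, n) = 0 := by simp [RatCode.val]

theorem primrec_ratCode_add : Primrec₂ RatCode.add := by
  have a1 : Primrec (fun p : RatCode × RatCode => p.1.1) := Primrec.fst.comp Primrec.fst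
  have a2 : Primrec (fun p : RatCode × RatCode => p.1.2) := Primrec.snd.comp Primrec.fst
  have b1 : Primrec (fun p : RatCode × RatCode => p.2.1) := Primrec.fst.comp Primrec.snd
  have b2 : Primrec (fun p : RatCode × RatCode => p.2.2) := Primrec.snd.comp Primrec.snd
  exact Primrec.pair
    (primrec_int_add.comp
      (primrec_int_mul.comp a1 (primrec_intCast.comp (Primrec.succ.comp b2)))
      (primrec_int_mul.comp b1 (primrec_intCast.comp (Primrec.succ.comp a2))))
    (Primrec.nat_add.comp (Primrec.nat_add.comp (Primrec.nat_mul.comp a2 b2) a2) b2)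

theorem primrec_ratCode_mul : Primrec₂ RatCode.mul := by
  have a1 : Primrec (fun p : RatCode × RatCode => p.1.1) := Primrec.fst.comp Primrec.fst
  have a2 : Primrec (fun p : RatCode × RatCode => p.1.2) := Primrec.snd.comp Primrec.fst
  have b1 : Primrec (fun p : RatCode × RatCode => p.2.1) := Primrec.fst.comp Primrec.snd
  have b2 : Primrec (fun p : RatCode × RatCode => p.2.2) := Primrec.snd.comp Primrec.snd
  exact Primrec.pair (primrec_int_mul.comp a1 b1)
    (Primrec.nat_add.comp (Primrec.nat_add.comp (Primrec.nat_mul.comp a2 b2) a2) b2)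

/-- The code of the entry of a coded matrix. -/
def MatCode.entryCode (m : MatCode) (x y : ℕ) : RatCode := (m.getD x []).getD y (0, 0)

theorem MatCode.entry_eq (m : MatCode) (x y : ℕ) : m.entry x y = (m.entryCode x y).val := rfl

theorem primrec_entryCode :
    Primrec (fun p : MatCode × ℕ × ℕ => p.1.entryCode p.2.1 p.2.2) :=
  (Primrec.list_getD ((0, 0) : RatCode)).comp
    ((Primrec.list_getD ([] : List RatCode)).comp Primrec.fst (Primrec.fst.comp Primrec.snd))
    (Primrec.snd.comp Primrec.snd)

section

variable {α : Type} [Primcodable α]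

theorem primrec_entryCode' {m : α → MatCode} {x y : α → ℕ} (hm : Primrec m) (hx : Primrec x)
    (hy : Primrec y) : Primrec fun a => (m a).entryCode (x a) (y a) :=
  primrec_entryCode.comp (Primrec.pair hm (Primrec.pair hx hy))

theorem primrec_ratCode_add' {p q : α → RatCode} (hp : Primrec p) (hq : Primrec q) :
    Primrec fun a => RatCode.add (p a) (q a) := primrec_ratCode_add.comp hp hq

theorem primrec_ratCode_mul' {p q : α → RatCode} (hp : Primrec p) (hq : Primrec q) :
    Primrec fun a => RatCode.mul (p a) (q a) := primrec_ratCode_mul.comp hp hq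

end

/-- The code of the matrix of size `d` with given entries. -/
def MatCode.ofFn (d : ℕ) (f : ℕ → ℕ → RatCode) : MatCode :=
  (List.range d).map fun x => (List.range d).map fun y => f x y

theorem MatCode.entryCode_ofFn {d : ℕ} (f : ℕ → ℕ → RatCode) {x y : ℕ} (hx : x < d) (hy : y < d) :
    (MatCode.ofFn d f).entryCode x y = f x y := by
  simp [MatCode.ofFn, MatCode.entryCode, List.getD_eq_getElem?_getD, hx, hy]

theorem primrec_matCode_ofFn {α : Type*} [Primcodable α] {d : α → ℕ} {f : α → ℕ → ℕ → RatCode}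
    (hd : Primrec d) (hf : Primrec fun p : (α × ℕ) × ℕ => f p.1.1 p.1.2 p.2) :
    Primrec fun a => MatCode.ofFn (d a) (f a) :=
  Primrec.list_map (Primrec.list_range.comp hd)
    (Primrec.list_map (Primrec.list_range.comp (hd.comp Primrec.fst)) hf.to₂).to₂

/-! # Recursive enumerability and bounded quantifiers -/

section

variable {α β : Type} [Primcodable α] [Primcodable β]

/-- Unbounded search through the codes of possible witnesses. All enumerability statements below
come from a primitive recursive check of certificates. -/
theorem rePred_exists {p : α → β → Prop} (hp : PrimrecPred fun x : α × β => p x.1 x.2) :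
    REPred fun a => ∃ b, p a b := by
  classical
  have h1 : Primrec₂ (fun (a : α) (n : ℕ) =>
      ((Encodable.decode (α := β) n).bind fun b => if p a b then some b else none)) := by
    refine Primrec.option_bind (Primrec.decode.comp Primrec.snd) ?_
    refine Primrec.ite (c := fun x : (α × ℕ) × β => p x.1.1 x.2) ?_
      (Primrec.option_some.comp Primrec.snd) (Primrec.const none)
    exact hp.comp (Primrec.pair (Primrec.fst.comp Primrec.fst) Primrec.snd)
  refine (Partrec.dom_re (Partrec.rfindOpt h1.to_comp)).of_eq fun a => ?_
  rw [Nat.rfindOpt_dom]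
  constructor
  · rintro ⟨n, b, hb⟩
    simp only [Option.mem_def, Option.bind_eq_some_iff] at hb
    obtain ⟨c, -, hc⟩ := hb
    by_cases h : p a c
    · exact ⟨c, h⟩
    · simp [h] at hc
  · rintro ⟨b, hb⟩
    exact ⟨Encodable.encode b, b, by simp [hb]⟩

theorem PrimrecPred.forall_mem' {f : α → List β} {p : α → β → Prop} (hf : Primrec f)
    (hp : PrimrecPred fun x : α × β => p x.1 x.2) : PrimrecPred fun a => ∀ b ∈ f a, p a b := by
  have h : PrimrecRel fun (b : β) (a : α) => p a b :=
    hp.comp (Primrec.pair Primrec.snd Primrec.fst)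
  exact h.forall_mem_list.comp hf Primrec.id

theorem PrimrecPred.exists_mem' {f : α → List β} {p : α → β → Prop} (hf : Primrec f)
    (hp : PrimrecPred fun x : α × β => p x.1 x.2) : PrimrecPred fun a => ∃ b ∈ f a, p a b := by
  have h : PrimrecRel fun (b : β) (a : α) => p a b :=
    hp.comp (Primrec.pair Primrec.snd Primrec.fst)
  exact h.exists_mem_list.comp hf Primrec.id

theorem PrimrecPred.forall_lt' {f : α → ℕ} {p : α → ℕ → Prop} (hf : Primrec f)
    (hp : PrimrecPred fun x : α × ℕ => p x.1 x.2) : PrimrecPred fun a => ∀ n < f a, p a n :=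
  (PrimrecPred.forall_mem' (Primrec.list_range.comp hf) hp).of_eq fun a => by simp

theorem PrimrecPred.exists_lt' {f : α → ℕ} {p : α → ℕ → Prop} (hf : Primrec f)
    (hp : PrimrecPred fun x : α × ℕ => p x.1 x.2) : PrimrecPred fun a => ∃ n < f a, p a n :=
  (PrimrecPred.exists_mem' (Primrec.list_range.comp hf) hp).of_eq fun a => by simp

end

/-! # Products of coded matrices -/

/-- The code of a product of coded matrices of size `d`. -/
def MatCode.mul (d : ℕ) (a b : MatCode) : MatCode :=
  MatCode.ofFn d fun x y => (List.range d).foldl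
    (fun acc z => RatCode.add acc (RatCode.mul (a.entryCode x z) (b.entryCode z y))) (0, 0)

/-- A code of the unit matrix of size `d`. -/
def MatCode.one (d : ℕ) : MatCode := MatCode.ofFn d fun x y => if x = y then (1, 0) else (0, 0)

/-- The code of the product of a list of coded matrices of size `d`. -/
def MatCode.prod (d : ℕ) (w : List MatCode) : MatCode := w.foldr (MatCode.mul d) (MatCode.one d)

theorem MatCode.toMatrix_ofFn (d : ℕ) (f : ℕ → ℕ → RatCode) :
    (MatCode.ofFn d f).toMatrix d = Matrix.of fun x y : Fin d => (f x y).val := by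
  ext x y
  simp [MatCode.toMatrix, MatCode.entry_eq, MatCode.entryCode_ofFn f x.2 y.2]

theorem RatCode.val_foldl_add {ι : Type} (l : List ι) (f : ι → RatCode) (a : RatCode) :
    (l.foldl (fun acc z => RatCode.add acc (f z)) a).val
      = a.val + (l.map fun z => (f z).val).sum := by
  induction l generalizing a with
  | nil => simp
  | cons z l ih => simp [ih, RatCode.val_add, add_assoc]

theorem MatCode.toMatrix_mul (d : ℕ) (a b : MatCode) :
    (MatCode.mul d a b).toMatrix d = a.toMatrix d * b.toMatrix d := by
  rw [MatCode.mul, MatCode.toMatrix_ofFn]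
  ext x y
  simp only [Matrix.of_apply, Matrix.mul_apply, RatCode.val_foldl_add, RatCode.val_mul,
    RatCode.val_zero, zero_add, MatCode.toMatrix, MatCode.entry_eq]
  rw [Fin.sum_univ_eq_sum_range (fun z => (a.entryCode x z).val * (b.entryCode z y).val)]
  rfl

theorem MatCode.toMatrix_one (d : ℕ) : (MatCode.one d).toMatrix d = 1 := by
  rw [MatCode.one, MatCode.toMatrix_ofFn]
  ext x y
  by_cases h : x = y
  · subst h; simp [RatCode.val]
  · have : (x : ℕ) ≠ y := fun e => h (Fin.ext e)
    simp [h, this, RatCode.val]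

theorem MatCode.toMatrix_prod (d : ℕ) (w : List MatCode) :
    (MatCode.prod d w).toMatrix d = (w.map fun m => m.toMatrix d).prod := by
  induction w with
  | nil => simp [MatCode.prod, MatCode.toMatrix_one]
  | cons m w ih =>
    rw [List.map_cons, List.prod_cons, ← ih, ← MatCode.toMatrix_mul]
    rfl

theorem primrec_matCode_mul {α : Type} [Primcodable α] {d : α → ℕ} {m m' : α → MatCode}
    (hd : Primrec d) (hm : Primrec m) (hm' : Primrec m') :
    Primrec fun a => MatCode.mul (d a) (m a) (m' a) := by
  have h : Primrec₂ fun (p : (α × ℕ) × ℕ) (q : RatCode × ℕ) =>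
      RatCode.add q.1
        (RatCode.mul ((m p.1.1).entryCode p.1.2 q.2) ((m' p.1.1).entryCode q.2 p.2)) := by
    have h0 : Primrec fun x : ((α × ℕ) × ℕ) × (RatCode × ℕ) => x.1.1.1 :=
      Primrec.fst.comp (Primrec.fst.comp Primrec.fst)
    have h1 : Primrec fun x : ((α × ℕ) × ℕ) × (RatCode × ℕ) => x.1.1.2 :=
      Primrec.snd.comp (Primrec.fst.comp Primrec.fst)
    have h2 : Primrec fun x : ((α × ℕ) × ℕ) × (RatCode × ℕ) => x.1.2 :=
      Primrec.snd.comp Primrec.fst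
    have h3 : Primrec fun x : ((α × ℕ) × ℕ) × (RatCode × ℕ) => x.2.1 :=
      Primrec.fst.comp Primrec.snd
    have h4 : Primrec fun x : ((α × ℕ) × ℕ) × (RatCode × ℕ) => x.2.2 :=
      Primrec.snd.comp Primrec.snd
    exact primrec_ratCode_add' h3 (primrec_ratCode_mul'
      (primrec_entryCode' (hm.comp h0) h1 h4) (primrec_entryCode' (hm'.comp h0) h4 h2))
  have h' : Primrec fun p : (α × ℕ) × ℕ => (List.range (d p.1.1)).foldl
      (fun acc z => RatCode.add acc
        (RatCode.mul ((m p.1.1).entryCode p.1.2 z) ((m' p.1.1).entryCode z p.2)))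
      ((0, 0) : RatCode) :=
    Primrec.list_foldl (Primrec.list_range.comp
      (hd.comp (Primrec.fst.comp Primrec.fst))) (Primrec.const _) h
  exact primrec_matCode_ofFn (f := fun a x y => (List.range (d a)).foldl
    (fun acc z => RatCode.add acc (RatCode.mul ((m a).entryCode x z) ((m' a).entryCode z y)))
    ((0, 0) : RatCode)) hd h'

theorem primrec_matCode_one : Primrec MatCode.one := by
  refine primrec_matCode_ofFn Primrec.id ?_
  exact Primrec.ite (Primrec.eq.comp (Primrec.snd.comp Primrec.fst) Primrec.snd)
    (Primrec.const _) (Primrec.const _)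

theorem primrec_matCode_prod {α : Type} [Primcodable α] {d : α → ℕ} {w : α → List MatCode}
    (hd : Primrec d) (hw : Primrec w) : Primrec fun a => MatCode.prod (d a) (w a) := by
  have h : Primrec₂ fun (a : α) (q : MatCode × MatCode) => MatCode.mul (d a) q.1 q.2 :=
    primrec_matCode_mul (hd.comp Primrec.fst) (Primrec.fst.comp Primrec.snd)
      (Primrec.snd.comp Primrec.snd)
  exact Primrec.list_foldr hw (primrec_matCode_one.comp hd) h

theorem MatCode.toMatrix_eq_zero_iff (m : MatCode) (d : ℕ) :
    m.toMatrix d = 0 ↔ ∀ x < d, ∀ y < d, (m.entryCode x y).1 = 0 := by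
  constructor
  · intro h x hx y hy
    have := congrFun (congrFun h ⟨x, hx⟩) ⟨y, hy⟩
    exact (RatCode.val_eq_zero_iff _).1 this
  · intro h
    ext x y
    exact (RatCode.val_eq_zero_iff _).2 (h x x.2 y y.2)

/-- Words of indices live in a type that depends on the instance; words of list members live in a
fixed coded type, as a search needs. -/
theorem exists_list_fin_iff {β : Type} (l : List β) (P : List β → Prop) :
    (∃ w : List (Fin l.length), P (w.map l.get)) ↔ ∃ w : List β, (∀ m ∈ w, m ∈ l) ∧ P w := by
  constructor
  · rintro ⟨w, h⟩
    refine ⟨_, ?_, h⟩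
    intro m hm
    obtain ⟨j, -, rfl⟩ := List.mem_map.1 hm
    exact List.get_mem l j
  · rintro ⟨w, hw, h⟩
    have : w ∈ Set.range (List.map l.get) := by
      rw [Set.range_list_map]
      intro m hm
      obtain ⟨j, hj⟩ := List.get_of_mem (hw m hm)
      exact ⟨j, hj⟩
    obtain ⟨v, rfl⟩ := this
    exact ⟨v, h⟩

theorem MMP_yes_iff (c : TupleCode) : MMP.yes c ↔ ∃ w : List MatCode, (∀ m ∈ w, m ∈ c.2) ∧
    w ≠ [] ∧ (w.map fun m => m.toMatrix c.1).prod = 0 := by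
  rw [← exists_list_fin_iff c.2 fun w => w ≠ [] ∧ (w.map fun m => m.toMatrix c.1).prod = 0]
  refine exists_congr fun w => ?_
  rw [List.map_map, Ne, Ne, List.map_eq_nil_iff]
  rfl

theorem rePred_MMP : REPred (α := TupleCode) MMP.yes := by
  have h : PrimrecPred fun x : TupleCode × List MatCode => (∀ m ∈ x.2, m ∈ x.1.2) ∧
      x.2 ≠ [] ∧ ∀ i < x.1.1, ∀ j < x.1.1,
        ((MatCode.prod x.1.1 x.2).entryCode i j).1 = 0 := by
    have hd : Primrec fun x : TupleCode × List MatCode => x.1.1 := Primrec.fst.comp Primrec.fst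
    refine PrimrecPred.and ?_ (PrimrecPred.and ?_ ?_)
    · refine (PrimrecPred.forall_mem' (p := fun (x : TupleCode × List MatCode) m =>
        ∃ m' ∈ x.1.2, m' = m) Primrec.snd ?_).of_eq fun x => by simp
      refine PrimrecPred.exists_mem' (Primrec.snd.comp (Primrec.fst.comp Primrec.fst)) ?_
      exact Primrec.eq.comp Primrec.snd (Primrec.snd.comp Primrec.fst)
    · exact (Primrec.eq.comp Primrec.snd (Primrec.const [])).not
    · refine PrimrecPred.forall_lt' hd (PrimrecPred.forall_lt' (hd.comp Primrec.fst) ?_)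
      have h0 : Primrec fun x : ((TupleCode × List MatCode) × ℕ) × ℕ => x.1.1 :=
        Primrec.fst.comp Primrec.fst
      exact Primrec.eq.comp (Primrec.fst.comp (primrec_entryCode'
        (primrec_matCode_prod (hd.comp h0) (Primrec.snd.comp h0))
        (Primrec.snd.comp Primrec.fst) Primrec.snd)) (Primrec.const 0)
  refine (rePred_exists (p := fun (c : TupleCode) (w : List MatCode) => (∀ m ∈ w, m ∈ c.2) ∧
      w ≠ [] ∧ ∀ i < c.1, ∀ j < c.1, ((MatCode.prod c.1 w).entryCode i j).1 = 0) h).of_eq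
    fun c => ?_
  rw [MMP_yes_iff]
  simp only [← MatCode.toMatrix_eq_zero_iff, MatCode.toMatrix_prod]

/-- A recursively enumerable problem reduces to the halting problem. -/
theorem reduces_halting_of_rePred (P : DecisionProblem) (h : REPred P.yes) :
    P.Reduces Halting := by
  obtain ⟨c, hc⟩ := Nat.Partrec.Code.exists_code.1 h
  refine ⟨fun i => (c, Encodable.encode i),
    (Primrec.pair (Primrec.const c) Primrec.encode).to_comp, fun i _ => ⟨trivial, ?_⟩⟩
  change _ ↔ (c.eval (Encodable.encode i)).Dom
  rw [hc]
  simp [Part.assert]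

theorem DecisionProblem.Reduces.trans {P Q R : DecisionProblem} (h : P.Reduces Q)
    (h' : Q.Reduces R) : P.Reduces R := by
  obtain ⟨f, hf, hf'⟩ := h
  obtain ⟨g, hg, hg'⟩ := h'
  exact ⟨fun i => g (f i), hg.comp hf, fun i hi => ⟨(hg' _ (hf' i hi).1).1,
    (hf' i hi).2.trans (hg' _ (hf' i hi).1).2⟩⟩

/-- A decidable problem reduces to every problem with both answers. -/
theorem DecisionProblem.IsDecidable.reduces {P R : DecisionProblem} (h : P.IsDecidable)
    (h1 : ∃ i, R.valid i ∧ R.yes i) (h0 : ∃ i, R.valid i ∧ ¬ R.yes i) : P.Reduces R := by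
  obtain ⟨g, hg, hg'⟩ := h
  obtain ⟨a, ha, ha'⟩ := h1
  obtain ⟨b, hb, hb'⟩ := h0
  refine ⟨fun i => bif g i then a else b,
    Computable.cond hg (Computable.const a) (Computable.const b), fun i hi => ?_⟩
  have := hg' i hi
  cases hgi : g i
  · simpa [hb, hb', hgi] using this
  · simpa [ha, ha', hgi] using this

theorem not_isDecidable_of_halting_reduces {P : DecisionProblem} (h : Halting.Reduces P) :
    ¬ P.IsDecidable := by
  rintro ⟨g, hg, hg'⟩
  obtain ⟨f, hf, hf'⟩ := h
  refine ComputablePred.halting_problem 0 (ComputablePred.computable_iff.2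
    ⟨fun c => g (f (c, 0)), hg.comp (hf.comp
      (Computable.pair Computable.id (Computable.const 0))), ?_⟩)
  funext c
  exact propext ((hf' (c, 0) trivial).2.trans (hg' _ (hf' (c, 0) trivial).1).symm)

/-! # Reachability games on supports -/

section Game

variable (d K A : ℕ) (E : ℕ → ℕ → ℕ → ℕ → Prop) (G : ℕ → Prop)

/-- The levels below `d` that can be reached from `X` by action `a` with observation `o`. -/
def gameNext (X : Set ℕ) (a o : ℕ) : Set ℕ := {y | y < d ∧ ∃ x ∈ X, x < d ∧ E a o x y}

/-- At most `n` suitable actions force the support into `G`, whatever is observed. -/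
def GameWin : ℕ → Set ℕ → Prop
  | 0, X => ∀ x ∈ X, x < d → G x
  | n + 1, X => (∀ x ∈ X, x < d → G x) ∨ ∃ a < A, ∀ o < K, GameWin n (gameNext d E X a o)

/-- The list `L` agrees with the set `X` below `d`. -/
def Lists (L : List ℕ) (X : Set ℕ) : Prop := ∀ y < d, y ∈ L ↔ y ∈ X

variable {d K A E G}

theorem gameNext_congr {X Y : Set ℕ} (h : ∀ y < d, y ∈ X ↔ y ∈ Y) (a o : ℕ) :
    gameNext d E X a o = gameNext d E Y a o := by
  ext y
  simp only [gameNext, Set.mem_ofPred_eq]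
  refine and_congr_right fun _ => exists_congr fun x => ?_
  constructor
  · rintro ⟨h1, h2, h3⟩; exact ⟨(h x h2).1 h1, h2, h3⟩
  · rintro ⟨h1, h2, h3⟩; exact ⟨(h x h2).2 h1, h2, h3⟩

/-- Positions matter only below `d`; this is what lets finite lists of numbers stand for arbitrary
sets in certificates. -/
theorem gameWin_congr {X Y : Set ℕ} (h : ∀ y < d, y ∈ X ↔ y ∈ Y) (n : ℕ) :
    GameWin d K A E G n X ↔ GameWin d K A E G n Y := by
  have h0 : (∀ x ∈ X, x < d → G x) ↔ ∀ x ∈ Y, x < d → G x :=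
    forall_congr' fun x => ⟨fun f h1 h2 => f ((h x h2).2 h1) h2,
      fun f h1 h2 => f ((h x h2).1 h1) h2⟩
  cases n with
  | zero => exact h0
  | succ n => simp only [GameWin, h0, gameNext_congr h]

theorem gameWin_succ {n : ℕ} {X : Set ℕ} (h : GameWin d K A E G n X) :
    GameWin d K A E G (n + 1) X := by
  induction n generalizing X with
  | zero => exact Or.inl h
  | succ n ih =>
    rcases h with h | ⟨a, ha, h⟩
    · exact Or.inl h
    · exact Or.inr ⟨a, ha, fun o ho => ih (h o ho)⟩

theorem gameWin_mono {m n : ℕ} (hmn : m ≤ n) {X : Set ℕ} (h : GameWin d K A E G m X) :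
    GameWin d K A E G n X := by
  induction hmn with
  | refl => exact h
  | step _ ih => exact gameWin_succ ih

variable (d K A E G)

/-- A certificate that all sets listed by `C` are winning. -/
def WinCert (C : List (List ℕ)) : Prop :=
  ∀ i < C.length, (∀ x ∈ C.getD i [], x < d → G x) ∨
    ∃ a < A, ∀ o < K, ∃ j < i, Lists d (C.getD j []) (gameNext d E {x | x ∈ C.getD i []} a o)

/-- A certificate that no set listed by `C` is winning. -/
def LoseCert (C : List (List ℕ)) : Prop :=
  ∀ X ∈ C, (∃ x ∈ X, x < d ∧ ¬ G x) ∧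
    ∀ a < A, ∃ o < K, ∃ Y ∈ C, Lists d Y (gameNext d E {x | x ∈ X} a o)

variable {d K A E G}

/-- Each position is justified by positions with smaller index, so justifications cannot be circular
and strong induction on the index yields a number of rounds. -/
theorem WinCert.win {C : List (List ℕ)} (h : WinCert d K A E G C) (i : ℕ) (hi : i < C.length) :
    ∃ n, GameWin d K A E G n {x | x ∈ C.getD i []} := by
  induction i using Nat.strong_induction_on with
  | _ i ih =>
    rcases h i hi with h0 | ⟨a, ha, h1⟩
    · exact ⟨0, h0⟩
    · choose! j hj hL using h1
      have h2 : ∀ o < K, ∃ n, GameWin d K A E G n (gameNext d E {x | x ∈ C.getD i []} a o) := by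
        intro o ho
        obtain ⟨n, hn⟩ := ih (j o) (hj o ho) ((hj o ho).trans hi)
        exact ⟨n, (gameWin_congr (hL o ho) n).1 hn⟩
      choose! n hn using h2
      refine ⟨(Finset.range K).sup n + 1, Or.inr ⟨a, ha, fun o ho => ?_⟩⟩
      exact gameWin_mono (Finset.le_sup (Finset.mem_range.2 ho)) (hn o ho)

open Classical in
/-- The subsets of `{0, …, d - 1}` with a given property, as lists. -/
noncomputable def subsetLists (d : ℕ) (P : Set ℕ → Prop) : List (List ℕ) :=
  ((Finset.range d).powerset.filter fun s : Finset ℕ => P (s : Set ℕ)).toList.map Finset.toList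

theorem mem_subsetLists {P : Set ℕ → Prop} {L : List ℕ} (h : L ∈ subsetLists d P) :
    P {x | x ∈ L} := by
  simp only [subsetLists, List.mem_map, Finset.mem_toList, Finset.mem_filter] at h
  obtain ⟨s, ⟨-, hs⟩, rfl⟩ := h
  simpa using hs

theorem exists_mem_subsetLists {P : Set ℕ → Prop}
    (hP : ∀ X Y : Set ℕ, (∀ y < d, y ∈ X ↔ y ∈ Y) → P X → P Y) {X : Set ℕ} (hX : P X) :
    ∃ L ∈ subsetLists d P, Lists d L X := by
  classical
  refine ⟨((Finset.range d).filter fun y => y ∈ X).toList, ?_, fun y hy => by simp [hy]⟩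
  refine List.mem_map.2 ⟨_, ?_, rfl⟩
  simp only [Finset.mem_toList, Finset.mem_filter, Finset.mem_powerset]
  exact ⟨Finset.filter_subset _ _, hP _ _ (fun y hy => by simp [hy]) hX⟩

/-- List all positions won in 0 rounds, then all won in at most 1 round, and so on. The replies to a
position of one block are found in an earlier block. -/
theorem exists_winCert (n : ℕ) : ∃ C, WinCert d K A E G C ∧
    ∀ X, GameWin d K A E G n X → ∃ i < C.length, Lists d (C.getD i []) X := by
  have hP : ∀ n, ∀ X Y : Set ℕ, (∀ y < d, y ∈ X ↔ y ∈ Y) → GameWin d K A E G n X →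
      GameWin d K A E G n Y := fun n X Y h => (gameWin_congr h n).1
  have key : ∀ n (C : List (List ℕ)), ∀ X, GameWin d K A E G n X →
      ∃ i < (C ++ subsetLists d (GameWin d K A E G n)).length,
        Lists d ((C ++ subsetLists d (GameWin d K A E G n)).getD i []) X := by
    intro n C X hX
    obtain ⟨L, hL, hLX⟩ := exists_mem_subsetLists (hP n) hX
    obtain ⟨i, hi, rfl⟩ := List.mem_iff_getElem.1 (List.mem_append_right C hL)
    refine ⟨i, hi, ?_⟩
    rwa [List.getD_eq_getElem _ _ hi]
  induction n with
  | zero =>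
    refine ⟨subsetLists d (GameWin d K A E G 0), fun i hi => Or.inl ?_, key 0 []⟩
    rw [List.getD_eq_getElem _ _ hi]
    exact mem_subsetLists (List.getElem_mem hi)
  | succ n ih =>
    obtain ⟨C, hC, hC'⟩ := ih
    refine ⟨C ++ subsetLists d (GameWin d K A E G (n + 1)), fun i hi => ?_, key (n + 1) C⟩
    by_cases hiC : i < C.length
    · rw [List.getD_append _ _ _ _ hiC]
      refine (hC i hiC).imp_right ?_
      rintro ⟨a, ha, h⟩
      refine ⟨a, ha, fun o ho => ?_⟩
      obtain ⟨j, hj, hL⟩ := h o ho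
      exact ⟨j, hj, by rwa [List.getD_append _ _ _ _ (hj.trans hiC)]⟩
    · push Not at hiC
      have hmem : (C ++ subsetLists d (GameWin d K A E G (n + 1))).getD i [] ∈
          subsetLists d (GameWin d K A E G (n + 1)) := by
        rw [List.length_append] at hi
        rw [List.getD_append_right _ _ _ _ hiC, List.getD_eq_getElem _ _ (by omega)]
        exact List.getElem_mem _
      refine (mem_subsetLists hmem).imp_right ?_
      rintro ⟨a, ha, h⟩
      refine ⟨a, ha, fun o ho => ?_⟩
      obtain ⟨j, hj, hL⟩ := hC' _ (h o ho)
      exact ⟨j, hj.trans_le hiC, by rwa [List.getD_append _ _ _ _ hj]⟩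

theorem exists_gameWin_iff (S : Set ℕ) : (∃ n, GameWin d K A E G n S) ↔
    ∃ C, WinCert d K A E G C ∧ ∃ i < C.length, Lists d (C.getD i []) S := by
  constructor
  · rintro ⟨n, hn⟩
    obtain ⟨C, hC, hC'⟩ := exists_winCert (d := d) (K := K) (A := A) (E := E) (G := G) n
    exact ⟨C, hC, hC' S hn⟩
  · rintro ⟨C, hC, i, hi, hL⟩
    obtain ⟨n, hn⟩ := hC.win i hi
    exact ⟨n, (gameWin_congr hL n).1 hn⟩

/-- A losing certificate is an invariant family: every action allows an observation that stays
inside it, outside the goal. The family of all positions that are not winning has this property, and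
it is finite up to agreement below `d`. -/
theorem not_exists_gameWin_iff (S : Set ℕ) : (¬ ∃ n, GameWin d K A E G n S) ↔
    ∃ C, LoseCert d K A E G C ∧ ∃ X ∈ C, Lists d X S := by
  constructor
  · intro hS
    have hP : ∀ X Y : Set ℕ, (∀ y < d, y ∈ X ↔ y ∈ Y) → (¬ ∃ n, GameWin d K A E G n X) →
        ¬ ∃ n, GameWin d K A E G n Y := by
      rintro X Y h hX ⟨n, hn⟩
      exact hX ⟨n, (gameWin_congr h n).2 hn⟩
    refine ⟨subsetLists d fun X => ¬ ∃ n, GameWin d K A E G n X, fun X hX => ?_,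
      exists_mem_subsetLists hP hS⟩
    have hX' := mem_subsetLists hX
    constructor
    · by_contra hcon
      push Not at hcon
      exact hX' ⟨0, hcon⟩
    · intro a ha
      have : ∃ o < K, ¬ ∃ n, GameWin d K A E G n (gameNext d E {x | x ∈ X} a o) := by
        by_contra hcon
        push Not at hcon
        choose! n hn using hcon
        -- Finitely many observations have a common bound on the remaining rounds, so a position all
        -- of whose successors are winning would be winning itself.
        exact hX' ⟨(Finset.range K).sup n + 1, Or.inr ⟨a, ha, fun o ho =>
          gameWin_mono (Finset.le_sup (Finset.mem_range.2 ho)) (hn o ho)⟩⟩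
      obtain ⟨o, ho, h⟩ := this
      exact ⟨o, ho, exists_mem_subsetLists hP h⟩
  · rintro ⟨C, hC, X, hX, hXS⟩ ⟨n, hn⟩
    have key : ∀ n, ∀ X ∈ C, ¬ GameWin d K A E G n {x | x ∈ X} := by
      intro n
      induction n with
      | zero =>
        rintro X hX h
        obtain ⟨⟨x, hx, hxd, hxG⟩, -⟩ := hC X hX
        exact hxG (h x hx hxd)
      | succ n ih =>
        rintro X hX (h | ⟨a, ha, h⟩)
        · obtain ⟨⟨x, hx, hxd, hxG⟩, -⟩ := hC X hX
          exact hxG (h x hx hxd)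
        · obtain ⟨o, ho, Y, hY, hL⟩ := (hC X hX).2 a ha
          exact ih Y hY ((gameWin_congr hL n).2 (h o ho))
    exact key n X hX ((gameWin_congr hXS n).2 hn)

end Game

section

variable {α : Type} [Primcodable α]

theorem primrecPred_mem {β : Type} [Primcodable β] {f : α → β} {g : α → List β} (hf : Primrec f)
    (hg : Primrec g) : PrimrecPred fun a => f a ∈ g a :=
  (PrimrecPred.exists_mem' (p := fun a b => b = f a) hg
    (Primrec.eq.comp Primrec.snd (hf.comp Primrec.fst))).of_eq fun a => by simp

theorem PrimrecPred.imp' {p q : α → Prop} (hp : PrimrecPred p) (hq : PrimrecPred q) :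
    PrimrecPred fun a => p a → q a :=
  (hp.not.or hq).of_eq fun a => by tauto

theorem PrimrecPred.iff' {p q : α → Prop} (hp : PrimrecPred p) (hq : PrimrecPred q) :
    PrimrecPred fun a => p a ↔ q a :=
  ((PrimrecPred.imp' hp hq).and (PrimrecPred.imp' hq hp)).of_eq fun a => by tauto

theorem primrec_getD_nil {β : Type} [Primcodable β] {f : α → List (List β)} {n : α → ℕ}
    (hf : Primrec f) (hn : Primrec n) : Primrec fun a => (f a).getD (n a) [] :=
  (Primrec.list_getD []).comp hf hn

variable {d K A : α → ℕ} {E : α → ℕ → ℕ → ℕ → ℕ → Prop} {G S : α → ℕ → Prop}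

theorem primrecPred_lists_gameNext (hd : Primrec d)
    (hE : ∀ {β : Type} [Primcodable β] {t : β → α} {a o x y : β → ℕ}, Primrec t → Primrec a →
      Primrec o → Primrec x → Primrec y → PrimrecPred fun b => E (t b) (a b) (o b) (x b) (y b))
    {β : Type} [Primcodable β] {t : β → α} {Y X : β → List ℕ} {a o : β → ℕ}
    (ht : Primrec t) (hY : Primrec Y) (hX : Primrec X) (ha : Primrec a) (ho : Primrec o) :
    PrimrecPred fun b => Lists (d (t b)) (Y b)
      (gameNext (d (t b)) (E (t b)) {x | x ∈ X b} (a b) (o b)) := by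
  refine PrimrecPred.forall_lt' (hd.comp ht) (PrimrecPred.iff'
    (primrecPred_mem Primrec.snd (hY.comp Primrec.fst)) (PrimrecPred.and
      (Primrec.nat_lt.comp Primrec.snd ((hd.comp ht).comp Primrec.fst)) ?_))
  refine PrimrecPred.exists_mem' (p := fun (b : β × ℕ) x => x < d (t b.1) ∧
    E (t b.1) (a b.1) (o b.1) x b.2) (hX.comp Primrec.fst) (PrimrecPred.and
      (Primrec.nat_lt.comp Primrec.snd ((hd.comp ht).comp (Primrec.fst.comp Primrec.fst))) ?_)
  have h1 : Primrec fun x : (β × ℕ) × ℕ => x.1.1 := Primrec.fst.comp Primrec.fst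
  exact hE (ht.comp h1) (ha.comp h1) (ho.comp h1) Primrec.snd (Primrec.snd.comp Primrec.fst)

/-- It is decidable whether a game on supports can be won. -/
theorem computablePred_exists_gameWin (hd : Primrec d) (hK : Primrec K) (hA : Primrec A)
    (hE : ∀ {β : Type} [Primcodable β] {t : β → α} {a o x y : β → ℕ}, Primrec t → Primrec a →
      Primrec o → Primrec x → Primrec y → PrimrecPred fun b => E (t b) (a b) (o b) (x b) (y b))
    (hG : PrimrecPred fun p : α × ℕ => G p.1 p.2) (hS : PrimrecPred fun p : α × ℕ => S p.1 p.2) :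
    ComputablePred fun a => ∃ n, GameWin (d a) (K a) (A a) (E a) (G a) n {x | S a x} := by
  have hlists : PrimrecPred fun p : (α × List (List ℕ)) × List ℕ =>
      Lists (d p.1.1) p.2 {x | S p.1.1 x} := by
    have h1 : Primrec fun x : ((α × List (List ℕ)) × List ℕ) × ℕ => x.1.1.1 :=
      Primrec.fst.comp (Primrec.fst.comp Primrec.fst)
    exact PrimrecPred.forall_lt' (hd.comp (Primrec.fst.comp Primrec.fst)) (PrimrecPred.iff'
      (primrecPred_mem Primrec.snd (Primrec.snd.comp Primrec.fst))
      (hS.comp (Primrec.pair h1 Primrec.snd)))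
  -- Post's theorem: winning certificates enumerate the yes-instances, losing certificates the
  -- no-instances.
  rw [ComputablePred.computable_iff_re_compl_re']
  constructor
  · have hget : Primrec fun x : (α × List (List ℕ)) × ℕ => x.1.2.getD x.2 [] :=
      primrec_getD_nil (Primrec.snd.comp Primrec.fst) Primrec.snd
    refine (rePred_exists (p := fun (a : α) (C : List (List ℕ)) =>
      WinCert (d a) (K a) (A a) (E a) (G a) C ∧
        ∃ i < C.length, Lists (d a) (C.getD i []) {x | S a x}) ?_).of_eq fun a =>
      (exists_gameWin_iff _).symm
    refine PrimrecPred.and ?_ ?_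
    · refine PrimrecPred.forall_lt' (Primrec.list_length.comp Primrec.snd) (PrimrecPred.or ?_ ?_)
      · refine PrimrecPred.forall_mem' (p := fun (x : (α × List (List ℕ)) × ℕ) y =>
          y < d x.1.1 → G x.1.1 y) hget (PrimrecPred.imp' ?_ ?_)
        · exact Primrec.nat_lt.comp Primrec.snd
            (hd.comp (Primrec.fst.comp (Primrec.fst.comp Primrec.fst)))
        · exact hG.comp (Primrec.pair (Primrec.fst.comp (Primrec.fst.comp Primrec.fst))
            Primrec.snd)
      · refine PrimrecPred.exists_lt' (hA.comp (Primrec.fst.comp Primrec.fst)) ?_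
        refine PrimrecPred.forall_lt' (hK.comp
          (Primrec.fst.comp (Primrec.fst.comp Primrec.fst))) ?_
        refine PrimrecPred.exists_lt' (Primrec.snd.comp (Primrec.fst.comp Primrec.fst)) ?_
        have h1 : Primrec fun x : ((((α × List (List ℕ)) × ℕ) × ℕ) × ℕ) × ℕ => x.1.1.1 :=
          Primrec.fst.comp (Primrec.fst.comp Primrec.fst)
        have h2 : Primrec fun x : ((((α × List (List ℕ)) × ℕ) × ℕ) × ℕ) × ℕ =>
            x.1.1.1.1.2.getD x.2 [] :=
          primrec_getD_nil (Primrec.snd.comp (Primrec.fst.comp h1)) Primrec.snd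
        have h3 : Primrec fun x : ((((α × List (List ℕ)) × ℕ) × ℕ) × ℕ) × ℕ =>
            x.1.1.1.1.2.getD x.1.1.1.2 [] :=
          primrec_getD_nil (Primrec.snd.comp (Primrec.fst.comp h1)) (Primrec.snd.comp h1)
        have h4 : Primrec fun x : ((((α × List (List ℕ)) × ℕ) × ℕ) × ℕ) × ℕ => x.1.1.1.1.1 :=
          Primrec.fst.comp (Primrec.fst.comp h1)
        have h5 : Primrec fun x : ((((α × List (List ℕ)) × ℕ) × ℕ) × ℕ) × ℕ => x.1.1.2 :=
          Primrec.snd.comp (Primrec.fst.comp Primrec.fst)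
        have h6 : Primrec fun x : ((((α × List (List ℕ)) × ℕ) × ℕ) × ℕ) × ℕ => x.1.2 :=
          Primrec.snd.comp Primrec.fst
        exact primrecPred_lists_gameNext hd hE h4 h2 h3 h5 h6
    · refine PrimrecPred.exists_lt' (Primrec.list_length.comp Primrec.snd) ?_
      exact hlists.comp (Primrec.pair Primrec.fst hget)
  · refine (rePred_exists (p := fun (a : α) (C : List (List ℕ)) =>
      LoseCert (d a) (K a) (A a) (E a) (G a) C ∧ ∃ X ∈ C, Lists (d a) X {x | S a x}) ?_).of_eq
      fun a => (not_exists_gameWin_iff _).symm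
    refine PrimrecPred.and ?_ (PrimrecPred.exists_mem' Primrec.snd hlists)
    refine PrimrecPred.forall_mem' Primrec.snd (PrimrecPred.and ?_ ?_)
    · refine PrimrecPred.exists_mem' (p := fun (x : (α × List (List ℕ)) × List ℕ) y =>
          y < d x.1.1 ∧ ¬ G x.1.1 y) Primrec.snd (PrimrecPred.and ?_ (PrimrecPred.not ?_))
      · exact Primrec.nat_lt.comp Primrec.snd
            (hd.comp (Primrec.fst.comp (Primrec.fst.comp Primrec.fst)))
      · exact hG.comp (Primrec.pair (Primrec.fst.comp (Primrec.fst.comp Primrec.fst))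
            Primrec.snd)
    · refine PrimrecPred.forall_lt' (hA.comp (Primrec.fst.comp Primrec.fst)) ?_
      refine PrimrecPred.exists_lt' (hK.comp
          (Primrec.fst.comp (Primrec.fst.comp Primrec.fst))) ?_
      refine PrimrecPred.exists_mem' (Primrec.snd.comp
        (Primrec.fst.comp (Primrec.fst.comp Primrec.fst))) ?_
      have h1 : Primrec fun x : ((((α × List (List ℕ)) × List ℕ) × ℕ) × ℕ) × List ℕ => x.1.1.1 :=
        Primrec.fst.comp (Primrec.fst.comp Primrec.fst)
      exact primrecPred_lists_gameNext hd hE (Primrec.fst.comp (Primrec.fst.comp h1))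
          Primrec.snd (Primrec.snd.comp h1)
          (Primrec.snd.comp (Primrec.fst.comp Primrec.fst)) (Primrec.snd.comp Primrec.fst)

end

/-! # Mortality of nonnegative matrices -/

/-- All entries of the coded matrices are nonnegative. -/
def TupleCode.Nonneg (c : TupleCode) : Prop :=
  ∀ m ∈ c.2, ∀ x y, 0 ≤ m.toMatrix c.1 x y

theorem getD_mem_or_eq {β : Type} (l : List β) (n : ℕ) (b : β) :
    l.getD n b ∈ l ∨ l.getD n b = b := by
  rcases lt_or_ge n l.length with h | h
  · rw [List.getD_eq_getElem _ _ h]; exact Or.inl (List.getElem_mem h)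
  · exact Or.inr (List.getD_eq_default _ _ h)

theorem TupleCode.nonneg_of_mem {c : TupleCode} (h : c ∈ nonnegTuples) : TupleCode.Nonneg c := by
  intro m hm x y
  change 0 ≤ (((m.getD x []).getD y (0, 0) : RatCode)).val
  rcases getD_mem_or_eq m x [] with hr | hr
  · rcases getD_mem_or_eq (m.getD x []) y (0, 0) with hq | hq
    · exact h m hm _ hr _ hq
    · rw [hq]; exact (RatCode.val_nonneg_iff _).2 le_rfl
  · rw [hr]; exact (RatCode.val_nonneg_iff _).2 le_rfl

/-- Some sequence of the matrices empties the support of a positive vector. -/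
def TupleCode.SupportMortal (c : TupleCode) : Prop :=
  ∃ n, GameWin c.1 1 c.2.length
    (fun a _ x y => ((c.2.getD a []).entryCode y x).1 ≠ 0) (fun _ => False) n {_x | True}

/-- The support of a vector. -/
def vecSupport {d : ℕ} (v : Fin d → ℚ) : Set ℕ := {x | ∃ h : x < d, v ⟨x, h⟩ ≠ 0}

/-- A sum of nonnegative terms vanishes only if each term does. Hence supports evolve according to
the zero pattern of the matrix alone. -/
theorem mulVec_ne_zero_iff {d : ℕ} {M : Matrix (Fin d) (Fin d) ℚ} {v : Fin d → ℚ}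
    (hM : ∀ x y, 0 ≤ M x y) (hv : ∀ x, 0 ≤ v x) (x : Fin d) :
    (M *ᵥ v) x ≠ 0 ↔ ∃ y, v y ≠ 0 ∧ M x y ≠ 0 := by
  rw [Matrix.mulVec, dotProduct, Ne,
    Finset.sum_eq_zero_iff_of_nonneg fun y _ => mul_nonneg (hM x y) (hv y)]
  simp only [Finset.mem_univ, true_implies, mul_eq_zero, not_forall, not_or]
  exact exists_congr fun y => and_comm

theorem mulVec_nonneg {d : ℕ} {M : Matrix (Fin d) (Fin d) ℚ} {v : Fin d → ℚ}
    (hM : ∀ x y, 0 ≤ M x y) (hv : ∀ x, 0 ≤ v x) (x : Fin d) : 0 ≤ (M *ᵥ v) x :=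
  Finset.sum_nonneg fun y _ => mul_nonneg (hM x y) (hv y)

theorem prod_nonneg_entries {d : ℕ} {w : List (Matrix (Fin d) (Fin d) ℚ)}
    (h : ∀ M ∈ w, ∀ x y, 0 ≤ M x y) : ∀ x y, 0 ≤ w.prod x y := by
  induction w with
  | nil => intro x y; rw [List.prod_nil, Matrix.one_apply]; split_ifs <;> norm_num
  | cons M w ih =>
    intro x y
    rw [List.prod_cons, Matrix.mul_apply]
    exact Finset.sum_nonneg fun z _ => mul_nonneg (h M (by simp) x z)
      (ih (fun N hN => h N (by simp [hN])) z y)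

section

variable {c : TupleCode}

theorem gameNext_vecSupport (hc : TupleCode.Nonneg c) {a : ℕ} (ha : a < c.2.length)
    {v : Fin c.1 → ℚ} (hv : ∀ x, 0 ≤ v x) (o : ℕ) :
    gameNext c.1 (fun a _ x y => ((c.2.getD a []).entryCode y x).1 ≠ 0) (vecSupport v) a o =
      vecSupport ((c.2.getD a []).toMatrix c.1 *ᵥ v) := by
  have hmem : c.2.getD a [] ∈ c.2 := by
    rw [List.getD_eq_getElem _ _ ha]; exact List.getElem_mem ha
  ext y
  simp only [gameNext, vecSupport, Set.mem_ofPred_eq,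
    mulVec_ne_zero_iff (hc _ hmem) hv]
  constructor
  · rintro ⟨hy, x, ⟨hx, hvx⟩, -, hE⟩
    exact ⟨hy, ⟨x, hx⟩, hvx, fun h => hE ((RatCode.val_eq_zero_iff _).1 h)⟩
  · rintro ⟨hy, x, hvx, hM⟩
    exact ⟨hy, x, ⟨x.2, hvx⟩, x.2, fun h => hM ((RatCode.val_eq_zero_iff _).2 h)⟩

theorem exists_word_of_gameWin (hc : TupleCode.Nonneg c) (n : ℕ) {v : Fin c.1 → ℚ}
    (hv : ∀ x, 0 ≤ v x)
    (h : GameWin c.1 1 c.2.length (fun a _ x y => ((c.2.getD a []).entryCode y x).1 ≠ 0)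
      (fun _ => False) n (vecSupport v)) :
    ∃ w : List MatCode, (∀ m ∈ w, m ∈ c.2) ∧ (w.map fun m => m.toMatrix c.1).prod *ᵥ v = 0 := by
  have h0 : ∀ v : Fin c.1 → ℚ, (∀ x ∈ vecSupport v, x < c.1 → False) → v = 0 := by
    intro v h
    funext x
    by_contra hx
    exact h x ⟨x.2, hx⟩ x.2
  induction n generalizing v with
  | zero => exact ⟨[], by simp, by simpa using h0 v h⟩
  | succ n ih =>
    rcases h with h | ⟨a, ha, h⟩
    · exact ⟨[], by simp, by simpa using h0 v h⟩
    · have hmem : c.2.getD a [] ∈ c.2 := by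
        rw [List.getD_eq_getElem _ _ ha]; exact List.getElem_mem ha
      have h1 := h 0 one_pos
      rw [gameNext_vecSupport hc ha hv] at h1
      obtain ⟨w, hw, hw'⟩ := ih (mulVec_nonneg (hc _ hmem) hv) h1
      -- The matrix that acts first is the rightmost factor, so the first move becomes the last
      -- letter.
      refine ⟨w ++ [c.2.getD a []], fun m hm => ?_, ?_⟩
      · rcases List.mem_append.1 hm with hm | hm
        · exact hw m hm
        · rw [List.mem_singleton.1 hm]; exact hmem
      · rw [List.map_append, List.prod_append, ← Matrix.mulVec_mulVec]
        simpa using hw'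

theorem gameWin_of_word (hc : TupleCode.Nonneg c) (w : List MatCode) (hw : ∀ m ∈ w, m ∈ c.2)
    {v : Fin c.1 → ℚ} (hv : ∀ x, 0 ≤ v x)
    (h : (w.map fun m => m.toMatrix c.1).prod *ᵥ v = 0) :
    GameWin c.1 1 c.2.length (fun a _ x y => ((c.2.getD a []).entryCode y x).1 ≠ 0)
      (fun _ => False) w.length (vecSupport v) := by
  induction w using List.reverseRecOn generalizing v with
  | nil =>
    rintro x ⟨hx, hvx⟩ -
    simp at h
    exact hvx (congrFun h _)
  | append_singleton w m ih =>
    obtain ⟨a, ha, rfl⟩ := List.mem_iff_getElem.1 (hw m (by simp))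
    rw [List.length_append]
    have hg : c.2.getD a [] = c.2[a] := List.getD_eq_getElem _ _ ha
    refine Or.inr ⟨a, ha, fun o _ => ?_⟩
    rw [gameNext_vecSupport hc ha hv, hg]
    refine ih (fun m hm => hw m (by simp [hm])) (mulVec_nonneg (hc _ (List.getElem_mem ha)) hv) ?_
    rw [List.map_append, List.prod_append, ← Matrix.mulVec_mulVec] at h
    simpa using h

/-- The all-ones vector has full support, and a nonnegative matrix that annihilates it is zero
because its row sums vanish. -/
theorem MMP_yes_iff_supportMortal (hc : TupleCode.Nonneg c) (hd : 0 < c.1) :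
    MMP.yes c ↔ TupleCode.SupportMortal c := by
  have hS : ∀ n, GameWin c.1 1 c.2.length
      (fun a _ x y => ((c.2.getD a []).entryCode y x).1 ≠ 0) (fun _ => False) n {_x | True} ↔
      GameWin c.1 1 c.2.length (fun a _ x y => ((c.2.getD a []).entryCode y x).1 ≠ 0)
      (fun _ => False) n (vecSupport (1 : Fin c.1 → ℚ)) := fun n =>
    gameWin_congr (fun y hy => by simp [vecSupport, hy]) n
  rw [MMP_yes_iff, TupleCode.SupportMortal]
  simp only [hS]
  constructor
  · rintro ⟨w, hw, -, h⟩
    exact ⟨_, gameWin_of_word hc w hw (fun _ => zero_le_one) (by rw [h, Matrix.zero_mulVec])⟩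
  · rintro ⟨n, hn⟩
    obtain ⟨w, hw, h⟩ := exists_word_of_gameWin hc n (fun _ => zero_le_one) hn
    refine ⟨w, hw, ?_, ?_⟩
    -- In positive dimension the empty product does not annihilate the all-ones vector, so the word
    -- found is automatically nonempty.
    · rintro rfl
      have := congrFun h ⟨0, hd⟩
      simp at this
    · have hnn : ∀ x y, 0 ≤ (w.map fun m => m.toMatrix c.1).prod x y := by
        refine prod_nonneg_entries fun M hM => ?_
        obtain ⟨m, hm, rfl⟩ := List.mem_map.1 hM
        exact hc m (hw m hm)
      ext x y
      have := congrFun h x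
      rw [Matrix.mulVec, dotProduct, Pi.zero_apply,
        Finset.sum_eq_zero_iff_of_nonneg fun y _ => mul_nonneg (hnn x y) zero_le_one] at this
      simpa using this y (Finset.mem_univ y)

end

theorem computablePred_supportMortal : ComputablePred TupleCode.SupportMortal := by
  refine computablePred_exists_gameWin (α := TupleCode)
    (E := fun c a _ x y => ((c.2.getD a []).entryCode y x).1 ≠ 0)
    (G := fun _ _ => False) (S := fun _ _ => True) Primrec.fst (Primrec.const 1)
    (Primrec.list_length.comp Primrec.snd) ?_ ?_ ?_
  · intro β _ t a o x y ht ha ho hx hy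
    exact (Primrec.eq.comp (Primrec.fst.comp (primrec_entryCode' ((Primrec.list_getD []).comp
      (Primrec.snd.comp ht) ha) hy hx)) (Primrec.const 0)).not
  · exact Primrec.primrecPred (Primrec.const _)
  · exact Primrec.primrecPred (Primrec.const _)

theorem entrywiseAbs_mem (c : TupleCode) : entrywiseAbs c ∈ nonnegTuples := by
  intro m hm r hr q hq
  obtain ⟨m', -, rfl⟩ := List.mem_map.1 hm
  obtain ⟨r', -, rfl⟩ := List.mem_map.1 hr
  obtain ⟨q', -, rfl⟩ := List.mem_map.1 hq
  exact (RatCode.val_nonneg_iff _).2 (abs_nonneg _)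

theorem entrywiseAbs_of_mem {c : TupleCode} (h : c ∈ nonnegTuples) : entrywiseAbs c = c := by
  refine Prod.ext rfl ?_
  change c.2.map _ = c.2
  conv_rhs => rw [← List.map_id c.2]
  refine List.map_congr_left fun m hm => ?_
  conv_rhs => rw [id, ← List.map_id m]
  refine List.map_congr_left fun r hr => ?_
  conv_rhs => rw [id, ← List.map_id r]
  refine List.map_congr_left fun q hq => ?_
  exact Prod.ext (abs_of_nonneg ((RatCode.val_nonneg_iff _).1 (h m hm r hr q hq))) rfl

/-- The game sees only which numerators are zero, and taking absolute values does not change that.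
-/
theorem supportMortal_entrywiseAbs (c : TupleCode) :
    (entrywiseAbs c).SupportMortal ↔ c.SupportMortal := by
  have h1 : (entrywiseAbs c).2.length = c.2.length := List.length_map _
  have h2 : ∀ a x y, (((entrywiseAbs c).2.getD a []).entryCode y x).1 =
      |((c.2.getD a []).entryCode y x).1| := by
    intro a x y
    have e1 : (entrywiseAbs c).2.getD a [] =
        ((c.2.getD a []).map fun r => r.map fun q => (|q.1|, q.2)) := by
      simp only [entrywiseAbs, List.getD_eq_getElem?_getD, List.getElem?_map]
      cases c.2[a]? <;> simp
    rw [e1]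
    simp only [MatCode.entryCode, List.getD_eq_getElem?_getD, List.getElem?_map]
    cases (c.2[a]?.getD [])[y]? with
    | none => simp
    | some r => simp only [Option.map_some, Option.getD_some, List.getElem?_map]; cases r[x]? <;> simp
  unfold TupleCode.SupportMortal
  simp only [h1, h2, Ne, abs_eq_zero]
  rfl

theorem computable_entrywiseAbs : Computable entrywiseAbs := by
  have h3 : Primrec fun q : RatCode => ((|q.1|, q.2) : RatCode) :=
    Primrec.pair (primrec_int_abs.comp Primrec.fst) Primrec.snd
  have h2 : Primrec fun r : List RatCode => r.map fun q => ((|q.1|, q.2) : RatCode) :=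
    Primrec.list_map Primrec.id (h3.comp Primrec.snd).to₂
  have h1 : Primrec fun m : MatCode => m.map fun r => r.map fun q => ((|q.1|, q.2) : RatCode) :=
    Primrec.list_map Primrec.id (h2.comp Primrec.snd).to₂
  exact (Primrec.pair Primrec.fst (Primrec.list_map Primrec.snd (h1.comp Primrec.snd).to₂)).to_comp

theorem isDecidable_of_supportMortal {P : DecisionProblem} (f : P.Inst → TupleCode)
    (hf : Computable f) (h : ∀ i, P.valid i → (P.yes i ↔ (f i).SupportMortal)) :
    P.IsDecidable := by
  obtain ⟨g, hg, hg'⟩ := ComputablePred.computable_iff.1 computablePred_supportMortal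
  refine ⟨fun i => g (f i), hg.comp hf, fun i hi => ?_⟩
  rw [h i hi, hg']

/-- An instance of mortality with the answer yes. -/
theorem MMP_yes_zero : MMP.yes (1, [[]]) := by
  rw [MMP_yes_iff]
  refine ⟨[[]], by simp, by simp, ?_⟩
  ext x y
  simp [MatCode.toMatrix, MatCode.entry, RatCode.val]

/-- An instance of mortality with the answer no. -/
theorem MMP_not_yes_empty : ¬ MMP.yes (1, []) := by
  rw [MMP_yes_iff]
  rintro ⟨w, hw, hne, -⟩
  exact hne (List.eq_nil_iff_forall_not_mem.2 fun m hm => by simpa using hw m hm)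

theorem nontriviallyDecidable_nonneg_MMP : (MMP.restrict nonnegTuples).NontriviallyDecidable := by
  refine ⟨isDecidable_of_supportMortal id Computable.id fun i hi =>
    MMP_yes_iff_supportMortal (TupleCode.nonneg_of_mem hi.2) hi.1,
    ⟨(1, [[]]), ⟨one_pos, ?_⟩, MMP_yes_zero⟩, ⟨(1, []), ⟨one_pos, ?_⟩, MMP_not_yes_empty⟩⟩
  · intro m hm r hr
    rw [List.mem_singleton.1 hm] at hr
    simp at hr
  · intro m hm
    simp at hm

/-! # Destructive interference and impossible sequences of outcomes -/

section

variable {d K : ℕ} {A : Fin K → Matrix (Fin d) (Fin d) ℂ}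

theorem totalMatrix_eq_prod (w : List (Fin K)) : totalMatrix A w = (w.reverse.map A).prod := by
  induction w with
  | nil => rfl
  | cons j w ih => simp [totalMatrix, ih]

theorem totalMatrix_nonneg (hA : ∀ j x y, 0 ≤ A j x y) (w : List (Fin K)) (x y : Fin d) :
    0 ≤ totalMatrix A w x y := by
  induction w generalizing y with
  | nil => rw [totalMatrix, Matrix.one_apply]; split_ifs <;> norm_num
  | cons j w ih =>
    rw [totalMatrix, Matrix.mul_apply]
    exact Finset.sum_nonneg fun z _ => mul_nonneg (ih z) (hA j z y)

theorem pathWeight_nonneg (hA : ∀ j x y, 0 ≤ A j x y) (y : Fin d) (p : List (Fin K × Fin d)) :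
    0 ≤ pathWeight A y p := by
  induction p generalizing y with
  | nil => exact zero_le_one
  | cons q p ih => exact mul_nonneg (hA _ _ _) (ih _)

/-- The weight of a path is one summand in a sum of nonnegative numbers. This is the whole reason
why classical measurements prohibit destructive interference. -/
theorem pathWeight_le (hA : ∀ j x y, 0 ≤ A j x y) (y : Fin d) (p : List (Fin K × Fin d)) :
    pathWeight A y p ≤ totalMatrix A (p.map Prod.fst) (pathEnd y p) y := by
  induction p generalizing y with
  | nil => simp [pathWeight, totalMatrix, pathEnd]
  | cons q p ih =>
    obtain ⟨j, z⟩ := q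
    have hend : pathEnd y ((j, z) :: p) = pathEnd z p := by
      rw [pathEnd, List.map_cons, List.getLastD_cons, pathEnd]
    rw [hend, List.map_cons, totalMatrix, Matrix.mul_apply, pathWeight]
    refine le_trans ?_ (Finset.single_le_sum (f := fun z' =>
      totalMatrix A (p.map Prod.fst) (pathEnd z p) z' * A j z' y)
      (fun z' _ => mul_nonneg (totalMatrix_nonneg hA _ _ _) (hA _ _ _)) (Finset.mem_univ z))
    rw [mul_comm]
    exact mul_le_mul_of_nonneg_right (ih z) (hA _ _ _)

theorem quantum_after (w : List (Fin K)) (ρ : Matrix (Fin d) (Fin d) ℂ) :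
    quantum.after A w ρ = totalMatrix A w * ρ * (totalMatrix A w)ᴴ := by
  induction w generalizing ρ with
  | nil => simp [PhysicalTheory.after, totalMatrix]
  | cons j w ih =>
    change quantum.after A w (A j * ρ * (A j)ᴴ) = _
    rw [ih, totalMatrix, Matrix.conjTranspose_mul]
    simp only [Matrix.mul_assoc]

theorem classical_after (w : List (Fin K)) (p : Fin d → ℂ) :
    classical.after A w (Matrix.diagonal p) = Matrix.diagonal (totalMatrix A w *ᵥ p) := by
  induction w generalizing p with
  | nil => simp [PhysicalTheory.after, totalMatrix]
  | cons j w ih =>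
    change classical.after A w (Matrix.diagonal (A j *ᵥ (Matrix.diagonal p).diag)) = _
    rw [Matrix.diag_diagonal, ih, totalMatrix, Matrix.mulVec_mulVec]

/-- The completely mixed state. -/
noncomputable def mixedState (d : ℕ) : Matrix (Fin d) (Fin d) ℂ := (d : ℂ)⁻¹ • 1

theorem mixedState_mem (hd : 0 < d) : mixedState d ∈ quantum.states d := by
  refine ⟨?_, ?_⟩
  · refine Matrix.PosSemidef.smul Matrix.PosSemidef.one ?_
    rw [← Complex.ofReal_natCast, ← Complex.ofReal_inv]
    exact_mod_cast (by positivity : (0 : ℝ) ≤ (d : ℝ)⁻¹)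
  · rw [mixedState, Matrix.trace_smul, Matrix.trace_one, Fintype.card_fin, smul_eq_mul]
    exact inv_mul_cancel₀ (by exact_mod_cast hd.ne')

/-- The trace is the squared Hilbert–Schmidt norm of `B` divided by d, so this single state detects
whether the total matrix vanishes. -/
theorem trace_mul_mixedState_eq_zero_iff (hd : 0 < d) (B : Matrix (Fin d) (Fin d) ℂ) :
    (B * mixedState d * Bᴴ).trace = 0 ↔ B = 0 := by
  have hd' : (d : ℂ)⁻¹ ≠ 0 := inv_ne_zero (by exact_mod_cast hd.ne')
  rw [mixedState, Matrix.mul_smul, Matrix.mul_one, Matrix.smul_mul, Matrix.trace_smul, smul_eq_zero,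
    or_iff_right hd', Matrix.trace_mul_conjTranspose_self_eq_zero_iff]

end

theorem noDestructiveInterference_classical : NoDestructiveInterference classical := by
  rintro d K A ⟨hA, -⟩ y p h
  exact le_antisymm (h ▸ pathWeight_le hA y p) (pathWeight_nonneg hA y p)

/-- The counterexample is the projective measurement along (1, 1) and (1, -1). The product of the
two projections is 0, although the path that stays at level 0 has weight 1/4. -/
theorem not_noDestructiveInterference_quantum : ¬ NoDestructiveInterference quantum := by
  intro h
  have h1 := h 2 2 ![!![1/2, 1/2; 1/2, 1/2], !![1/2, -1/2; -1/2, 1/2]] (by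
    change ∑ j, _ = _
    rw [Fin.sum_univ_two]
    ext x y
    fin_cases x <;> fin_cases y <;>
      simp [Matrix.mul_apply, Fin.sum_univ_two, Matrix.add_apply, Complex.conj_ofNat] <;> norm_num)
    0 [(0, 0), (1, 0)]
  have h2 := h1 (by
    simp [totalMatrix, pathEnd, Matrix.mul_apply, Fin.sum_univ_two]; norm_num)
  simp [pathWeight] at h2

/-! # Measurement occurrence is mortality -/

theorem totalMatrix_toComplex_eq_zero_iff (c : TupleCode) (w : List (Fin c.2.length)) :
    totalMatrix c.toComplex w = 0 ↔ (w.reverse.map c.toMatrices).prod = 0 := by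
  have h : (w.reverse.map c.toComplex).prod =
      (Rat.castHom ℂ).mapMatrix (w.reverse.map c.toMatrices).prod := by
    rw [map_list_prod, List.map_map]
    rfl
  rw [totalMatrix_eq_prod, h]
  exact map_eq_zero_iff _ (Matrix.map_injective (Rat.castHom ℂ).injective)

/-- Outcomes are listed in order of time and factors from left to right, hence the reversal.
Nonemptiness of the word is free since the unit matrix is not zero in positive dimension. -/
theorem MMP_yes_iff_totalMatrix (c : TupleCode) (hd : 0 < c.1) :
    MMP.yes c ↔ ∃ w, totalMatrix c.toComplex w = 0 := by
  simp only [totalMatrix_toComplex_eq_zero_iff]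
  constructor
  · rintro ⟨w, -, h⟩
    exact ⟨w.reverse, by rwa [List.reverse_reverse]⟩
  · rintro ⟨w, h⟩
    refine ⟨w.reverse, ?_, h⟩
    rintro h0
    rw [h0] at h
    have := congrFun (congrFun h ⟨0, hd⟩) ⟨0, hd⟩
    simp at this

theorem MOP_quantum_yes_iff (c : TupleCode) (hd : 0 < c.1) :
    (MOP quantum).yes c ↔ MMP.yes c := by
  rw [MMP_yes_iff_totalMatrix c hd]
  refine exists_congr fun w => ?_
  simp only [quantum_after]
  constructor
  · intro h
    exact (trace_mul_mixedState_eq_zero_iff hd _).1 (h _ (mixedState_mem hd))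
  · intro h ρ _
    simp [h]

/-- Starting at level y, the probability is the sum of column y of the total matrix. Nonnegative
columns with sum zero are zero. -/
theorem MOP_classical_yes_iff (c : TupleCode) (hc : (MOP classical).valid c) :
    (MOP classical).yes c ↔ MMP.yes c := by
  rw [MMP_yes_iff_totalMatrix c hc.1]
  refine exists_congr fun w => ?_
  constructor
  · intro h
    have hnn := totalMatrix_nonneg hc.2.1 w
    ext x y
    have h1 := h (Matrix.diagonal fun z => ((Pi.single y 1 : Fin c.1 → ℝ) z : ℂ))
      ⟨Pi.single y 1, fun z => by rw [Pi.single_apply]; split_ifs <;> norm_num, by simp, rfl⟩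
    have h2 : (fun z => ((Pi.single y 1 : Fin c.1 → ℝ) z : ℂ)) = Pi.single y 1 := by
      funext z
      rw [Pi.single_apply, Pi.single_apply]; split_ifs <;> simp
    rw [h2, classical_after, Matrix.trace_diagonal, Matrix.mulVec_single_one] at h1
    simp only [Matrix.col_apply] at h1
    rw [Finset.sum_eq_zero_iff_of_nonneg fun x _ => hnn x y] at h1
    exact h1 x (Finset.mem_univ x)
  · rintro h ρ ⟨p, -, -, rfl⟩
    simp [classical_after, h]

theorem nonneg_of_valid_classical {c : TupleCode} (hc : (MOP classical).valid c) :
    TupleCode.Nonneg c := by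
  intro m hm x y
  obtain ⟨j, rfl⟩ := List.get_of_mem hm
  have := hc.2.1 j x y
  change (0 : ℂ) ≤ ((MatCode.toMatrix (c.2.get j) c.1 x y : ℚ) : ℂ) at this
  rw [← Complex.ofReal_ratCast, Complex.zero_le_real] at this
  exact_mod_cast this

theorem MOP_classical_yes_iff_supportMortal (c : TupleCode) (hc : (MOP classical).valid c) :
    (MOP classical).yes c ↔ c.SupportMortal :=
  (MOP_classical_yes_iff c hc).trans
    (MMP_yes_iff_supportMortal (nonneg_of_valid_classical hc) hc.1)

/-- This expresses the classical branch of the scheme by the support game of the original tuple, for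
matrices of arbitrary sign. -/
theorem MMP_yes_entrywiseAbs_iff (c : TupleCode) (hd : 0 < c.1) :
    MMP.yes (entrywiseAbs c) ↔ c.SupportMortal := by
  rw [← supportMortal_entrywiseAbs]
  exact MMP_yes_iff_supportMortal (TupleCode.nonneg_of_mem (entrywiseAbs_mem c)) hd

theorem nontriviallyDecidable_MOP_classical : (MOP classical).NontriviallyDecidable := by
  have v1 : (MOP classical).valid (1, [[[(0, 0)]], [[(1, 0)]]]) := by
    refine ⟨one_pos, fun j x y => ?_, fun y => ?_⟩
    · obtain rfl := Subsingleton.elim x 0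
      obtain rfl := Subsingleton.elim y 0
      change Fin 2 at j
      fin_cases j <;>
        simp [TupleCode.toComplex, MatCode.toComplex, MatCode.toMatrix, MatCode.entry, RatCode.val]
    · obtain rfl := Subsingleton.elim y 0
      change ∑ j : Fin 2, ∑ x : Fin 1, _ = _
      simp [TupleCode.toComplex, MatCode.toComplex, MatCode.toMatrix, MatCode.entry, RatCode.val]
  have v0 : (MOP classical).valid (1, [[[(1, 0)]]]) := by
    refine ⟨one_pos, fun j x y => ?_, fun y => ?_⟩
    · obtain rfl := Subsingleton.elim x 0
      obtain rfl := Subsingleton.elim y 0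
      change Fin 1 at j
      fin_cases j
      simp [TupleCode.toComplex, MatCode.toComplex, MatCode.toMatrix, MatCode.entry, RatCode.val]
    · obtain rfl := Subsingleton.elim y 0
      change ∑ j : Fin 1, ∑ x : Fin 1, _ = _
      simp [TupleCode.toComplex, MatCode.toComplex, MatCode.toMatrix, MatCode.entry, RatCode.val]
  refine ⟨isDecidable_of_supportMortal id Computable.id MOP_classical_yes_iff_supportMortal,
    ⟨_, v1, ?_⟩, ⟨_, v0, ?_⟩⟩
  · rw [MOP_classical_yes_iff _ v1, MMP_yes_iff]
    refine ⟨[[[(0, 0)]]], by simp, by simp, ?_⟩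
    ext x y
    obtain rfl := Subsingleton.elim x 0
    obtain rfl := Subsingleton.elim y 0
    simp [MatCode.toMatrix, MatCode.entry, RatCode.val]
  · rw [MOP_classical_yes_iff _ v0, MMP_yes_iff]
    rintro ⟨w, hw, -, h⟩
    have hone : MatCode.toMatrix [[(1, 0)]] 1 = 1 := by
      ext x y
      obtain rfl := Subsingleton.elim x 0
      obtain rfl := Subsingleton.elim y 0
      simp [MatCode.toMatrix, MatCode.entry, RatCode.val]
    have : (w.map fun m => MatCode.toMatrix m 1).prod = 1 := by
      refine List.prod_eq_one fun M hM => ?_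
      obtain ⟨m, hm, rfl⟩ := List.mem_map.1 hM
      rw [List.mem_singleton.1 (hw m hm), hone]
    rw [this] at h
    exact one_ne_zero h

/-- The classical side of the scheme is decidable, with both answers. -/
theorem nontriviallyDecidable_resourceDependent_classical :
    (MMP.resourceDependent entrywiseAbs
      (NoDestructiveInterference classical)).NontriviallyDecidable := by
  have h : ∀ c : TupleCode, 0 < c.1 → ((MMP.resourceDependent entrywiseAbs
      (NoDestructiveInterference classical)).yes c ↔ c.SupportMortal) := by
    intro c hd
    rw [← MMP_yes_entrywiseAbs_iff c hd]
    simp [DecisionProblem.resourceDependent, noDestructiveInterference_classical]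
  refine ⟨isDecidable_of_supportMortal id Computable.id h, ⟨(1, [[]]), one_pos, ?_⟩,
    ⟨(1, []), one_pos, ?_⟩⟩
  · rw [h _ one_pos, ← MMP_yes_entrywiseAbs_iff _ one_pos]
    exact MMP_yes_zero
  · rw [h _ one_pos, ← MMP_yes_entrywiseAbs_iff _ one_pos]
    exact MMP_not_yes_empty

theorem resourceDependent_quantum_reduces : (MMP.resourceDependent entrywiseAbs
    (NoDestructiveInterference quantum)).Reduces MMP :=
  ⟨id, Computable.id, fun i hi => ⟨hi, by
    simp [DecisionProblem.resourceDependent, not_noDestructiveInterference_quantum]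
    rfl⟩⟩

/-! # Goal-state reachability for POMDPs -/

namespace POMDP

/-- The transitions between supports. -/
def Code.edge (c : POMDP.Code) (a o x y : ℕ) : Prop :=
  ((c.2.2.1.getD a ([], [])).1.entryCode x y).1 ≠ 0 ∧
    ((c.2.2.1.getD a ([], [])).2.entryCode y o).1 ≠ 0

/-- The game on supports can be won. -/
def Code.SupportReachable (c : POMDP.Code) : Prop :=
  ∃ n, GameWin c.1 c.2.1 c.2.2.1.length (Code.edge c) (fun y => y = c.2.2.2.2) n
    {x | (c.2.2.2.1.getD x (0, 0)).1 ≠ 0}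

/-- The unnormalised belief after an action and an observation. -/
def update (M : POMDP) (a : Fin M.numAct) (o : Fin M.numObs) (b : Fin M.dim → ℚ) : Fin M.dim → ℚ :=
  fun s' => M.obs a s' o * ∑ s, M.trans a s s' * b s

theorem update_nonneg {M : POMDP} (hM : M.IsGoalModel) (a : Fin M.numAct) (o : Fin M.numObs)
    {b : Fin M.dim → ℚ} (hb : ∀ s, 0 ≤ b s) (s : Fin M.dim) : 0 ≤ M.update a o b s :=
  mul_nonneg (hM.2.2.2.1 _ _ _)
    (Finset.sum_nonneg fun _ _ => mul_nonneg (hM.2.1 _ _ _) (hb _))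

theorem beliefAfter_nonneg {M : POMDP} (hM : M.IsGoalModel)
    (π : List (Fin M.numObs) → Fin M.numAct) (h : List (Fin M.numObs)) (s : Fin M.dim) :
    0 ≤ M.beliefAfter π h s := by
  induction h generalizing s with
  | nil => exact hM.2.2.2.2.2.1 s
  | cons o h ih => exact update_nonneg hM _ _ ih s

theorem update_ne_zero_iff {M : POMDP} (hM : M.IsGoalModel) (a : Fin M.numAct) (o : Fin M.numObs)
    {b : Fin M.dim → ℚ} (hb : ∀ s, 0 ≤ b s) (s' : Fin M.dim) :
    M.update a o b s' ≠ 0 ↔ ∃ s, b s ≠ 0 ∧ M.trans a s s' ≠ 0 ∧ M.obs a s' o ≠ 0 := by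
  rw [update, mul_ne_zero_iff, Ne, Ne,
    Finset.sum_eq_zero_iff_of_nonneg fun s _ => mul_nonneg (hM.2.1 a s s') (hb s)]
  simp only [Finset.mem_univ, true_implies, mul_eq_zero, not_forall, not_or]
  constructor
  · rintro ⟨h1, s, h2, h3⟩; exact ⟨s, h3, h2, h1⟩
  · rintro ⟨s, h3, h2, h1⟩; exact ⟨h1, s, h2, h3⟩

/-- For a nonnegative belief, conditional probability 1 at the goal means that no mass lies
elsewhere. An impossible history has empty support and satisfies both sides trivially. -/
theorem concentrated_iff {d : ℕ} {b : Fin d → ℚ} (hb : ∀ s, 0 ≤ b s) (g : Fin d) :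
    (∑ s, b s ≠ 0 → ∀ s : Fin d, (s : ℕ) = g → b s / ∑ s', b s' = 1) ↔
      ∀ x ∈ vecSupport b, x < d → x = g := by
  constructor
  · rintro h x ⟨hx, hbx⟩ -
    by_contra hxg
    have h0 : ∑ s, b s ≠ 0 := by
      rw [Ne, Finset.sum_eq_zero_iff_of_nonneg fun s _ => hb s]
      exact fun h => hbx (h _ (Finset.mem_univ _))
    have h1 := h h0 g rfl
    rw [div_eq_one_iff_eq h0] at h1
    rw [← Finset.add_sum_erase _ _ (Finset.mem_univ g), left_eq_add,
      Finset.sum_eq_zero_iff_of_nonneg fun s _ => hb s] at h1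
    exact hbx (h1 ⟨x, hx⟩ (Finset.mem_erase.2 ⟨fun e => hxg (congrArg Fin.val e),
      Finset.mem_univ _⟩))
  · intro h h0 s hs
    obtain rfl : s = g := Fin.ext hs
    rw [div_eq_one_iff_eq h0]
    symm
    refine Finset.sum_eq_single s (fun t _ hts => ?_) (fun h => absurd (Finset.mem_univ s) h)
    by_contra hbt
    exact hts (Fin.ext (h t ⟨t.2, hbt⟩ t.2))

variable {c : POMDP.Code}

theorem gameNext_vecSupport (hM : (ofCode c).IsGoalModel) (a : Fin c.2.2.1.length)
    (o : Fin c.2.1) {b : Fin c.1 → ℚ} (hb : ∀ s, 0 ≤ b s) :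
    gameNext c.1 (Code.edge c) (vecSupport b) a o =
      vecSupport (POMDP.update (ofCode c) a o b) := by
  have hg : c.2.2.1.getD a ([], []) = c.2.2.1.get a := List.getD_eq_getElem _ _ a.2
  ext y
  simp only [gameNext, vecSupport, Set.mem_ofPred_eq]
  constructor
  · rintro ⟨hy, x, ⟨hx, hbx⟩, -, hE⟩
    rw [Code.edge, hg] at hE
    refine ⟨hy, (update_ne_zero_iff hM a o hb ⟨y, hy⟩).2 ⟨⟨x, hx⟩, hbx, ?_, ?_⟩⟩
    · exact fun h => hE.1 ((RatCode.val_eq_zero_iff _).1 h)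
    · exact fun h => hE.2 ((RatCode.val_eq_zero_iff _).1 h)
  · rintro ⟨hy, hu⟩
    obtain ⟨x, hbx, h1, h2⟩ := (update_ne_zero_iff hM a o hb ⟨y, hy⟩).1 hu
    refine ⟨hy, x, ⟨x.2, hbx⟩, x.2, ?_⟩
    rw [Code.edge, hg]
    exact ⟨fun h => h1 ((RatCode.val_eq_zero_iff _).2 h),
      fun h => h2 ((RatCode.val_eq_zero_iff _).2 h)⟩

theorem vecSupport_start (c : POMDP.Code) (n : ℕ) :
    GameWin c.1 c.2.1 c.2.2.1.length (Code.edge c) (fun y => y = c.2.2.2.2) n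
      {x | (c.2.2.2.1.getD x (0, 0)).1 ≠ 0} ↔
    GameWin c.1 c.2.1 c.2.2.1.length (Code.edge c) (fun y => y = c.2.2.2.2) n
      (vecSupport (ofCode c).start) := by
  refine gameWin_congr (fun y hy => ?_) n
  constructor
  · exact fun h => ⟨hy, fun h' => h ((RatCode.val_eq_zero_iff _).1 h')⟩
  · rintro ⟨_, h⟩
    exact fun h' => h ((RatCode.val_eq_zero_iff _).2 h')

theorem goal_lt (hM : (ofCode c).IsGoalModel) : c.2.2.2.2 < c.1 := by
  obtain ⟨s, hs, -⟩ := hM.2.2.2.2.2.2.2.1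
  change (s : ℕ) = _ at hs
  rw [← hs]
  exact s.2

/-- From the goal all probability returns to the goal. Hence a game won early can be prolonged to a
prescribed number of steps, as reachability at a fixed time requires. -/
theorem gameNext_goal (hM : (ofCode c).IsGoalModel) (a : Fin c.2.2.1.length) (o : ℕ) {X : Set ℕ}
    (hX : ∀ x ∈ X, x < c.1 → x = c.2.2.2.2) :
    ∀ y ∈ gameNext c.1 (Code.edge c) X a o, y < c.1 → y = c.2.2.2.2 := by
  rintro y ⟨hy, x, hxX, hx, hE⟩ -
  have hg : c.2.2.1.getD a ([], []) = c.2.2.1.get a := List.getD_eq_getElem _ _ a.2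
  rw [Code.edge, hg] at hE
  have hxg := hX x hxX hx
  let s : Fin (ofCode c).dim := ⟨x, hx⟩
  let t : Fin (ofCode c).dim := ⟨y, hy⟩
  have h1 := hM.2.2.2.2.2.2.2.2 a s hxg
  have h2 := hM.2.2.1 a s
  rw [← Finset.add_sum_erase _ _ (Finset.mem_univ s), h1, add_eq_left,
    Finset.sum_eq_zero_iff_of_nonneg fun s' _ => hM.2.1 a s s'] at h2
  by_contra hyg
  refine hE.1 ((RatCode.val_eq_zero_iff _).1 (h2 t (Finset.mem_erase.2 ⟨?_, Finset.mem_univ _⟩)))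
  intro e
  exact hyg ((congrArg Fin.val e).trans hxg)

/-- The support can be forced into the goal in exactly `n` steps. -/
def Code.WinsIn (c : POMDP.Code) : ℕ → Set ℕ → Prop
  | 0, X => ∀ x ∈ X, x < c.1 → x = c.2.2.2.2
  | n + 1, X => ∃ a : Fin c.2.2.1.length, ∀ o : Fin c.2.1,
      Code.WinsIn c n (gameNext c.1 (Code.edge c) X a o)

theorem winsIn_of_goal (hM : (ofCode c).IsGoalModel) (n : ℕ) {X : Set ℕ}
    (hX : ∀ x ∈ X, x < c.1 → x = c.2.2.2.2) : Code.WinsIn c n X := by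
  induction n generalizing X with
  | zero => exact hX
  | succ n ih => exact ⟨⟨0, hM.1⟩, fun o => ih (gameNext_goal hM _ _ hX)⟩

theorem winsIn_of_gameWin (hM : (ofCode c).IsGoalModel) (n : ℕ) {X : Set ℕ}
    (hX : GameWin c.1 c.2.1 c.2.2.1.length (Code.edge c) (fun y => y = c.2.2.2.2) n X) :
    Code.WinsIn c n X := by
  induction n generalizing X with
  | zero => exact hX
  | succ n ih =>
    rcases hX with h | ⟨a, ha, h⟩
    · exact winsIn_of_goal hM _ h
    · exact ⟨⟨a, ha⟩, fun o => ih (h o o.2)⟩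

theorem goalReachable_of_winsIn (hM : (ofCode c).IsGoalModel) (n : ℕ)
    (hn : Code.WinsIn c n (vecSupport (ofCode c).start)) : (ofCode c).GoalReachable := by
  have hstrat : ∀ (k : ℕ) (X : Set ℕ), ∃ a : Fin c.2.2.1.length, Code.WinsIn c (k + 1) X →
      ∀ o : Fin c.2.1, Code.WinsIn c k (gameNext c.1 (Code.edge c) X a o) := by
    intro k X
    by_cases h : Code.WinsIn c (k + 1) X
    · obtain ⟨a, ha⟩ := h
      exact ⟨a, fun _ => ha⟩
    · exact ⟨⟨0, hM.1⟩, fun h' => absurd h' h⟩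
  choose σ hσ using hstrat
  -- The policy needs the current support, and the support depends on the earlier actions, so the
  -- supports are defined by recursion on the history. The number `n - 1 - h.length` counts the
  -- rounds that remain after the action chosen at `h`; only histories shorter than `n` matter.
  let X : List (Fin c.2.1) → Set ℕ := fun h => h.rec (vecSupport (ofCode c).start)
    fun o h X => gameNext c.1 (Code.edge c) X (σ (n - 1 - h.length) X) o
  let π : List (Fin c.2.1) → Fin c.2.2.1.length := fun h => σ (n - 1 - h.length) (X h)
  have hX : ∀ h, vecSupport ((ofCode c).beliefAfter π h) = X h := by
    intro h
    induction h with
    | nil => rfl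
    | cons o h ih =>
      have e := gameNext_vecSupport hM (π h) o (beliefAfter_nonneg hM π h)
      change vecSupport (POMDP.update (ofCode c) (π h) o ((ofCode c).beliefAfter π h)) =
        gameNext c.1 (Code.edge c) (X h) (π h) o
      exact e.symm.trans (congrArg (fun Y => gameNext c.1 (Code.edge c) Y (π h) o) ih)
  have hwin : ∀ h, h.length ≤ n → Code.WinsIn c (n - h.length) (X h) := by
    intro h
    induction h with
    | nil => exact fun _ => hn
    | cons o h ih =>
      intro hl
      rw [List.length_cons] at hl
      have h1 := ih (by omega)
      have h2 : n - h.length = n - 1 - h.length + 1 := by omega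
      rw [h2] at h1
      have h3 := hσ _ _ h1 o
      have h4 : n - (o :: h).length = n - 1 - h.length := by rw [List.length_cons]; omega
      rw [h4]
      exact h3
  refine ⟨n, π, fun (h : List (Fin c.2.1)) (hl : h.length = n) => ?_⟩
  have h1 := hwin h hl.le
  rw [show n - h.length = 0 by omega] at h1
  exact (concentrated_iff (beliefAfter_nonneg hM π h) ⟨_, goal_lt hM⟩).2
    ((congrArg (Code.WinsIn c 0) (hX h)).mpr h1)

theorem gameWin_of_goalReachable (hM : (ofCode c).IsGoalModel) (h : (ofCode c).GoalReachable) :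
    ∃ n, GameWin c.1 c.2.1 c.2.2.1.length (Code.edge c) (fun y => y = c.2.2.2.2) n
      (vecSupport (ofCode c).start) := by
  obtain ⟨n, π, hn⟩ := h
  have key : ∀ k h, h.length + k = n →
      GameWin c.1 c.2.1 c.2.2.1.length (Code.edge c) (fun y => y = c.2.2.2.2) k
        (vecSupport ((ofCode c).beliefAfter π h)) := by
    intro k
    induction k with
    | zero =>
      intro h hl
      exact (concentrated_iff (beliefAfter_nonneg hM π h) ⟨_, goal_lt hM⟩).1 (hn h hl)
    | succ k ih =>
      intro h hl
      refine Or.inr ⟨(π h : ℕ), (π h).2, fun o ho => ?_⟩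
      have e := gameNext_vecSupport hM (π h) ⟨o, ho⟩ (beliefAfter_nonneg hM π h)
      exact (congrArg (GameWin c.1 c.2.1 c.2.2.1.length (Code.edge c)
        (fun y => y = c.2.2.2.2) k) e).mpr (ih (⟨o, ho⟩ :: h) (by rw [List.length_cons]; omega))
  exact ⟨n, key n [] (by simp)⟩

theorem goalReachable_iff (hM : (ofCode c).IsGoalModel) :
    (ofCode c).GoalReachable ↔ Code.SupportReachable c := by
  unfold Code.SupportReachable
  simp only [vecSupport_start]
  exact ⟨gameWin_of_goalReachable hM, fun ⟨n, hn⟩ =>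
    goalReachable_of_winsIn hM n (winsIn_of_gameWin hM n hn)⟩

theorem computablePred_supportReachable : ComputablePred Code.SupportReachable := by
  have h1 : Primrec fun c : POMDP.Code => c.2.2.1 :=
    Primrec.fst.comp (Primrec.snd.comp Primrec.snd)
  have h2 : Primrec fun c : POMDP.Code => c.2.2.2.1 :=
    Primrec.fst.comp (Primrec.snd.comp (Primrec.snd.comp Primrec.snd))
  have h3 : Primrec fun c : POMDP.Code => c.2.2.2.2 :=
    Primrec.snd.comp (Primrec.snd.comp (Primrec.snd.comp Primrec.snd))
  refine computablePred_exists_gameWin (α := POMDP.Code)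
    (E := Code.edge) (G := fun c y => y = c.2.2.2.2)
    (S := fun c x => (c.2.2.2.1.getD x (0, 0)).1 ≠ 0) Primrec.fst
    (Primrec.fst.comp Primrec.snd) (Primrec.list_length.comp h1) ?_ ?_ ?_
  · intro β _ t a o x y ht ha ho hx hy
    have h4 : Primrec fun b => (t b).2.2.1.getD (a b) ([], []) :=
      (Primrec.list_getD (([], []) : MatCode × MatCode)).comp (h1.comp ht) ha
    exact PrimrecPred.and
      (Primrec.eq.comp (Primrec.fst.comp (primrec_entryCode' (Primrec.fst.comp h4) hx hy))
        (Primrec.const 0)).not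
      (Primrec.eq.comp (Primrec.fst.comp (primrec_entryCode' (Primrec.snd.comp h4) hy ho))
        (Primrec.const 0)).not
  · exact Primrec.eq.comp Primrec.snd (h3.comp Primrec.fst)
  · exact (Primrec.eq.comp (Primrec.fst.comp ((Primrec.list_getD ((0, 0) : RatCode)).comp
      (h2.comp Primrec.fst) Primrec.snd)) (Primrec.const 0)).not

end POMDP

theorem nontriviallyDecidable_POMDPReachability : POMDPReachability.NontriviallyDecidable := by
  have v1 : POMDPReachability.valid (1, 1, [([[(1, 0)]], [[(1, 0)]])], [(1, 0)], 0) := by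
    change POMDP.IsGoalModel ⟨1, 1, 1, _, _, _, _⟩
    refine ⟨one_pos, ?_, ?_, ?_, ?_, ?_, ?_, ⟨0, rfl, fun s _ => Subsingleton.elim _ _⟩, ?_⟩ <;>
      simp [MatCode.entry, RatCode.val]
  -- Two states that never move, started in the one that is not the goal.
  have v0 : POMDPReachability.valid (2, 1, [([[(1, 0)], [(0, 0), (1, 0)]], [[(1, 0)], [(1, 0)]])],
      [(0, 0), (1, 0)], 0) := by
    change POMDP.IsGoalModel ⟨2, 1, 1, _, _, _, _⟩
    refine ⟨one_pos, ?_, ?_, ?_, ?_, ?_, ?_, ⟨0, rfl, fun s hs => Fin.ext hs⟩, ?_⟩ <;>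
      simp [MatCode.entry, RatCode.val, Fin.forall_fin_two]
  refine ⟨?_, ⟨_, v1, (POMDP.goalReachable_iff v1).2 ⟨0, ?_⟩⟩,
    ⟨_, v0, fun h => ?_⟩⟩
  · obtain ⟨g, hg, hg'⟩ := ComputablePred.computable_iff.1 POMDP.computablePred_supportReachable
    refine ⟨g, hg, fun c hc => ?_⟩
    exact (iff_of_eq (congrFun hg' c)).symm.trans (POMDP.goalReachable_iff hc).symm
  · intro x _ hx
    change x < 1 at hx
    change x = 0
    omega
  · obtain ⟨n, hn⟩ := (POMDP.goalReachable_iff v0).1 h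
    have key : ∀ n (X : Set ℕ), 1 ∈ X → ¬ GameWin 2 1 1
        (POMDP.Code.edge (2, 1, [([[(1, 0)], [(0, 0), (1, 0)]], [[(1, 0)], [(1, 0)]])],
          [(0, 0), (1, 0)], 0)) (fun y => y = 0) n X := by
      intro n
      induction n with
      | zero => exact fun X hX h => one_ne_zero (h 1 hX one_lt_two)
      | succ n ih =>
        rintro X hX (h | ⟨a, ha, h⟩)
        · exact one_ne_zero (h 1 hX one_lt_two)
        · refine ih _ ?_ (h 0 one_pos)
          obtain rfl : a = 0 := by omega
          exact ⟨one_lt_two, 1, hX, one_lt_two, by simp [POMDP.Code.edge, MatCode.entryCode]⟩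
    exact key n _ (by simp) hn

/-! # Measurement occurrence reduces to QOMDP reachability -/

section Extend

variable {d : ℕ}

/-- A block matrix on `d` levels and one further level. -/
noncomputable def blockMatrix (X : Matrix (Fin d) (Fin d) ℂ) (r : Fin d → ℂ) (t : ℂ) :
    Matrix (Fin (d + 1)) (Fin (d + 1)) ℂ :=
  (Matrix.fromBlocks X 0 (Matrix.of fun _ : Fin 1 => r) (Matrix.of fun _ _ => t)).submatrix
    finSumFinEquiv.symm finSumFinEquiv.symm

theorem blockMatrix_apply (X : Matrix (Fin d) (Fin d) ℂ) (r : Fin d → ℂ) (t : ℂ)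
    (x y : Fin (d + 1)) : blockMatrix X r t x y =
      if hx : (x : ℕ) < d then (if hy : (y : ℕ) < d then X ⟨x, hx⟩ ⟨y, hy⟩ else 0)
      else (if hy : (y : ℕ) < d then r ⟨y, hy⟩ else t) := by
  rw [blockMatrix, Matrix.submatrix_apply]
  refine Fin.addCases (fun i => ?_) (fun i => ?_) x <;>
    refine Fin.addCases (fun j => ?_) (fun j => ?_) y <;>
    simp [finSumFinEquiv_symm_apply_castAdd, finSumFinEquiv_symm_apply_natAdd]

/-- Each alternative of `h` kills the coherences X Y r† and r Y X† between the old levels and the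
goal, so states stay block diagonal. -/
theorem act_blockMatrix (X Y : Matrix (Fin d) (Fin d) ℂ) (r : Fin d → ℂ) (t s : ℂ)
    (h : Y = 0 ∨ (r = 0 ∨ X = 0)) :
    quantum.act (blockMatrix X r t) (blockMatrix Y 0 s) =
      blockMatrix (X * Y * Xᴴ) 0 ((r ᵥ* Y) ⬝ᵥ star r + t * s * star t) := by
  have h0 : (Matrix.of fun _ : Fin 1 => (0 : Fin d → ℂ)) = 0 := rfl
  change blockMatrix X r t * blockMatrix Y 0 s * (blockMatrix X r t)ᴴ = _
  simp only [blockMatrix, Matrix.conjTranspose_submatrix, Matrix.submatrix_mul_equiv,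
    Matrix.fromBlocks_conjTranspose, Matrix.fromBlocks_multiply, h0]
  congr 1
  have h1 : X * Y * (Matrix.of fun _ : Fin 1 => r)ᴴ = 0 := by
    rcases h with rfl | rfl | rfl
    · simp
    · rw [h0]; simp
    · simp
  have h2 : (Matrix.of fun _ : Fin 1 => r) * Y * Xᴴ = 0 := by
    rcases h with rfl | rfl | rfl
    · simp
    · rw [h0]; simp
    · simp
  congr 1
  · simp
  · simp [h1]
  · simp [h2]
  · ext i j
    simp [Matrix.mul_apply, dotProduct, Matrix.vecMul]

theorem trace_blockMatrix (X : Matrix (Fin d) (Fin d) ℂ) (r : Fin d → ℂ) (t : ℂ) :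
    (blockMatrix X r t).trace = X.trace + t := by
  rw [Matrix.trace, Fin.sum_univ_castSucc, Matrix.trace]
  simp [blockMatrix_apply]

theorem conjTranspose_mul_blockMatrix (X : Matrix (Fin d) (Fin d) ℂ) (r : Fin d → ℂ) (t : ℂ)
    (h : r = 0 ∨ t = 0) : (blockMatrix X r t)ᴴ * blockMatrix X r t =
      blockMatrix (Xᴴ * X + Matrix.vecMulVec (star r) r) 0 (star t * t) := by
  have h0 : (Matrix.of fun _ : Fin 1 => (0 : Fin d → ℂ)) = 0 := rfl
  simp only [blockMatrix, Matrix.conjTranspose_submatrix, Matrix.submatrix_mul_equiv,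
    Matrix.fromBlocks_conjTranspose, Matrix.fromBlocks_multiply, h0]
  congr 1
  congr 1
  · ext i j
    simp [Matrix.mul_apply, Matrix.vecMulVec_apply]
  · ext i j
    rcases h with rfl | rfl <;> simp [Matrix.mul_apply]
  · ext i j
    rcases h with rfl | rfl <;> simp [Matrix.mul_apply]
  · ext i j
    simp [Matrix.mul_apply]

theorem blockMatrix_zero : blockMatrix (0 : Matrix (Fin d) (Fin d) ℂ) 0 0 = 0 := by
  ext x y; simp [blockMatrix_apply]

theorem blockMatrix_add (X Y : Matrix (Fin d) (Fin d) ℂ) (s t : ℂ) :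
    blockMatrix X 0 s + blockMatrix Y 0 t = blockMatrix (X + Y) 0 (s + t) := by
  ext x y
  simp only [blockMatrix_apply, Matrix.add_apply]
  split_ifs <;> simp

theorem blockMatrix_sum {ι : Type} (s : Finset ι) (X : ι → Matrix (Fin d) (Fin d) ℂ) :
    ∑ i ∈ s, blockMatrix (X i) 0 0 = blockMatrix (∑ i ∈ s, X i) 0 0 := by
  classical
  induction s using Finset.induction_on with
  | empty => simp [blockMatrix_zero]
  | insert i s hi ih => rw [Finset.sum_insert hi, Finset.sum_insert hi, ih, blockMatrix_add, add_zero]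

theorem blockMatrix_one : blockMatrix (1 : Matrix (Fin d) (Fin d) ℂ) 0 1 = 1 := by
  ext x y
  simp only [blockMatrix_apply, Matrix.one_apply, Fin.ext_iff]
  split_ifs <;> first | rfl | omega

theorem smul_blockMatrix (a : ℂ) (X : Matrix (Fin d) (Fin d) ℂ) (t : ℂ) :
    a • blockMatrix X 0 t = blockMatrix (a • X) 0 (a * t) := by
  ext x y
  simp only [blockMatrix_apply, Matrix.smul_apply]
  split_ifs <;> simp

theorem posSemidef_blockMatrix {a t : ℂ} (ha : 0 ≤ a) (ht : 0 ≤ t) :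
    (blockMatrix (a • (1 : Matrix (Fin d) (Fin d) ℂ)) 0 t).PosSemidef := by
  have h : blockMatrix (a • (1 : Matrix (Fin d) (Fin d) ℂ)) 0 t =
      Matrix.diagonal fun x : Fin (d + 1) => if (x : ℕ) < d then a else t := by
    ext x y
    simp only [blockMatrix_apply, Matrix.diagonal_apply, Matrix.smul_apply, Matrix.one_apply,
      Fin.ext_iff]
    split_ifs <;> first | rfl | omega | simp
  rw [h, Matrix.posSemidef_diagonal_iff]
  intro x
  split_ifs
  · exact ha
  · exact ht

end Extend

/-- The entries of the Kraus operator for action `j` and observation `o`: observation `0` continues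
with outcome `j`, observation `1` stays in the goal state, and every other observation stands for
another outcome and a level, and leads to the goal state. -/
def TupleCode.krausEntry (c : TupleCode) (j o x y : ℕ) : RatCode :=
  if o = 0 then (if x < c.1 ∧ y < c.1 then (c.2.getD j []).entryCode x y else (0, 0))
  else if o = 1 then (if x < c.1 ∨ y < c.1 then (0, 0) else (1, 0))
  else if ¬ x < c.1 ∧ y < c.1 ∧ (o - 2) / c.1 ≠ j then
    (c.2.getD ((o - 2) / c.1) []).entryCode ((o - 2) % c.1) y
  else (0, 0)

/-- The QOMDP in which one bets on the outcomes of a measurement device. -/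
def TupleCode.toQOMDP (c : TupleCode) : QOMDP.Code :=
  (c.1 + 1, c.2.length * c.1 + 2,
    (List.range c.2.length).map fun j => (List.range (c.2.length * c.1 + 2)).map fun o =>
      MatCode.ofFn (c.1 + 1) fun x y => c.krausEntry j o x y,
    MatCode.ofFn (c.1 + 1) fun x y => if x = y ∧ x < c.1 then (1, c.1 - 1) else (0, 0),
    MatCode.ofFn (c.1 + 1) fun x y => if x < c.1 ∨ y < c.1 then (0, 0) else (1, 0))

theorem primrec_krausEntry : Primrec fun p : (((TupleCode × ℕ) × ℕ) × ℕ) × ℕ =>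
    p.1.1.1.1.krausEntry p.1.1.1.2 p.1.1.2 p.1.2 p.2 := by
  have hc : Primrec fun p : (((TupleCode × ℕ) × ℕ) × ℕ) × ℕ => p.1.1.1.1 :=
    Primrec.fst.comp (Primrec.fst.comp (Primrec.fst.comp Primrec.fst))
  have hd : Primrec fun p : (((TupleCode × ℕ) × ℕ) × ℕ) × ℕ => p.1.1.1.1.1 := Primrec.fst.comp hc
  have hm : Primrec fun p : (((TupleCode × ℕ) × ℕ) × ℕ) × ℕ => p.1.1.1.1.2 := Primrec.snd.comp hc
  have hj : Primrec fun p : (((TupleCode × ℕ) × ℕ) × ℕ) × ℕ => p.1.1.1.2 :=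
    Primrec.snd.comp (Primrec.fst.comp (Primrec.fst.comp Primrec.fst))
  have ho : Primrec fun p : (((TupleCode × ℕ) × ℕ) × ℕ) × ℕ => p.1.1.2 :=
    Primrec.snd.comp (Primrec.fst.comp Primrec.fst)
  have hx : Primrec fun p : (((TupleCode × ℕ) × ℕ) × ℕ) × ℕ => p.1.2 :=
    Primrec.snd.comp Primrec.fst
  have hy : Primrec fun p : (((TupleCode × ℕ) × ℕ) × ℕ) × ℕ => p.2 := Primrec.snd
  have hk : Primrec fun p : (((TupleCode × ℕ) × ℕ) × ℕ) × ℕ => (p.1.1.2 - 2) / p.1.1.1.1.1 :=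
    Primrec.nat_div.comp (Primrec.nat_sub.comp ho (Primrec.const 2)) hd
  have hr : Primrec fun p : (((TupleCode × ℕ) × ℕ) × ℕ) × ℕ => (p.1.1.2 - 2) % p.1.1.1.1.1 :=
    Primrec.nat_mod.comp (Primrec.nat_sub.comp ho (Primrec.const 2)) hd
  have hget : ∀ {i : (((TupleCode × ℕ) × ℕ) × ℕ) × ℕ → ℕ}, Primrec i →
      Primrec fun p : (((TupleCode × ℕ) × ℕ) × ℕ) × ℕ => p.1.1.1.1.2.getD (i p) [] :=
    fun hi => (Primrec.list_getD ([] : MatCode)).comp hm hi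
  refine Primrec.ite (Primrec.eq.comp ho (Primrec.const 0)) (Primrec.ite
    (PrimrecPred.and (Primrec.nat_lt.comp hx hd) (Primrec.nat_lt.comp hy hd))
    (primrec_entryCode' (hget hj) hx hy) (Primrec.const _)) (Primrec.ite
    (Primrec.eq.comp ho (Primrec.const 1)) (Primrec.ite
    (PrimrecPred.or (Primrec.nat_lt.comp hx hd) (Primrec.nat_lt.comp hy hd))
    (Primrec.const _) (Primrec.const _)) (Primrec.ite (PrimrecPred.and
      (Primrec.nat_lt.comp hx hd).not (PrimrecPred.and (Primrec.nat_lt.comp hy hd)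
      (Primrec.eq.comp hk hj).not)) (primrec_entryCode' (hget hk) hr hy) (Primrec.const _)))

theorem primrec_toQOMDP : Primrec TupleCode.toQOMDP := by
  have hd : Primrec fun c : TupleCode => c.1 := Primrec.fst
  have hd1 : Primrec fun c : TupleCode => c.1 + 1 := Primrec.succ.comp hd
  have hl : Primrec fun c : TupleCode => c.2.length := Primrec.list_length.comp Primrec.snd
  have hk : Primrec fun c : TupleCode => c.2.length * c.1 + 2 :=
    Primrec.succ.comp (Primrec.succ.comp (Primrec.nat_mul.comp hl hd))
  have hx : Primrec fun p : (TupleCode × ℕ) × ℕ => p.1.2 := Primrec.snd.comp Primrec.fst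
  have hy : Primrec fun p : (TupleCode × ℕ) × ℕ => p.2 := Primrec.snd
  have hdp : Primrec fun p : (TupleCode × ℕ) × ℕ => p.1.1.1 :=
    hd.comp (Primrec.fst.comp Primrec.fst)
  refine Primrec.pair hd1 (Primrec.pair hk (Primrec.pair ?_ (Primrec.pair ?_ ?_)))
  · refine Primrec.list_map (Primrec.list_range.comp hl) ?_
    refine Primrec.list_map (Primrec.list_range.comp (hk.comp Primrec.fst)) ?_
    exact primrec_matCode_ofFn (α := (TupleCode × ℕ) × ℕ) (hd1.comp (Primrec.fst.comp Primrec.fst))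
      primrec_krausEntry
  · exact primrec_matCode_ofFn hd1 (Primrec.ite
      (PrimrecPred.and (Primrec.eq.comp hx hy) (Primrec.nat_lt.comp hx hdp))
      (Primrec.pair (Primrec.const 1) (Primrec.nat_sub.comp hdp (Primrec.const 1)))
      (Primrec.const _))
  · exact primrec_matCode_ofFn hd1 (Primrec.ite
      (PrimrecPred.or (Primrec.nat_lt.comp hx hdp) (Primrec.nat_lt.comp hy hdp))
      (Primrec.const _) (Primrec.const _))

section

variable {c : TupleCode}

theorem MatCode.toComplex_ofFn (d : ℕ) (f : ℕ → ℕ → RatCode) :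
    (MatCode.ofFn d f).toComplex d = Matrix.of fun x y : Fin d => ((f x y).val : ℂ) := by
  rw [MatCode.toComplex, MatCode.toMatrix_ofFn]
  rfl

/-- The transition matrix of outcome `j`. -/
noncomputable def TupleCode.op (c : TupleCode) (j : ℕ) : Matrix (Fin c.1) (Fin c.1) ℂ :=
  (c.2.getD j []).toComplex c.1

theorem TupleCode.toComplex_eq_op (j : Fin c.2.length) : c.toComplex j = c.op j := by
  rw [TupleCode.op, List.getD_eq_getElem _ _ j.2]
  rfl

/-- The Kraus operators of action `a`. -/
noncomputable def TupleCode.krausOp (c : TupleCode) (a : ℕ) (o : Fin (c.2.length * c.1 + 2)) :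
    Matrix (Fin (c.1 + 1)) (Fin (c.1 + 1)) ℂ :=
  Matrix.of fun x y => ((c.krausEntry a o x y).val : ℂ)

theorem TupleCode.kraus_toQOMDP (c : TupleCode) (a : Fin (QOMDP.ofCode c.toQOMDP).numAct)
    (o : Fin (c.2.length * c.1 + 2)) : (QOMDP.ofCode c.toQOMDP).kraus a o = c.krausOp a o := by
  rw [TupleCode.krausOp, ← MatCode.toComplex_ofFn]
  change MatCode.toComplex (List.getD (List.get _ a) o []) _ = _
  have h : ∀ a : Fin ((List.range c.2.length).map fun j =>
      (List.range (c.2.length * c.1 + 2)).map fun o =>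
        MatCode.ofFn (c.1 + 1) fun x y => c.krausEntry j o x y).length,
      (List.get _ a).getD o [] = MatCode.ofFn (c.1 + 1) fun x y => c.krausEntry a o x y := by
    intro a
    rw [List.get_eq_getElem]
    simp [List.getD_eq_getElem?_getD]
  exact congrArg (fun m => MatCode.toComplex m (c.1 + 1)) (h a)

theorem TupleCode.krausOp_zero (c : TupleCode) (a : ℕ) :
    c.krausOp a (0 : Fin (c.2.length * c.1 + 2)) =
      blockMatrix (c.op a) 0 0 := by
  ext x y
  simp only [blockMatrix_apply, TupleCode.krausOp, Matrix.of_apply, TupleCode.krausEntry]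
  by_cases hx : (x : ℕ) < c.1 <;> by_cases hy : (y : ℕ) < c.1 <;>
    simp [hx, hy, RatCode.val_zero]
  rfl

theorem TupleCode.krausOp_one (c : TupleCode) (a : ℕ) :
    c.krausOp a (1 : Fin (c.2.length * c.1 + 2)) =
      blockMatrix 0 0 1 := by
  ext x y
  simp only [blockMatrix_apply, TupleCode.krausOp, Matrix.of_apply, TupleCode.krausEntry]
  by_cases hx : (x : ℕ) < c.1 <;> by_cases hy : (y : ℕ) < c.1 <;>
    simp [hx, hy, RatCode.val]

/-- The index k encodes an outcome i and a row b. For i ≠ a the operator transfers row b of outcome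
i to the goal level; for i = a it is zero, which gives all actions the same set of observations. -/
theorem TupleCode.krausOp_succ (c : TupleCode) (a : ℕ)
    (k : Fin (c.2.length * c.1)) (i : ℕ) (b : Fin c.1) (hk : (k : ℕ) = b + c.1 * i) :
    c.krausOp a (k.succ.succ : Fin (c.2.length * c.1 + 2)) =
      blockMatrix 0 (if i = a then 0 else fun y => c.op i b y) 0 := by
  have hd : 0 < c.1 := b.pos
  have h1 : (k : ℕ) / c.1 = i := by
    rw [hk, Nat.add_mul_div_left _ _ hd, Nat.div_eq_of_lt b.2, zero_add]
  have h2 : (k : ℕ) % c.1 = b := by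
    rw [hk, Nat.add_mul_mod_self_left, Nat.mod_eq_of_lt b.2]
  ext x y
  simp only [blockMatrix_apply, TupleCode.krausOp, Matrix.of_apply, TupleCode.krausEntry]
  by_cases hx : (x : ℕ) < c.1 <;> by_cases hy : (y : ℕ) < c.1 <;> by_cases hi : i = a <;>
    simp [hx, hy, hi, RatCode.val_zero, h1, h2]
  rfl

theorem TupleCode.start_toQOMDP (hd : 0 < c.1) :
    (QOMDP.ofCode c.toQOMDP).start = blockMatrix (mixedState c.1) 0 0 := by
  change MatCode.toComplex (MatCode.ofFn (c.1 + 1) _) (c.1 + 1) = _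
  rw [MatCode.toComplex_ofFn]
  ext x y
  simp only [blockMatrix_apply, Matrix.of_apply, mixedState, Matrix.smul_apply, Matrix.one_apply,
    Fin.ext_iff]
  have h : ((c.1 - 1 : ℕ) : ℚ) + 1 = c.1 := by
    rw [Nat.cast_sub hd]; simp
  by_cases hx : (x : ℕ) < c.1 <;> by_cases hy : (y : ℕ) < c.1 <;> by_cases hxy : (x : ℕ) = y <;>
    simp [hx, hy, hxy, RatCode.val, h]

theorem TupleCode.goal_toQOMDP : (QOMDP.ofCode c.toQOMDP).goal = blockMatrix 0 0 1 := by
  change MatCode.toComplex (MatCode.ofFn (c.1 + 1) _) (c.1 + 1) = _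
  rw [MatCode.toComplex_ofFn]
  ext x y
  simp only [blockMatrix_apply, Matrix.of_apply]
  by_cases hx : (x : ℕ) < c.1 <;> by_cases hy : (y : ℕ) < c.1 <;> simp [hx, hy, RatCode.val]

theorem TupleCode.sum_op (hc : (MOP quantum).valid c) :
    ∑ i ∈ Finset.range c.2.length, (c.op i)ᴴ * c.op i = 1 := by
  rw [← Fin.sum_univ_eq_sum_range fun i => (c.op i)ᴴ * c.op i]
  simp only [← TupleCode.toComplex_eq_op]
  exact hc.2

theorem TupleCode.length_pos (hc : (MOP quantum).valid c) : 0 < c.2.length := by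
  rw [Nat.pos_iff_ne_zero]
  intro h
  have h1 := TupleCode.sum_op hc
  rw [h, Finset.range_zero, Finset.sum_empty] at h1
  have := congrFun (congrFun h1 ⟨0, hc.1⟩) ⟨0, hc.1⟩
  simp at this

theorem TupleCode.numAct_toQOMDP (c : TupleCode) :
    (QOMDP.ofCode c.toQOMDP).numAct = c.2.length := by
  change List.length (List.map _ _) = _
  simp

theorem sum_vecMulVec_star_row {d : ℕ} (X : Matrix (Fin d) (Fin d) ℂ) :
    ∑ b, Matrix.vecMulVec (star fun y => X b y) (fun y => X b y) = Xᴴ * X := by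
  ext x y
  simp [Matrix.sum_apply, Matrix.vecMulVec_apply, Matrix.mul_apply]

/-- Summing r†r over the rows r of A_i gives A_i†A_i. So the losing bets contribute ∑ A_i†A_i over i
≠ a, observation 0 supplies the missing summand, and observation 1 the projection to the goal. -/
theorem TupleCode.sum_krausOp (hc : (MOP quantum).valid c) {a : ℕ} (ha : a < c.2.length) :
    ∑ o, (c.krausOp a o)ᴴ * c.krausOp a o = 1 := by
  rw [Fin.sum_univ_succ, Fin.sum_univ_succ]
  have h4 : ∀ (i : Fin c.2.length) (b : Fin c.1),
      (c.krausOp a (finProdFinEquiv (i, b)).succ.succ)ᴴ *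
        c.krausOp a (finProdFinEquiv (i, b)).succ.succ =
      blockMatrix (if (i : ℕ) = a then 0 else
        Matrix.vecMulVec (star fun y => c.op i b y) (fun y => c.op i b y)) 0 0 := by
    intro i b
    rw [TupleCode.krausOp_succ c a (finProdFinEquiv (i, b)) i b rfl,
      conjTranspose_mul_blockMatrix _ _ _ (Or.inr rfl)]
    by_cases hi : (i : ℕ) = a
    · rw [if_pos hi, if_pos hi]; simp
    · rw [if_neg hi, if_neg hi]; simp
  have h3 : ∑ k : Fin (c.2.length * c.1), (c.krausOp a k.succ.succ)ᴴ * c.krausOp a k.succ.succ =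
      blockMatrix (∑ i ∈ (Finset.range c.2.length).erase a, (c.op i)ᴴ * c.op i) 0 0 := by
    rw [← finProdFinEquiv.sum_comp, Fintype.sum_prod_type]
    simp only [h4, blockMatrix_sum]
    congr 1
    have h5 : ∀ i : Fin c.2.length, (∑ b : Fin c.1, if (i : ℕ) = a then 0 else
        Matrix.vecMulVec (star fun y => c.op i b y) (fun y => c.op i b y)) =
        if (i : ℕ) = a then 0 else (c.op i)ᴴ * c.op i := by
      intro i
      split_ifs
      · simp
      · exact sum_vecMulVec_star_row _
    simp only [h5]
    rw [Fin.sum_univ_eq_sum_range fun i => if i = a then 0 else (c.op i)ᴴ * c.op i,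
      ← Finset.add_sum_erase _ _ (Finset.mem_range.2 ha), if_pos rfl, zero_add]
    exact Finset.sum_congr rfl fun i hi => if_neg (Finset.ne_of_mem_erase hi)
  have h1 := TupleCode.krausOp_zero c a
  have h2 := TupleCode.krausOp_one c a
  rw [h3, h1]
  rw [show (Fin.succ 0 : Fin (c.2.length * c.1 + 2)) = 1 from rfl, h2,
    conjTranspose_mul_blockMatrix _ _ _ (Or.inl rfl),
    conjTranspose_mul_blockMatrix _ _ _ (Or.inl rfl), blockMatrix_add, blockMatrix_add,
    ← blockMatrix_one]
  congr 1
  · rw [← TupleCode.sum_op hc, ← Finset.add_sum_erase _ _ (Finset.mem_range.2 ha)]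
    simp
  · simp

/-- Every observation keeps the state off the goal or in the goal. -/
theorem TupleCode.act_krausOp (c : TupleCode) (a : ℕ) (o : Fin (c.2.length * c.1 + 2))
    (Y : Matrix (Fin c.1) (Fin c.1) ℂ) :
    (o = 0 ∧ quantum.act (c.krausOp a o) (blockMatrix Y 0 0) =
      blockMatrix (c.op a * Y * (c.op a)ᴴ) 0 0) ∨
    ∃ r, quantum.act (c.krausOp a o) (blockMatrix Y 0 0) = blockMatrix 0 0 r := by
  induction o using Fin.cases with
  | zero =>
    left
    refine ⟨rfl, ?_⟩
    rw [TupleCode.krausOp_zero, act_blockMatrix _ _ _ _ _ (Or.inr (Or.inl rfl))]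
    simp
  | succ o =>
    right
    induction o using Fin.cases with
    | zero =>
      rw [show (Fin.succ 0 : Fin (c.2.length * c.1 + 2)) = 1 from rfl, TupleCode.krausOp_one,
        act_blockMatrix _ _ _ _ _ (Or.inr (Or.inl rfl))]
      exact ⟨0, by simp⟩
    | succ k =>
      have hk : ((finProdFinEquiv.symm k).2 : ℕ) + c.1 * (finProdFinEquiv.symm k).1 = k :=
        congrArg Fin.val (finProdFinEquiv.apply_symm_apply k)
      rw [TupleCode.krausOp_succ c a k _ _ hk.symm,
        act_blockMatrix _ _ _ _ _ (Or.inr (Or.inr rfl))]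
      exact ⟨_, by simp; rfl⟩

theorem TupleCode.act_krausOp_goal (c : TupleCode) (a : ℕ) (o : Fin (c.2.length * c.1 + 2))
    (s : ℂ) : ∃ r, quantum.act (c.krausOp a o) (blockMatrix 0 0 s) = blockMatrix 0 0 r := by
  induction o using Fin.cases with
  | zero =>
    rw [TupleCode.krausOp_zero, act_blockMatrix _ _ _ _ _ (Or.inl rfl)]
    exact ⟨0, by simp⟩
  | succ o =>
    induction o using Fin.cases with
    | zero =>
      rw [show (Fin.succ 0 : Fin (c.2.length * c.1 + 2)) = 1 from rfl, TupleCode.krausOp_one,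
        act_blockMatrix _ _ _ _ _ (Or.inl rfl)]
      exact ⟨s, by simp⟩
    | succ k =>
      have hk : ((finProdFinEquiv.symm k).2 : ℕ) + c.1 * (finProdFinEquiv.symm k).1 = k :=
        congrArg Fin.val (finProdFinEquiv.apply_symm_apply k)
      rw [TupleCode.krausOp_succ c a k _ _ hk.symm, act_blockMatrix _ _ _ _ _ (Or.inl rfl)]
      exact ⟨0, by simp⟩

theorem normalize_goal {d : ℕ} (s : ℂ) (h : (blockMatrix (0 : Matrix (Fin d) (Fin d) ℂ) 0 s).trace ≠ 0) :
    (blockMatrix (0 : Matrix (Fin d) (Fin d) ℂ) 0 s).trace⁻¹ •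
      blockMatrix (0 : Matrix (Fin d) (Fin d) ℂ) 0 s = blockMatrix 0 0 1 := by
  rw [trace_blockMatrix, Matrix.trace_zero, zero_add] at h ⊢
  rw [smul_blockMatrix, smul_zero, inv_mul_cancel₀ h]

theorem TupleCode.isGoalModel_toQOMDP (hc : (MOP quantum).valid c) :
    (QOMDP.ofCode c.toQOMDP).IsGoalModel := by
  have hnum := TupleCode.numAct_toQOMDP c
  refine ⟨Nat.succ_pos _, hnum.symm ▸ TupleCode.length_pos hc, fun a => ?_, ?_, ?_, fun a o => ?_⟩
  · refine Eq.trans (Finset.sum_congr rfl fun o _ => ?_)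
      (TupleCode.sum_krausOp hc (a.2.trans_eq hnum))
    have := TupleCode.kraus_toQOMDP c a o
    exact congrArg (fun X => Xᴴ * X) this
  · rw [TupleCode.start_toQOMDP hc.1]
    refine ⟨posSemidef_blockMatrix ?_ le_rfl, ?_⟩
    · rw [← Complex.ofReal_natCast, ← Complex.ofReal_inv, Complex.zero_le_real]
      positivity
    · exact (trace_blockMatrix _ _ _).trans (by rw [(mixedState_mem hc.1).2, add_zero])
  · rw [TupleCode.goal_toQOMDP]
    refine ⟨?_, ?_⟩
    · have := posSemidef_blockMatrix (d := c.1) (le_refl (0 : ℂ)) zero_le_one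
      rwa [zero_smul] at this
    · exact (trace_blockMatrix _ _ _).trans (by rw [Matrix.trace_zero, zero_add])
  · obtain ⟨r, hr⟩ := TupleCode.act_krausOp_goal c a o 1
    have h : quantum.act ((QOMDP.ofCode c.toQOMDP).kraus a o) (QOMDP.ofCode c.toQOMDP).goal =
        blockMatrix 0 0 r := by
      rw [TupleCode.goal_toQOMDP, ← hr]
      exact congrArg (fun X => quantum.act X _) (TupleCode.kraus_toQOMDP c a o)
    intro σ hσ
    have hσ' : σ = blockMatrix 0 0 r := h
    rw [TupleCode.goal_toQOMDP]
    rw [hσ'] at hσ ⊢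
    exact normalize_goal r hσ

theorem TupleCode.stateAfter_cons (π : List (Fin (c.2.length * c.1 + 2)) →
    Fin (QOMDP.ofCode c.toQOMDP).numAct) (o : Fin (c.2.length * c.1 + 2))
    (h : List (Fin (c.2.length * c.1 + 2))) :
    (QOMDP.ofCode c.toQOMDP).stateAfter π (o :: h) =
      quantum.act (c.krausOp (π h) o) ((QOMDP.ofCode c.toQOMDP).stateAfter π h) :=
  congrArg (fun X => quantum.act X ((QOMDP.ofCode c.toQOMDP).stateAfter π h))
    (TupleCode.kraus_toQOMDP c (π h) o)

/-- Along the history in which every bet is correct the state never acquires weight at the goal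
level. If the goal is reached with certainty, this history has probability 0, and the actions of the
policy along it spell an impossible sequence of outcomes. -/
theorem TupleCode.yes_of_goalReachable (hc : (MOP quantum).valid c)
    (h : (QOMDP.ofCode c.toQOMDP).GoalReachable) : (MOP quantum).yes c := by
  rw [MOP_quantum_yes_iff c hc.1, MMP_yes_iff_totalMatrix c hc.1]
  obtain ⟨n, π, hn⟩ := h
  have key : ∀ k, ∃ w : List (Fin c.2.length), (QOMDP.ofCode c.toQOMDP).stateAfter π
      (List.replicate k (0 : Fin (c.2.length * c.1 + 2))) = blockMatrix
        ((w.map c.toComplex).prod * mixedState c.1 * ((w.map c.toComplex).prod)ᴴ) 0 0 := by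
    intro k
    induction k with
    | zero => exact ⟨[], (TupleCode.start_toQOMDP hc.1).trans
        (congrArg (fun X => blockMatrix X 0 0) (by simp))⟩
    | succ k ih =>
      obtain ⟨w, hw⟩ := ih
      refine ⟨Fin.cast (TupleCode.numAct_toQOMDP c) (π (List.replicate k (0 : Fin (c.2.length * c.1 + 2)))) :: w, ?_⟩
      refine (TupleCode.stateAfter_cons π 0 (List.replicate k (0 : Fin (c.2.length * c.1 + 2)))).trans ?_
      refine (congrArg (quantum.act (c.krausOp _ _)) hw).trans ?_
      refine (congrArg (fun X => quantum.act X _) (TupleCode.krausOp_zero c _)).trans ?_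
      refine (act_blockMatrix _ _ _ _ _ (Or.inr (Or.inl rfl))).trans ?_
      simp only [List.map_cons, List.prod_cons, TupleCode.toComplex_eq_op,
        Matrix.conjTranspose_mul, Matrix.mul_assoc, mul_zero, zero_mul, Fin.val_cast,
        Matrix.zero_vecMul, zero_dotProduct, add_zero]
      rfl
  obtain ⟨w, hw⟩ := key n
  refine ⟨w.reverse, ?_⟩
  rw [totalMatrix_eq_prod, List.reverse_reverse, ← trace_mul_mixedState_eq_zero_iff hc.1]
  by_contra hne
  have h1 := hn (List.replicate n (0 : Fin (c.2.length * c.1 + 2))) (List.length_replicate ..)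
  rw [hw, TupleCode.goal_toQOMDP] at h1
  have h2 := h1 (fun h => hne ((trace_blockMatrix _ _ _).trans (add_zero _) |>.symm.trans h))
  -- Compare the entries at the goal level: 0 for the state, 1 for the goal.
  have h3 := congrFun (congrFun ((smul_blockMatrix _ _ _).symm.trans h2) (Fin.last c.1))
    (Fin.last c.1)
  simp [blockMatrix_apply] at h3

/-- Bet on the letters of the impossible sequence in turn. Any history with a wrong bet leads to the
goal block and stays there; the remaining one ends in the zero state. -/
theorem TupleCode.goalReachable_of_yes (hc : (MOP quantum).valid c)
    (h : (MOP quantum).yes c) : (QOMDP.ofCode c.toQOMDP).GoalReachable := by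
  rw [MOP_quantum_yes_iff c hc.1, MMP_yes_iff_totalMatrix c hc.1] at h
  obtain ⟨w, hw⟩ := h
  rw [totalMatrix_eq_prod] at hw
  -- The default letter is used only at histories at least as long as `w`, which play no role.
  let π : List (Fin (c.2.length * c.1 + 2)) → Fin (QOMDP.ofCode c.toQOMDP).numAct := fun h =>
    Fin.cast (TupleCode.numAct_toQOMDP c).symm (w.getD h.length ⟨0, TupleCode.length_pos hc⟩)
  have key : ∀ h : List (Fin (c.2.length * c.1 + 2)), h.length ≤ w.length →
      ((QOMDP.ofCode c.toQOMDP).stateAfter π h = blockMatrix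
        (((w.take h.length).reverse.map c.toComplex).prod * mixedState c.1 *
          (((w.take h.length).reverse.map c.toComplex).prod)ᴴ) 0 0) ∨
      ∃ r, (QOMDP.ofCode c.toQOMDP).stateAfter π h = blockMatrix 0 0 r := by
    intro h
    induction h with
    | nil => exact fun _ => Or.inl ((TupleCode.start_toQOMDP hc.1).trans
        (congrArg (fun X => blockMatrix X 0 0) (by simp)))
    | cons o h ih =>
      intro hl
      rw [List.length_cons] at hl
      have e := TupleCode.stateAfter_cons π o h
      rcases ih (by omega) with ih | ⟨r, ih⟩
      · rw [ih] at e
        rcases TupleCode.act_krausOp c (π h) o (((w.take h.length).reverse.map c.toComplex).prod *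
          mixedState c.1 * (((w.take h.length).reverse.map c.toComplex).prod)ᴴ) with ⟨-, h1⟩ | ⟨r, h1⟩
        · left
          refine e.trans (h1.trans ?_)
          have hop : c.op (π h) = c.toComplex (w[h.length]'hl) := by
            rw [TupleCode.toComplex_eq_op]
            change c.op (w.getD h.length _ : Fin _) = _
            rw [List.getD_eq_getElem _ _ hl]
          rw [hop, List.length_cons, List.take_succ_eq_append_getElem hl]
          simp only [List.reverse_append, List.reverse_singleton, List.singleton_append,
            List.map_cons, List.prod_cons, Matrix.conjTranspose_mul, Matrix.mul_assoc]
        · exact Or.inr ⟨r, e.trans h1⟩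
      · rw [ih] at e
        obtain ⟨r', h1⟩ := TupleCode.act_krausOp_goal c (π h) o r
        exact Or.inr ⟨r', e.trans h1⟩
  refine ⟨w.length, π, fun h hl => ?_⟩
  intro σ hσ
  rw [TupleCode.goal_toQOMDP]
  have hl' : List.length (α := Fin (c.2.length * c.1 + 2)) h = w.length := hl
  rcases key h hl'.le with h1 | ⟨r, h1⟩
  · rw [hl', List.take_length, hw] at h1
    have h2 : σ = blockMatrix 0 0 0 := h1.trans (congrArg (fun X => blockMatrix X 0 0) (by simp))
    exact absurd ((congrArg Matrix.trace (h2.trans blockMatrix_zero)).trans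
      (Matrix.trace_zero ..)) hσ
  · have h2 : σ = blockMatrix 0 0 r := h1
    rw [h2] at hσ ⊢
    exact normalize_goal r hσ

end

theorem MOP_quantum_reduces_QOMDPReachability : (MOP quantum).Reduces QOMDPReachability :=
  ⟨TupleCode.toQOMDP, primrec_toQOMDP.to_comp, fun _ hc => ⟨TupleCode.isGoalModel_toQOMDP hc,
    ⟨TupleCode.goalReachable_of_yes hc, TupleCode.yes_of_goalReachable hc⟩⟩⟩

/-! ### Completing integer matrices to a quantum measurement -/

-- Vectors e_i - t_ij e_j, one for each ordered pair, cancel the off-diagonal entries; as (k, l) and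
-- (l, k) both contribute, what is cancelled is 2t. The diagonal is then filled up to N by sums of
-- four squares. The set of vectors is indexed independently of N, so its size is known before N is
-- chosen.
open Finset in
theorem exists_sum_vecMulVec_add_eq {J : Type*} [Fintype J] [DecidableEq J] (o : J)
    (t : J → J → ℤ) (ht : ∀ i j, t i j = t j i) (h0 : ∀ j, t o j = 0) :
    ∃ M : ℕ, ∀ N : ℕ, M ≤ N → ∃ u : (J × J) ⊕ (J × Fin 4) → J → ℤ, (∀ κ, u κ o = 0) ∧
      ∀ k l, 2 * t k l + ∑ κ, u κ k * u κ l = if k = l ∧ k ≠ o then (N : ℤ) else 0 := by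
  let p : J × J → J → ℤ := fun ij k => if k = o then 0 else
    (if ij.1 = k then 1 else 0) - t ij.1 ij.2 * (if ij.2 = k then 1 else 0)
  let r : J → ℤ := fun k => 2 * t k k + ∑ ij, p ij k * p ij k
  have hoff : ∀ k l, k ≠ l → 2 * t k l + ∑ ij, p ij k * p ij l = 0 := by
    intro k l hkl
    by_cases hk : k = o
    · simp [p, hk, h0]
    by_cases hl : l = o
    · simp [p, hl, ht k o, h0]
    have : ∀ ij : J × J, p ij k * p ij l = (if ij = (k, l) then - t k l else 0) +
        (if ij = (l, k) then - t l k else 0) := by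
      rintro ⟨i, j⟩
      simp only [p, hk, hl, if_false, Prod.mk.injEq]
      by_cases h1 : i = k
      · subst h1
        simp only [hkl, if_true, if_false, true_and, false_and]
        by_cases h2 : j = l
        · subst h2
          simp [Ne.symm hkl]
        · simp [h2]
      · by_cases h3 : i = l
        · subst h3
          by_cases h4 : j = k
          · subst h4; simp [h1, hkl]
          · simp [h1, h4]
        · by_cases h4 : j = k
          · subst h4; simp [h1, h3, hkl]
          · simp [h1, h3, h4]
    rw [sum_congr rfl fun ij _ => this ij, sum_add_distrib, sum_ite_eq', sum_ite_eq', ht l k]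
    simp
    ring
  refine ⟨∑ k, (r k).natAbs, fun N hN => ?_⟩
  have hq : ∀ k, ∃ q : Fin 4 → ℤ, (∑ i, q i * q i) = if k = o then 0 else (N : ℤ) - r k := by
    intro k
    by_cases hk : k = o
    · exact ⟨0, by simp [hk]⟩
    have h1 : (r k).natAbs ≤ N :=
      (single_le_sum (f := fun k => (r k).natAbs) (fun _ _ => Nat.zero_le _) (mem_univ k)).trans hN
    -- Lagrange: the missing amount N - r_k is nonnegative by the choice of the bound.
    obtain ⟨a, b, c, d, h⟩ := Nat.sum_four_squares ((N : ℤ) - r k).toNat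
    refine ⟨![a, b, c, d], ?_⟩
    have h2 : (((N : ℤ) - r k).toNat : ℤ) = N - r k := Int.toNat_of_nonneg (by omega)
    rw [if_neg hk, ← h2, ← h]
    simp [Fin.sum_univ_four]
    ring
  choose q hq using hq
  refine ⟨Sum.elim p fun ki k => if ki.1 = k then q ki.1 ki.2 else 0, ?_, fun k l => ?_⟩
  · rintro (ij | ⟨k, i⟩)
    · simp [p]
    · by_cases hk : k = o
      · subst hk
        have h := hq k
        rw [if_pos rfl, sum_eq_zero_iff_of_nonneg fun i _ => mul_self_nonneg _] at h
        simpa using h i (mem_univ i)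
      · simp [hk]
  · rw [Fintype.sum_sum_type, Fintype.sum_prod_type (f := fun ki : J × Fin 4 => _)]
    simp only [Sum.elim_inl, Sum.elim_inr]
    by_cases hkl : k = l
    · subst hkl
      have : ∑ x, ∑ y, (if x = k then q x y else 0) * (if x = k then q x y else 0) =
          ∑ y, q k y * q k y := by
        rw [sum_eq_single k (fun x _ hx => by simp [hx]) (by simp)]
        simp
      rw [this, hq k]
      by_cases hk : k = o
      · simp [hk, h0, p]
      · rw [if_neg hk, if_pos ⟨rfl, hk⟩]
        simp only [r]
        ring
    · have : ∑ x, ∑ y, (if x = k then q x y else 0) * (if x = l then q x y else 0) = 0 := by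
        refine sum_eq_zero fun x _ => sum_eq_zero fun y _ => ?_
        by_cases hx : x = k
        · subst hx; simp [hkl]
        · simp [hx]
      rw [this, add_zero, hoff k l hkl, if_neg (fun h => hkl h.1)]

/-- With e the unit vector at `o` and a the row of A at `o` without its entry there, e - 16a cancels
the cross terms with `o` at the cost of 256 aaᵀ elsewhere. The pairs ±e + 2u have no cross terms in
total and contribute 8 ∑ uuᵀ, which by the preceding lemma for t = A + 16 aaᵀ makes the block away
from `o` scalar. Copies of e adjust the entry at `o`. All vectors used are odd at `o` and even
elsewhere. -/
theorem exists_odd_completion {J : Type*} [Fintype J] [DecidableEq J] (o : J)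
    (A : J → J → ℤ) (hA : ∀ i j, A i j = A j i) :
    ∃ n : ℕ, 0 < n ∧ ∃ T : List (J → ℤ), (∀ τ ∈ T, Odd (τ o) ∧ ∀ j, j ≠ o → Even (τ j)) ∧
      ∀ k l, 16 * A k l + (T.map fun τ => τ k * τ l).sum = if k = l then (n : ℤ) ^ 2 else 0 := by
  let a : J → ℤ := fun j => if j = o then 0 else A o j
  let e : J → ℤ := fun j => if j = o then 1 else 0
  let t : J → J → ℤ := fun i j => if i = o ∨ j = o then 0 else A i j + 16 * (a i * a j)
  obtain ⟨M, hM⟩ := exists_sum_vecMulVec_add_eq o t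
    (fun i j => by simp only [t, or_comm (a := i = o), hA i j, mul_comm (a i)]) (by simp [t])
  let C : ℕ := Fintype.card ((J × J) ⊕ (J × Fin 4))
  let k : ℕ := M + (A o o).natAbs + C + 1
  -- The value N = 2k² makes the resulting scalar 8N = (4k)² a square, so that division by its root
  -- keeps the matrices rational.
  obtain ⟨u, hu0, hu⟩ := hM (2 * k ^ 2) (by nlinarith [show M ≤ k by omega, show 1 ≤ k by omega])
  have hR : 0 ≤ (16 * k ^ 2 : ℤ) - (16 * A o o + 1 + 2 * C) := by
    have h1 : (k : ℤ) = M + |A o o| + C + 1 := by simp [k]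
    have h2 := le_abs_self (A o o)
    nlinarith [show (0 : ℤ) ≤ M by positivity, show (0 : ℤ) ≤ C by positivity, abs_nonneg (A o o)]
  -- The entry at (o, o) already has 16 A_oo, 1 from the first vector and 2C from the pairs; k was
  -- taken large enough for the rest to be nonnegative.
  let R : ℕ := ((16 * k ^ 2 : ℤ) - (16 * A o o + 1 + 2 * C)).toNat
  have hR' : (R : ℤ) = (16 * k ^ 2 : ℤ) - (16 * A o o + 1 + 2 * C) := Int.toNat_of_nonneg hR
  refine ⟨4 * k, by omega, (fun j => e j - 16 * a j) ::
    (Finset.univ.toList.map (fun κ j => e j + 2 * u κ j) ++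
      (Finset.univ.toList.map (fun κ j => - e j + 2 * u κ j) ++ List.replicate R e)), ?_, ?_⟩
  · intro τ hτ
    simp only [List.mem_cons, List.mem_append, List.mem_map, Finset.mem_toList, Finset.mem_univ,
      true_and, List.mem_replicate] at hτ
    rcases hτ with rfl | ⟨κ, rfl⟩ | ⟨κ, rfl⟩ | ⟨-, rfl⟩
    · refine ⟨by simp [e, a], fun j hj => ?_⟩
      simp only [e, hj, if_false]
      exact ⟨-8 * a j, by ring⟩
    · refine ⟨by simp [e, hu0], fun j hj => by simp [e, hj]⟩
    · refine ⟨by simp [e, hu0], fun j hj => by simp [e, hj]⟩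
    · exact ⟨by simp [e], fun j hj => by simp [e, hj]⟩
  · intro i j
    have h1 : ∀ s : ℤ, ((Finset.univ.toList.map fun κ j => s * e j + 2 * u κ j).map
        fun τ => τ i * τ j).sum = ∑ κ, (s * e i + 2 * u κ i) * (s * e j + 2 * u κ j) := by
      intro s
      rw [List.map_map]
      exact Finset.sum_map_toList _ _
    have h2 := h1 1
    have h3 := h1 (-1)
    simp only [one_mul, neg_one_mul] at h2 h3
    rw [List.map_cons, List.sum_cons, List.map_append, List.sum_append, List.map_append,
      List.sum_append, h2, h3, List.map_replicate, List.sum_replicate, nsmul_eq_mul, hR']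
    have h4 : ∑ κ, (e i + 2 * u κ i) * (e j + 2 * u κ j) +
        ∑ κ, (-e i + 2 * u κ i) * (-e j + 2 * u κ j) =
        2 * C * (e i * e j) + 8 * ∑ κ, u κ i * u κ j := by
      rw [← Finset.sum_add_distrib, Finset.mul_sum, show (2 * C * (e i * e j) : ℤ) =
        ∑ κ : (J × J) ⊕ (J × Fin 4), 2 * (e i * e j) by
          rw [Finset.sum_const, Finset.card_univ, nsmul_eq_mul]; ring, ← Finset.sum_add_distrib]
      exact Finset.sum_congr rfl fun κ _ => by ring
    have h5 := hu i j
    have h6 : 16 * A i j = 16 * A o o * (e i * e j) + 16 * (e i * a j + e j * a i) + 16 * t i j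
        - 256 * (a i * a j) := by
      by_cases hi : i = o <;> by_cases hj : j = o
      · subst hi; subst hj; simp [e, a, t]
      · subst hi; simp [e, a, t, hj]
      · subst hj; simp [e, a, t, hi, hA i j]
      · simp [e, t, hi, hj]
        ring
    have h7 : (if i = j then ((4 * k : ℕ) : ℤ) ^ 2 else 0) = 16 * k ^ 2 * (e i * e j) +
        8 * (if i = j ∧ i ≠ o then ((2 * k ^ 2 : ℕ) : ℤ) else 0) := by
      by_cases hij : i = j
      · subst hij
        by_cases hi : i = o
        · simp [hi, e]; ring
        · simp [hi, e]; ring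
      · simp only [hij, if_false, false_and]
        by_cases hi : i = o
        · have : j ≠ o := fun h => hij (hi.trans h.symm)
          simp [e, this]
        · simp [e, hi]
    rw [h7, ← h5]
    linear_combination h6 + h4

/-- The lists `C` and `R` are chosen before x: for a unit vector s one has (s rᵀ)ᵀ(s rᵀ) = r rᵀ, so
the normalisation does not see x. Applied to x, every product of the matrices is a nonzero multiple
of some g x, unless the row τ₀ meets a g x with τ₀ · (g x) = 0; the completing rows have odd values
there. -/
theorem exists_kraus_family {J : Type*} [Fintype J] [DecidableEq J] (o : J)
    (G : List (Matrix J J ℤ)) (hG : ∀ g ∈ G, ∀ j, g o j = if j = o then 1 else 0) (τ₀ : J → ℤ) :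
    ∃ (C : List (Matrix J J ℚ)) (R : List (J → ℚ)), ∀ (x : J → ℤ) (q : ℤ), x o = 1 → q ≠ 0 →
      x ⬝ᵥ x = q ^ 2 →
      ((C ++ R.map (Matrix.vecMulVec fun j => (x j : ℚ) / q)).map fun K => Kᵀ * K).sum = 1 ∧
      ((∃ w : List (Matrix J J ℚ),
        (∀ K ∈ w, K ∈ C ++ R.map (Matrix.vecMulVec fun j => (x j : ℚ) / q)) ∧ w.prod = 0) ↔
      ∃ w : List (Matrix J J ℤ), (∀ g ∈ w, g ∈ G) ∧ τ₀ ⬝ᵥ (w.prod *ᵥ x) = 0) := by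
  obtain ⟨n, hn, T, hT, hsum⟩ := exists_odd_completion o
    (fun k l => (G.map fun g => (gᵀ * g) k l).sum + τ₀ k * τ₀ l) (fun i j => by
      rw [mul_comm (τ₀ i)]
      congr 2
      refine List.map_congr_left fun g _ => ?_
      rw [← Matrix.transpose_apply (gᵀ * g), Matrix.transpose_mul, Matrix.transpose_transpose])
  have hn0 : (n : ℚ) ≠ 0 := by positivity
  let row : ℚ → (J → ℤ) → J → ℚ := fun a τ j => a * τ j
  let cst : Matrix J J ℤ → Matrix J J ℚ := fun g => (4 / n : ℚ) • g.map (Int.cast : ℤ → ℚ)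
  refine ⟨G.map cst, row (4 / n) τ₀ :: T.map (row (1 / n)), fun x q hxo hq hx => ?_⟩
  have hq0 : (q : ℚ) ≠ 0 := by exact_mod_cast hq
  set s : J → ℚ := fun j => (x j : ℚ) / q with hs
  have hss : s ⬝ᵥ s = 1 := by
    have h1 : s ⬝ᵥ s = ((x ⬝ᵥ x : ℤ) : ℚ) / q ^ 2 := by
      simp only [dotProduct, hs, Int.cast_sum, Int.cast_mul, Finset.sum_div]
      exact Finset.sum_congr rfl fun j _ => by ring
    rw [h1, hx]
    push_cast
    exact div_self (pow_ne_zero 2 hq0)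
  have hvec : ∀ r : J → ℚ, (Matrix.vecMulVec s r)ᵀ * Matrix.vecMulVec s r =
      Matrix.vecMulVec r r := by
    intro r
    rw [Matrix.transpose_vecMulVec, Matrix.vecMulVec_mul_vecMulVec, hss, one_smul]
  constructor
  · ext k l
    have h1 := congrArg (Int.cast : ℤ → ℚ) (hsum k l)
    have happ : ∀ (l' : List (Matrix J J ℚ)) , l'.sum k l = (l'.map fun K => K k l).sum := by
      intro l'
      induction l' with
      | nil => simp
      | cons a l' ih => simp [ih]
    rw [happ, List.map_map, List.map_append, List.sum_append, List.map_map, List.map_map,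
      List.map_cons, List.sum_cons, List.map_map]
    have h2 : (G.map (((fun K : Matrix J J ℚ => K k l) ∘ fun K => Kᵀ * K) ∘ cst)).sum =
        16 / n ^ 2 * ((G.map fun g => (gᵀ * g) k l).sum : ℤ) := by
      rw [Int.cast_list_sum, ← List.sum_map_mul_left, List.map_map]
      congr 1
      refine List.map_congr_left fun g _ => ?_
      simp only [Function.comp, cst, Matrix.mul_apply, Matrix.transpose_apply, Matrix.smul_apply,
        Matrix.map_apply, smul_eq_mul, Int.cast_sum, Int.cast_mul, Finset.mul_sum]
      exact Finset.sum_congr rfl fun j _ => by ring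
    have h3 : (T.map (((((fun K : Matrix J J ℚ => K k l) ∘ fun K => Kᵀ * K) ∘
        Matrix.vecMulVec s)) ∘ row (1 / n))).sum =
        1 / n ^ 2 * ((T.map fun τ => τ k * τ l).sum : ℤ) := by
      rw [Int.cast_list_sum, ← List.sum_map_mul_left, List.map_map]
      congr 1
      refine List.map_congr_left fun τ _ => ?_
      simp only [Function.comp, hvec, row, Matrix.vecMulVec_apply, Int.cast_mul]
      ring
    rw [h2, h3]
    simp only [Function.comp, hvec, row, Matrix.vecMulVec_apply]
    have h4 : (1 : Matrix J J ℚ) k l = ((if k = l then (n : ℤ) ^ 2 else 0 : ℤ) : ℚ) / n ^ 2 := by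
      rw [Matrix.one_apply]
      split_ifs
      · push_cast
        rw [div_self (pow_ne_zero 2 hn0)]
      · simp
    rw [h4, ← hsum k l]
    push_cast
    ring
  have hrow : ∀ w : List (Matrix J J ℤ), (∀ g ∈ w, g ∈ G) → (w.prod *ᵥ x) o = 1 := by
    intro w
    induction w with
    | nil => simp [hxo]
    | cons g w ih =>
      intro hw
      rw [List.prod_cons, ← Matrix.mulVec_mulVec, Matrix.mulVec, dotProduct]
      simp only [hG g (hw g (by simp)), ite_mul, one_mul, zero_mul, Finset.sum_ite_eq',
        Finset.mem_univ, if_true]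
      exact ih fun g' hg' => hw g' (by simp [hg'])
  constructor
  · rintro ⟨w, hw, hw0⟩
    by_contra! hne
    -- The invariant: nonzero multiples of points of the orbit of x. A rank-one operator resets the
    -- orbit to x itself, with the empty word.
    let Good : (J → ℚ) → Prop := fun y => ∃ c : ℚ, c ≠ 0 ∧ ∃ w : List (Matrix J J ℤ),
      (∀ g ∈ w, g ∈ G) ∧ y = fun j => c * ((w.prod *ᵥ x) j : ℤ)
    have hrank : ∀ (a : ℚ) (τ : J → ℤ), a ≠ 0 →
        (∀ w : List (Matrix J J ℤ), (∀ g ∈ w, g ∈ G) → τ ⬝ᵥ (w.prod *ᵥ x) ≠ 0) →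
        ∀ y, Good y → Good (Matrix.vecMulVec s (row a τ) *ᵥ y) := by
      rintro a τ ha hτ y ⟨c, hc, w, hw, rfl⟩
      have hz : ((τ ⬝ᵥ (w.prod *ᵥ x) : ℤ) : ℚ) ≠ 0 := by exact_mod_cast hτ w hw
      refine ⟨a * c * (τ ⬝ᵥ (w.prod *ᵥ x) : ℤ) / q, by positivity, [], by simp, ?_⟩
      rw [Matrix.vecMulVec_mulVec]
      ext j
      have : row a τ ⬝ᵥ (fun j => c * ((w.prod *ᵥ x) j : ℤ)) =
          a * c * (τ ⬝ᵥ (w.prod *ᵥ x) : ℤ) := by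
        simp only [dotProduct, row, Int.cast_sum, Int.cast_mul, Finset.mul_sum]
        exact Finset.sum_congr rfl fun j _ => by ring
      rw [this]
      simp [hs]
      ring
    have hpres : ∀ K ∈ G.map cst ++ (row (4 / n) τ₀ :: T.map (row (1 / n))).map
        (Matrix.vecMulVec s), ∀ y, Good y → Good (K *ᵥ y) := by
      intro K hK
      rcases List.mem_append.1 hK with hK | hK
      · obtain ⟨g, hg, rfl⟩ := List.mem_map.1 hK
        rintro y ⟨c, hc, w, hw, rfl⟩
        refine ⟨4 / n * c, by positivity, g :: w, ?_, ?_⟩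
        · intro g' hg'
          rcases List.mem_cons.1 hg' with rfl | h
          exacts [hg, hw _ h]
        · ext j
          rw [List.prod_cons, ← Matrix.mulVec_mulVec]
          simp only [cst, Matrix.mulVec, dotProduct, Matrix.smul_apply, Matrix.map_apply,
            smul_eq_mul, Int.cast_sum, Int.cast_mul, Finset.mul_sum]
          exact Finset.sum_congr rfl fun i _ => Finset.sum_congr rfl fun k _ => by ring
      · obtain ⟨r, hr, rfl⟩ := List.mem_map.1 hK
        rcases List.mem_cons.1 hr with rfl | hr
        · exact hrank _ _ (by positivity) hne
        · obtain ⟨τ, hτ, rfl⟩ := List.mem_map.1 hr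
          refine hrank _ _ (by positivity) fun w hw => ?_
          -- The entry of g x at `o` is 1 and meets the odd entry of τ; all other terms are even.
          suffices h : Odd (τ ⬝ᵥ (w.prod *ᵥ x)) by
            rintro h0
            rw [h0] at h
            exact Int.not_odd_zero h
          rw [dotProduct, ← Finset.add_sum_erase _ _ (Finset.mem_univ o), hrow w hw, mul_one]
          refine (hT τ hτ).1.add_even (Finset.even_sum _ fun j hj => ?_)
          exact ((hT τ hτ).2 j (Finset.ne_of_mem_erase hj)).mul_right _
    have hgood : ∀ w : List (Matrix J J ℚ), (∀ K ∈ w, K ∈ G.map cst ++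
        (row (4 / n) τ₀ :: T.map (row (1 / n))).map (Matrix.vecMulVec s)) →
        Good (w.prod *ᵥ fun j => (x j : ℚ)) := by
      intro w
      induction w with
      | nil => exact fun _ => ⟨1, one_ne_zero, [], by simp, by simp⟩
      | cons K w ih =>
        intro hw
        rw [List.prod_cons, ← Matrix.mulVec_mulVec]
        exact hpres K (hw K (by simp)) _ (ih fun K' hK' => hw K' (by simp [hK']))
    obtain ⟨c, hc, w', hw', h⟩ := hgood w hw
    have h' := congrFun h o
    rw [hw0, Matrix.zero_mulVec, hrow w' hw'] at h'
    simp [hc.symm] at h'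
  · rintro ⟨w, hw, h0⟩
    have hP : ∀ w : List (Matrix J J ℤ), ∃ c : ℚ, (w.map cst).prod =
        c • w.prod.map (Int.cast : ℤ → ℚ) := by
      intro w
      induction w with
      | nil => exact ⟨1, by simp⟩
      | cons g w ih =>
        obtain ⟨c, ih⟩ := ih
        refine ⟨4 / n * c, ?_⟩
        rw [List.map_cons, List.prod_cons, ih, List.prod_cons, Matrix.map_mul_intCast]
        simp only [cst, Matrix.smul_mul, Matrix.mul_smul, smul_smul, mul_comm c]
    obtain ⟨c, hc⟩ := hP w
    -- The left factor evaluates τ₀ and the right factor prepares s, so the product is a multiple of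
    -- τ₀ · (g x) = 0.
    refine ⟨Matrix.vecMulVec s (row (4 / n) τ₀) ::
      (w.map cst ++ [Matrix.vecMulVec s (row (4 / n) τ₀)]), ?_, ?_⟩
    · intro K hK
      simp only [List.mem_cons, List.mem_append, List.mem_map, List.not_mem_nil, or_false] at hK
      rcases hK with rfl | ⟨g, hg, rfl⟩ | rfl
      · simp
      · exact List.mem_append_left _ (List.mem_map_of_mem (hw g hg))
      · simp
    · rw [List.prod_cons, List.prod_append, List.prod_singleton, hc, Matrix.smul_mul,
        Matrix.mul_vecMulVec, Matrix.mul_smul, Matrix.vecMulVec_mul_vecMulVec]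
      have : row (4 / n) τ₀ ⬝ᵥ (w.prod.map (Int.cast : ℤ → ℚ) *ᵥ s) =
          4 / n / q * (τ₀ ⬝ᵥ (w.prod *ᵥ x) : ℤ) := by
        simp only [dotProduct, Matrix.mulVec, row, hs, Int.cast_sum, Int.cast_mul, Finset.mul_sum,
          Matrix.map_apply]
        exact Finset.sum_congr rfl fun i _ => Finset.sum_congr rfl fun j _ => by ring
      rw [this, h0]
      simp

/-! ### Partial recursive functions on nondeterministic register programs -/

/-- Instructions for registers with natural numbers: `copy r s` sets `r` to the value of `s`, and
`test r s` can be executed only if `r` and `s` have the same value. -/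
inductive RegOp where
  | zero (r : ℕ)
  | succ (r : ℕ)
  | copy (r s : ℕ)
  | test (r s : ℕ)

def RegOp.Rel : RegOp → (ℕ → ℕ) → (ℕ → ℕ) → Prop
  | zero r, σ, σ' => σ' = Function.update σ r 0
  | succ r, σ, σ' => σ' = Function.update σ r (σ r + 1)
  | copy r s, σ, σ' => σ' = Function.update σ r (σ s)
  | test r s, σ, σ' => σ r = σ s ∧ σ' = σ

/-- Nondeterministic register programs. -/
inductive RegProg where
  | op (o : RegOp)
  | seq (p q : RegProg)
  | star (p : RegProg)

def RegProg.Rel : RegProg → (ℕ → ℕ) → (ℕ → ℕ) → Prop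
  | op o => o.Rel
  | seq p q => fun σ σ' => ∃ ρ, p.Rel σ ρ ∧ q.Rel ρ σ'
  | star p => Relation.ReflTransGen p.Rel

/-- The program `p` computes `f` from the registers `a` to the register `b`, and changes no register
below `b`. -/
def RegProg.Computes {n : ℕ} (p : RegProg) (f : List.Vector ℕ n →. ℕ) (a : Fin n → ℕ)
    (b : ℕ) : Prop :=
  (∀ σ σ', p.Rel σ σ' → (∀ i < b, σ' i = σ i) ∧ σ' b ∈ f (List.Vector.ofFn fun i => σ (a i))) ∧
    ∀ σ, (f (List.Vector.ofFn fun i => σ (a i))).Dom → ∃ σ', p.Rel σ σ'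

/-- The input registers and the output register `b` are arbitrary, and everything from `b` upwards
may serve as scratch space; this makes programs composable without renaming. -/
def RegComputable {n : ℕ} (f : List.Vector ℕ n →. ℕ) : Prop :=
  ∀ (a : Fin n → ℕ) (b : ℕ), (∀ i, a i < b) → ∃ p : RegProg, p.Computes f a b

theorem RegComputable.mOfFn {m : ℕ} : ∀ {n : ℕ} (g : Fin n → List.Vector ℕ m →. ℕ),
    (∀ i, RegComputable (g i)) → ∀ (a : Fin m → ℕ) (b : ℕ), (∀ i, a i < b) →
    ∃ p : RegProg, (∀ σ σ', p.Rel σ σ' → (∀ i < b, σ' i = σ i) ∧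
      ∀ i : Fin n, σ' (b + i) ∈ g i (List.Vector.ofFn fun i => σ (a i))) ∧
      ∀ σ, (∀ i, (g i (List.Vector.ofFn fun i => σ (a i))).Dom) → ∃ σ', p.Rel σ σ' := by
  intro n
  induction n with
  | zero =>
    intro g _ a b _
    -- Testing a register against itself always succeeds and changes nothing.
    exact ⟨.op (.test 0 0), fun σ σ' h => ⟨fun i _ => by rw [h.2], fun i => i.elim0⟩,
      fun σ _ => ⟨σ, rfl, rfl⟩⟩
  | succ n ih =>
    intro g hg a b hab
    obtain ⟨p, hp1, hp2⟩ := ih (fun i => g i.castSucc) (fun i => hg _) a b hab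
    obtain ⟨q, hq1, hq2⟩ := hg (Fin.last n) a (b + n) fun i => (hab i).trans_le (Nat.le_add_right ..)
    have hpa : ∀ σ ρ, p.Rel σ ρ → (List.Vector.ofFn fun i => ρ (a i)) =
        List.Vector.ofFn fun i => σ (a i) := by
      intro σ ρ h
      congr 1
      funext i
      exact (hp1 σ ρ h).1 _ (hab i)
    refine ⟨.seq p q, ?_, ?_⟩
    · rintro σ σ' ⟨ρ, h1, h2⟩
      obtain ⟨h3, h4⟩ := hp1 _ _ h1
      obtain ⟨h5, h6⟩ := hq1 _ _ h2
      refine ⟨fun i hi => (h5 i (by omega)).trans (h3 i hi), fun i => ?_⟩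
      induction i using Fin.lastCases with
      | last => rwa [hpa _ _ h1] at h6
      | cast i =>
        have := h4 i
        rwa [← h5 (b + i) (by omega)] at this
    · intro σ h
      obtain ⟨ρ, h1⟩ := hp2 σ fun i => h _
      obtain ⟨σ', h2⟩ := hq2 ρ (by rw [hpa _ _ h1]; exact h _)
      exact ⟨σ', ρ, h1, h2⟩

theorem mem_mOfFn_iff {n : ℕ} (g : Fin n → Part ℕ) (v : List.Vector ℕ n) :
    v ∈ List.Vector.mOfFn g ↔ ∀ i, v.get i ∈ g i := by
  induction n with
  | zero =>
    have : v = List.Vector.nil := Subsingleton.elim _ _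
    subst this
    simp [List.Vector.mOfFn]
  | succ n ih =>
    obtain ⟨x, v, rfl⟩ := v.exists_eq_cons
    simp only [List.Vector.mOfFn, Part.bind_eq_bind, Part.mem_bind_iff, ih, Part.pure_eq_some,
      Part.mem_some_iff, Fin.forall_fin_succ, List.Vector.get_zero, List.Vector.head_cons,
      List.Vector.get_cons_succ]
    constructor
    · rintro ⟨y, hy, u, hu, h⟩
      obtain ⟨h1, h2⟩ := (List.Vector.eq_cons_iff ..).1 h
      rw [List.Vector.head_cons] at h1
      rw [List.Vector.tail_cons] at h2
      exact ⟨h1 ▸ hy, h2 ▸ hu⟩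
    · rintro ⟨hx, hv⟩
      exact ⟨x, hx, v, hv, rfl⟩

theorem RegComputable.comp {m n : ℕ} {f : List.Vector ℕ n →. ℕ}
    (g : Fin n → List.Vector ℕ m →. ℕ) (hf : RegComputable f) (hg : ∀ i, RegComputable (g i)) :
    RegComputable fun v => (List.Vector.mOfFn fun i => g i v) >>= f := by
  intro a b hab
  obtain ⟨p, hp1, hp2⟩ := RegComputable.mOfFn g hg a (b + 1) fun i => (hab i).trans (Nat.lt_succ_self b)
  obtain ⟨q, hq1, hq2⟩ := hf (fun i => b + 1 + i) (b + 1 + n) fun i => by omega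
  have hv : ∀ σ ρ, p.Rel σ ρ → (List.Vector.ofFn fun i : Fin n => ρ (b + 1 + i)) ∈
      List.Vector.mOfFn fun i => g i (List.Vector.ofFn fun i => σ (a i)) := by
    intro σ ρ h
    rw [mem_mOfFn_iff]
    intro i
    rw [List.Vector.get_ofFn]
    exact (hp1 σ ρ h).2 i
  refine ⟨.seq p (.seq q (.op (.copy b (b + 1 + n)))), ?_, ?_⟩
  · rintro σ σ' ⟨ρ, h1, ρ', h2, rfl⟩
    obtain ⟨h3, h4⟩ := hp1 _ _ h1
    obtain ⟨h5, h6⟩ := hq1 _ _ h2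
    refine ⟨fun i hi => ?_, ?_⟩
    · rw [Function.update_of_ne hi.ne, h5 i (by omega), h3 i (by omega)]
    · rw [Function.update_self]
      exact Part.mem_bind (hv _ _ h1) h6
  · intro σ h
    obtain ⟨y, hy⟩ := Part.dom_iff_mem.1 h
    obtain ⟨v, h1, h2⟩ := Part.mem_bind_iff.1 hy
    obtain ⟨ρ, h3⟩ := hp2 σ fun i => Part.dom_iff_mem.2 ⟨_, (mem_mOfFn_iff _ _).1 h1 i⟩
    obtain ⟨ρ', h4⟩ := hq2 ρ (by
      rw [← Part.mem_unique h1 (hv _ _ h3)]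
      exact Part.dom_iff_mem.2 ⟨y, h2⟩)
    exact ⟨_, ρ, h3, ρ', h4, rfl⟩

/-- The number of iterations is guessed: the loop keeps a counter in `b + 1`, and the final test
against the recursion argument discards all wrong guesses. -/
theorem RegComputable.prec {n : ℕ} {f : List.Vector ℕ n → ℕ} {g : List.Vector ℕ (n + 2) → ℕ}
    (hf : RegComputable (f : List.Vector ℕ n →. ℕ))
    (hg : RegComputable (g : List.Vector ℕ (n + 2) →. ℕ)) :
    RegComputable ((fun v => v.head.rec (f v.tail) fun y IH => g (y ::ᵥ IH ::ᵥ v.tail) :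
      List.Vector ℕ (n + 1) → ℕ) : List.Vector ℕ (n + 1) →. ℕ) := by
  intro a b hab
  obtain ⟨p, hp1, hp2⟩ := hf (fun i => a i.succ) b fun i => hab _
  obtain ⟨q, hq1, hq2⟩ := hg (Fin.cons (b + 1) (Fin.cons b fun i => a i.succ)) (b + 2) (by
    intro i
    refine Fin.cases (by simp) (fun i => Fin.cases (by simp) (fun i => ?_) i) i
    have := hab i.succ
    simp only [Fin.cons_succ]
    omega)
  let body : RegProg := .seq q (.seq (.op (.copy b (b + 2))) (.op (.succ (b + 1))))
  have hbody : ∀ σ σ', body.Rel σ σ' → (∀ i < b, σ' i = σ i) ∧ σ' (b + 1) = σ (b + 1) + 1 ∧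
      σ' b = g (σ (b + 1) ::ᵥ σ b ::ᵥ List.Vector.ofFn fun i => σ (a i.succ)) := by
    rintro σ σ' ⟨ρ, h1, ρ', rfl, rfl⟩
    obtain ⟨h2, h3⟩ := hq1 _ _ h1
    refine ⟨fun i hi => ?_, ?_, ?_⟩
    · rw [Function.update_of_ne (by omega), Function.update_of_ne (by omega), h2 i (by omega)]
    · rw [Function.update_self, Function.update_of_ne (by omega), h2 _ (by omega)]
    · rw [Function.update_of_ne (by omega), Function.update_self]
      exact Part.mem_some_iff.1 h3
  have hloop : ∀ σ σ', Relation.ReflTransGen body.Rel σ σ' → σ (b + 1) = 0 →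
      σ b = f (List.Vector.ofFn fun i => σ (a i.succ)) → (∀ i < b, σ' i = σ i) ∧
      σ' b = Nat.rec (f (List.Vector.ofFn fun i => σ (a i.succ)))
        (fun y IH => g (y ::ᵥ IH ::ᵥ List.Vector.ofFn fun i => σ (a i.succ))) (σ' (b + 1)) := by
    intro σ σ' h h0 hb
    induction h with
    | refl => exact ⟨fun _ _ => rfl, by rw [h0]; exact hb⟩
    | tail _ h2 ih =>
      obtain ⟨h3, h4, h5⟩ := hbody _ _ h2
      refine ⟨fun i hi => (h3 i hi).trans (ih.1 i hi), ?_⟩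
      rw [h4, h5, ih.2]
      congr 3
      exact congrArg _ (funext fun i => ih.1 _ (hab _))
  have hrun : ∀ k σ, σ (b + 1) = 0 →
      ∃ σ', Relation.ReflTransGen body.Rel σ σ' ∧ σ' (b + 1) = k := by
    intro k σ h0
    induction k with
    | zero => exact ⟨σ, .refl, h0⟩
    | succ k ih =>
      obtain ⟨ρ, h1, h2⟩ := ih
      obtain ⟨ρ', h3⟩ := hq2 ρ trivial
      have h4 : body.Rel ρ _ := ⟨ρ', h3, _, rfl, rfl⟩
      exact ⟨_, h1.tail h4, by rw [(hbody _ _ h4).2.1, h2]⟩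
  have hinit : ∀ σ ρ, p.Rel σ ρ → (∀ i < b, Function.update ρ (b + 1) 0 i = σ i) ∧
      Function.update ρ (b + 1) 0 (b + 1) = 0 ∧ Function.update ρ (b + 1) 0 b =
        f (List.Vector.ofFn fun i => Function.update ρ (b + 1) 0 (a i.succ)) := by
    intro σ ρ h
    obtain ⟨h1, h2⟩ := hp1 _ _ h
    have h3 : ∀ i < b, Function.update ρ (b + 1) 0 i = σ i := fun i hi => by
      rw [Function.update_of_ne (by omega), h1 i hi]
    refine ⟨h3, Function.update_self .., ?_⟩
    rw [Function.update_of_ne (by omega)]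
    refine (Part.mem_some_iff.1 h2).trans (congrArg f (congrArg _ (funext fun i => ?_)))
    exact (h3 _ (hab _)).symm
  refine ⟨.seq p (.seq (.op (.zero (b + 1))) (.seq (.star body) (.op (.test (b + 1) (a 0))))),
    ?_, ?_⟩
  · rintro σ σ' ⟨ρ, h1, _, rfl, ρ', h2, h3, rfl⟩
    obtain ⟨h4, h5, h6⟩ := hinit _ _ h1
    obtain ⟨h7, h8⟩ := hloop _ _ h2 h5 h6
    refine ⟨fun i hi => (h7 i hi).trans (h4 i hi), ?_⟩
    have h9 : (fun i => Function.update ρ (b + 1) 0 (a (Fin.succ i))) = fun i : Fin n => σ (a i.succ) :=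
      funext fun i => h4 _ (hab _)
    rw [h9, h3, h7 _ (hab _), h4 _ (hab _)] at h8
    rw [PFun.coe_val, Part.mem_some_iff, h8, List.Vector.head_ofFn, List.Vector.tail_ofFn]
  · intro σ _
    obtain ⟨ρ, h1⟩ := hp2 σ trivial
    obtain ⟨h4, h5, h6⟩ := hinit _ _ h1
    obtain ⟨σ', h7, h8⟩ := hrun (σ (a 0)) _ h5
    refine ⟨σ', ρ, h1, _, rfl, σ', h7, ?_, rfl⟩
    rw [h8, (hloop _ _ h7 h5 h6).1 _ (hab _), h4 _ (hab _)]

theorem RegComputable.of_primrec {n : ℕ} {f : List.Vector ℕ n → ℕ} (hf : Nat.Primrec' f) :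
    RegComputable (f : List.Vector ℕ n →. ℕ) := by
  induction hf with
  | zero =>
    intro a b _
    refine ⟨.op (.zero b), ?_, fun σ _ => ⟨_, rfl⟩⟩
    rintro σ _ rfl
    exact ⟨fun i hi => Function.update_of_ne hi.ne .., by simp⟩
  | succ =>
    intro a b hab
    refine ⟨.seq (.op (.copy b (a 0))) (.op (.succ b)), ?_, fun σ _ => ⟨_, _, rfl, rfl⟩⟩
    rintro σ _ ⟨_, rfl, rfl⟩
    refine ⟨fun i hi => ?_, ?_⟩
    · rw [Function.update_of_ne hi.ne, Function.update_of_ne hi.ne]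
    · simp
  | get i =>
    intro a b hab
    refine ⟨.op (.copy b (a i)), ?_, fun σ _ => ⟨_, rfl⟩⟩
    rintro σ _ rfl
    exact ⟨fun i hi => Function.update_of_ne hi.ne .., by simp⟩
  | comp g _ _ hf hg =>
    have h := RegComputable.comp _ hf hg
    have e : ∀ v, (List.Vector.mOfFn fun i => (g i : List.Vector ℕ _ →. ℕ) v) =
        Part.some (List.Vector.ofFn fun i => g i v) := fun v => Vector.mOfFn_part_some _
    simp only [e] at h
    exact (congrArg RegComputable (funext fun v => Part.bind_some _ _)).mp h
  | prec _ _ hf hg => exact RegComputable.prec hf hg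

/-- No instruction tests that a value is nonzero. Instead `pos` guesses a positive number, and a
test for equality with the value certifies that the candidate must be passed over. -/
theorem RegComputable.rfind {n : ℕ} {f : List.Vector ℕ (n + 1) → ℕ}
    (hf : RegComputable (f : List.Vector ℕ (n + 1) →. ℕ)) :
    RegComputable fun v => Nat.rfind fun k => Part.some (decide (f (k ::ᵥ v) = 0)) := by
  intro a b hab
  obtain ⟨p, hp1, hp2⟩ := hf (Fin.cons b a) (b + 1) (by
    intro i
    refine Fin.cases (by simp) (fun i => ?_) i
    have := hab i
    simp only [Fin.cons_succ]
    omega)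
  replace hp1 : ∀ σ σ', p.Rel σ σ' → (∀ i ≤ b, σ' i = σ i) ∧
      σ' (b + 1) = f (σ b ::ᵥ List.Vector.ofFn fun i => σ (a i)) := fun σ σ' h =>
    ⟨fun i hi => (hp1 σ σ' h).1 i (by omega), Part.mem_some_iff.1 (hp1 σ σ' h).2⟩
  let pos : RegProg := .seq (.op (.zero (b + 2))) (.seq (.op (.succ (b + 2)))
    (.star (.op (.succ (b + 2)))))
  have hpos : ∀ σ σ', pos.Rel σ σ' → (∀ i ≤ b + 1, σ' i = σ i) ∧ 0 < σ' (b + 2) := by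
    rintro σ σ' ⟨_, rfl, _, rfl, h⟩
    induction h with
    | refl =>
      refine ⟨fun i hi => ?_, by simp⟩
      rw [Function.update_of_ne (by omega), Function.update_of_ne (by omega)]
    | tail _ h ih =>
      cases h
      refine ⟨fun i hi => ?_, by simp⟩
      rw [Function.update_of_ne (by omega), ih.1 i hi]
  have hpos' : ∀ σ k, ∃ σ', pos.Rel σ σ' ∧ σ' (b + 2) = k + 1 := by
    intro σ k
    suffices h : ∃ σ', Relation.ReflTransGen (RegOp.succ (b + 2)).Rel
        (Function.update (Function.update σ (b + 2) 0) (b + 2)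
          (Function.update σ (b + 2) 0 (b + 2) + 1)) σ' ∧ σ' (b + 2) = k + 1 by
      obtain ⟨σ', h1, h2⟩ := h
      exact ⟨σ', ⟨_, rfl, _, rfl, h1⟩, h2⟩
    induction k with
    | zero => exact ⟨_, .refl, by simp⟩
    | succ k ih =>
      obtain ⟨ρ, h1, h2⟩ := ih
      exact ⟨_, h1.tail rfl, by simp [h2]⟩
  let body : RegProg := .seq p (.seq pos (.seq (.op (.test (b + 2) (b + 1))) (.op (.succ b))))
  have hbody : ∀ σ σ', body.Rel σ σ' → (∀ i < b, σ' i = σ i) ∧ σ' b = σ b + 1 ∧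
      f (σ b ::ᵥ List.Vector.ofFn fun i => σ (a i)) ≠ 0 := by
    rintro σ σ' ⟨ρ, h1, ρ', h2, _, ⟨h3, rfl⟩, rfl⟩
    obtain ⟨h4, h5⟩ := hp1 _ _ h1
    obtain ⟨h6, h7⟩ := hpos _ _ h2
    refine ⟨fun i hi => ?_, ?_, ?_⟩
    · rw [Function.update_of_ne hi.ne, h6 i (by omega), h4 i hi.le]
    · rw [Function.update_self, h6 b (by omega), h4 b le_rfl]
    · rw [← h5, ← h6 _ le_rfl, ← h3]
      exact h7.ne'
  have hloop : ∀ σ σ', Relation.ReflTransGen body.Rel σ σ' → σ b = 0 → (∀ i < b, σ' i = σ i) ∧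
      ∀ k < σ' b, f (k ::ᵥ List.Vector.ofFn fun i => σ (a i)) ≠ 0 := by
    intro σ σ' h h0
    induction h with
    | refl => exact ⟨fun _ _ => rfl, by simp [h0]⟩
    | tail _ h2 ih =>
      obtain ⟨h3, h4, h5⟩ := hbody _ _ h2
      refine ⟨fun i hi => (h3 i hi).trans (ih.1 i hi), fun k hk => ?_⟩
      rw [h4] at hk
      rcases Nat.lt_succ_iff_lt_or_eq.1 hk with hk | rfl
      · exact ih.2 k hk
      · rwa [show (fun i => _) = _ from funext fun i => ih.1 _ (hab i)] at h5
  have hrun : ∀ k σ, σ b = 0 → (∀ j < k, f (j ::ᵥ List.Vector.ofFn fun i => σ (a i)) ≠ 0) →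
      ∃ σ', Relation.ReflTransGen body.Rel σ σ' ∧ σ' b = k := by
    intro k σ h0 hk
    induction k with
    | zero => exact ⟨σ, .refl, h0⟩
    | succ k ih =>
      obtain ⟨ρ, h1, h2⟩ := ih fun j hj => hk j (by omega)
      obtain ⟨ρ', h3⟩ := hp2 ρ trivial
      have h4 := (hp1 _ _ h3).2
      rw [h2, show (fun i => ρ (a i)) = fun i => σ (a i) from
        funext fun i => (hloop _ _ h1 h0).1 _ (hab i)] at h4
      obtain ⟨ρ'', h5, h6⟩ := hpos' ρ' (ρ' (b + 1) - 1)
      have h7 := hk k (by omega)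
      rw [← h4] at h7
      have h8 : body.Rel ρ _ := ⟨ρ', h3, ρ'', h5, _, ⟨by
        rw [h6, (hpos _ _ h5).1 _ le_rfl]; omega, rfl⟩, rfl⟩
      exact ⟨_, h1.tail h8, by rw [(hbody _ _ h8).2.1, h2]⟩
  refine ⟨.seq (.op (.zero b)) (.seq (.star body) (.seq p (.seq (.op (.zero (b + 2)))
    (.op (.test (b + 2) (b + 1)))))), ?_, ?_⟩
  · rintro σ σ' ⟨_, rfl, ρ, h1, ρ', h2, _, rfl, h3, rfl⟩
    have h0 : ∀ i < b, Function.update σ b 0 i = σ i := fun i hi => Function.update_of_ne hi.ne ..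
    have h0' : (fun i => Function.update σ b 0 (a i)) = fun i => σ (a i) :=
      funext fun i => h0 _ (hab i)
    obtain ⟨h4, h5⟩ := hloop _ _ h1 (Function.update_self ..)
    obtain ⟨h6, h7⟩ := hp1 _ _ h2
    rw [h0'] at h5
    rw [Function.update_self, Function.update_of_ne (by omega), h7,
      show (fun i => ρ (a i)) = fun i => σ (a i) from
        funext fun i => (h4 _ (hab i)).trans (h0 _ (hab i))] at h3
    refine ⟨fun i hi => ?_, ?_⟩
    · rw [Function.update_of_ne (by omega), h6 i hi.le, h4 i hi, h0 i hi]
    · rw [Function.update_of_ne (by omega), h6 b le_rfl]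
      refine Nat.mem_rfind.2 ⟨by simp [h3.symm], fun {k} hk => by simp [h5 k hk]⟩
  · intro σ h
    obtain ⟨k, hk⟩ := Part.dom_iff_mem.1 h
    replace hk := Nat.mem_rfind.1 hk
    have h0' : (fun i => Function.update σ b 0 (a i)) = fun i => σ (a i) :=
      funext fun i => Function.update_of_ne (hab i).ne ..
    obtain ⟨ρ, h1, h2⟩ := hrun k (Function.update σ b 0) (Function.update_self ..) (by
      intro j hj
      rw [h0']
      simpa using hk.2 hj)
    obtain ⟨ρ', h3⟩ := hp2 ρ trivial
    refine ⟨_, _, rfl, ρ, h1, ρ', h3, _, rfl, ?_, rfl⟩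
    rw [Function.update_self, Function.update_of_ne (by omega), (hp1 _ _ h3).2, h2,
      show (fun i => ρ (a i)) = fun i => σ (a i) from funext fun i =>
        ((hloop _ _ h1 (Function.update_self ..)).1 _ (hab i)).trans (congrFun h0' i)]
    have h4 := Part.mem_some_iff.1 hk.1
    exact (of_decide_eq_true h4.symm).symm

theorem RegComputable.of_partrec {n : ℕ} {f : List.Vector ℕ n →. ℕ} (hf : Nat.Partrec' f) :
    RegComputable f := by
  induction hf with
  | prim hf => exact RegComputable.of_primrec hf
  | comp g _ _ hf hg => exact RegComputable.comp g hf hg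
  | rfind _ hf => exact RegComputable.rfind hf

theorem exists_regProg_of_partrec {F : ℕ →. ℕ} (hF : Partrec F) :
    ∃ p : RegProg, ∀ m, (∃ σ', p.Rel (fun r => if r = 0 then m else 0) σ') ↔ (F m).Dom := by
  obtain ⟨p, h1, h2⟩ := RegComputable.of_partrec (Nat.Partrec'.part_iff₁.2 hF) (fun _ => 0) 1
    (fun _ => Nat.one_pos)
  refine ⟨p, fun m => ⟨?_, fun h => h2 _ (by simpa using h)⟩⟩
  rintro ⟨σ', h⟩
  have := (h1 _ _ h).2
  exact Part.dom_iff_mem.2 ⟨_, by simpa using this⟩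

/-! ### From programs to finite automata -/

/-- The steps of a finite automaton whose transitions execute register instructions. -/
def AutStep {S : Type} (E : List (S × RegOp × S)) (c c' : S × (ℕ → ℕ)) : Prop :=
  ∃ o : RegOp, (c.1, o, c'.1) ∈ E ∧ o.Rel c.2 c'.2

-- Thompson's construction, with `test 0 0` as the silent transition. For the star a fresh state,
-- both initial and final, is visited between iterations.
open Relation in
theorem RegProg.exists_automaton (p : RegProg) : ∃ (S : Type) (_ : Fintype S)
    (E : List (S × RegOp × S)) (s t : S), ∀ σ σ', p.Rel σ σ' ↔
      ReflTransGen (AutStep E) (s, σ) (t, σ') := by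
  induction p with
  | op o =>
    refine ⟨Bool, inferInstance, [(false, o, true)], false, true, fun σ σ' => ⟨?_, ?_⟩⟩
    · exact fun h => .single ⟨o, by simp, h⟩
    · intro h
      have key : ∀ c, ReflTransGen (AutStep [(false, o, true)]) (false, σ) c →
          (c.1 = false → c.2 = σ) ∧ (c.1 = true → o.Rel σ c.2) := by
        intro c h
        induction h with
        | refl => simp
        | tail _ h ih =>
          obtain ⟨o', h1, h2⟩ := h
          simp only [List.mem_singleton, Prod.mk.injEq] at h1
          obtain ⟨h3, rfl, h4⟩ := h1
          rw [ih.1 h3] at h2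
          simp [h4, h2]
      exact (key _ h).2 rfl
  | seq p q hp hq =>
    obtain ⟨S, _, E, s, t, hp⟩ := hp
    obtain ⟨S', _, E', s', t', hq⟩ := hq
    let D : List ((S ⊕ S') × RegOp × (S ⊕ S')) := (Sum.inl t, RegOp.test 0 0, Sum.inr s') ::
      (E.map (fun e => (Sum.inl e.1, e.2.1, Sum.inl e.2.2)) ++
        E'.map fun e => (Sum.inr e.1, e.2.1, Sum.inr e.2.2))
    refine ⟨S ⊕ S', inferInstance, D, Sum.inl s, Sum.inr t', fun σ σ' => ⟨?_, ?_⟩⟩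
    · rintro ⟨ρ, h1, h2⟩
      rw [hp] at h1
      rw [hq] at h2
      have h3 : ReflTransGen (AutStep D) (Sum.inl s, σ) (Sum.inl t, ρ) :=
        h1.lift (fun c => (Sum.inl c.1, c.2)) fun a b ⟨o, ho, hr⟩ => ⟨o, by
          simpa [D] using ho, hr⟩
      have h4 : ReflTransGen (AutStep D) (Sum.inr s', ρ) (Sum.inr t', σ') :=
        h2.lift (fun c => (Sum.inr c.1, c.2)) fun a b ⟨o, ho, hr⟩ => ⟨o, by
          simpa [D] using ho, hr⟩
      have h5 : AutStep D (Sum.inl t, ρ) (Sum.inr s', ρ) := ⟨RegOp.test 0 0, by simp [D], rfl, rfl⟩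
      exact (h3.tail h5).trans h4
    · intro h
      have key : ∀ c, ReflTransGen (AutStep D) (Sum.inl s, σ) c →
          (∀ x, c.1 = Sum.inl x → ReflTransGen (AutStep E) (s, σ) (x, c.2)) ∧
          (∀ x, c.1 = Sum.inr x →
            ∃ ρ, p.Rel σ ρ ∧ ReflTransGen (AutStep E') (s', ρ) (x, c.2)) := by
        intro c h
        induction h with
        | refl => exact ⟨fun x hx => by (cases hx; exact .refl), fun x hx => by cases hx⟩
        | @tail b c _ h ih =>
          obtain ⟨o, h1, h2⟩ := h
          simp only [D, List.mem_cons, List.mem_append, List.mem_map, Prod.mk.injEq] at h1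
          rcases h1 with ⟨h3, rfl, h4⟩ | ⟨e, he, h3, rfl, h4⟩ | ⟨e, he, h3, rfl, h4⟩
          · refine ⟨fun x hx => by (rw [h4] at hx; cases hx), fun x hx => ?_⟩
            rw [h4] at hx
            cases hx
            refine ⟨b.2, (hp _ _).2 (ih.1 _ h3), ?_⟩
            rw [h2.2]
          · refine ⟨fun x hx => ?_, fun x hx => by (rw [← h4] at hx; cases hx)⟩
            rw [← h4] at hx
            cases hx
            exact (ih.1 _ h3.symm).tail ⟨_, he, h2⟩
          · refine ⟨fun x hx => by (rw [← h4] at hx; cases hx), fun x hx => ?_⟩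
            rw [← h4] at hx
            cases hx
            obtain ⟨ρ, h5, h6⟩ := ih.2 _ h3.symm
            exact ⟨ρ, h5, h6.tail ⟨_, he, h2⟩⟩
      obtain ⟨ρ, h1, h2⟩ := (key _ h).2 _ rfl
      exact ⟨ρ, h1, (hq _ _).2 h2⟩
  | star p hp =>
    obtain ⟨S, _, E, s, t, hp⟩ := hp
    let D : List (Option S × RegOp × Option S) := (none, RegOp.test 0 0, some s) ::
      (some t, RegOp.test 0 0, none) :: E.map (fun e => (some e.1, e.2.1, some e.2.2))
    refine ⟨Option S, inferInstance, D, none, none, fun σ σ' => ⟨?_, ?_⟩⟩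
    · intro h
      induction h with
      | refl => exact .refl
      | @tail ρ σ' _ h ih =>
        rw [hp] at h
        have h3 : ReflTransGen (AutStep D) (some s, ρ) (some t, σ') :=
          h.lift (fun c => (some c.1, c.2)) fun a b ⟨o, ho, hr⟩ => ⟨o, by
            simpa [D] using ho, hr⟩
        have h4 : AutStep D (none, ρ) (some s, ρ) := ⟨RegOp.test 0 0, by simp [D], rfl, rfl⟩
        have h5 : AutStep D (some t, σ') (none, σ') := ⟨RegOp.test 0 0, by simp [D], rfl, rfl⟩
        exact ((ih.tail h4).trans h3).tail h5
    · intro h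
      have key : ∀ c, ReflTransGen (AutStep D) (none, σ) c →
          (c.1 = none → ReflTransGen p.Rel σ c.2) ∧
          (∀ x, c.1 = some x → ∃ ρ, ReflTransGen p.Rel σ ρ ∧
            ReflTransGen (AutStep E) (s, ρ) (x, c.2)) := by
        intro c h
        induction h with
        | refl => exact ⟨fun _ => .refl, fun x hx => by cases hx⟩
        | @tail b c _ h ih =>
          obtain ⟨o, h1, h2⟩ := h
          simp only [D, List.mem_cons, List.mem_map, Prod.mk.injEq] at h1
          rcases h1 with ⟨h3, rfl, h4⟩ | ⟨h3, rfl, h4⟩ | ⟨e, he, h3, rfl, h4⟩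
          · refine ⟨fun hx => by (rw [h4] at hx; cases hx), fun x hx => ?_⟩
            rw [h4] at hx
            cases hx
            refine ⟨b.2, ih.1 h3, ?_⟩
            rw [h2.2]
          · refine ⟨fun _ => ?_, fun x hx => by (rw [h4] at hx; cases hx)⟩
            obtain ⟨ρ, h5, h6⟩ := ih.2 _ h3
            rw [h2.2]
            exact h5.tail ((hp _ _).2 h6)
          · refine ⟨fun hx => by (rw [← h4] at hx; cases hx), fun x hx => ?_⟩
            rw [← h4] at hx
            cases hx
            obtain ⟨ρ, h5, h6⟩ := ih.2 _ h3.symm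
            exact ⟨ρ, h5, h6.tail ⟨_, he, h2⟩⟩
      exact (key _ h).1 rfl

/-! ### Tensor squares and accumulated squares of linear forms -/

section

variable {ι : Type} [Fintype ι]

/-- The vector `v ⊗ v`, with an additional entry `a`. -/
def squareVec (v : ι → ℤ) (a : ℤ) : Option (ι × ι) → ℤ
  | none => a
  | some ij => v ij.1 * v ij.2

/-- The matrix that acts on `v ⊗ v` like `U`, and adds to the additional entry the squares of the
values of the linear forms in `l` at `v`. -/
def squareMatrix (l : List (ι → ℤ)) (U : Matrix ι ι ℤ) :
    Matrix (Option (ι × ι)) (Option (ι × ι)) ℤ :=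
  Matrix.of fun
    | none, none => 1
    | none, some ij => (l.map fun c => c ij.1 * c ij.2).sum
    | some _, none => 0
    | some ij, some kl => U ij.1 kl.1 * U ij.2 kl.2

theorem sum_mul_mul_mul (c c' v : ι → ℤ) :
    ∑ ij : ι × ι, c ij.1 * c' ij.2 * (v ij.1 * v ij.2) = (c ⬝ᵥ v) * (c' ⬝ᵥ v) := by
  rw [dotProduct, dotProduct, Finset.sum_mul_sum, Fintype.sum_prod_type]
  exact Finset.sum_congr rfl fun i _ => Finset.sum_congr rfl fun j _ => by ring

/-- The square of a linear form in v is linear in v ⊗ v. Conditions can therefore be checked by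
adding nonnegative penalties, which never cancel later. -/
theorem squareMatrix_mulVec (l : List (ι → ℤ)) (U : Matrix ι ι ℤ) (v : ι → ℤ) (a : ℤ) :
    squareMatrix l U *ᵥ squareVec v a =
      squareVec (U *ᵥ v) (a + (l.map fun c => (c ⬝ᵥ v) ^ 2).sum) := by
  ext k
  rw [Matrix.mulVec, dotProduct, Fintype.sum_option]
  rcases k with _ | ⟨i, j⟩
  · simp only [squareMatrix, squareVec, Matrix.of_apply, one_mul, add_right_inj]
    induction l with
    | nil => simp
    | cons c l ih =>
      simp only [List.map_cons, List.sum_cons, add_mul, Finset.sum_add_distrib, ih,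
        sum_mul_mul_mul, pow_two]
  · simp only [squareMatrix, squareVec, Matrix.of_apply, zero_mul, zero_add]
    exact sum_mul_mul_mul (U i) (U j) v

theorem squareVec_dotProduct (f v : ι → ℤ) (a b : ℤ) :
    squareVec f b ⬝ᵥ squareVec v a = b * a + (f ⬝ᵥ v) ^ 2 := by
  rw [dotProduct, Fintype.sum_option, pow_two]
  simp only [squareVec, sum_mul_mul_mul]

end

/-! ### Automaton runs as orbits of integer matrices -/

section

variable {S : Type} (N : ℕ) (num : S → ℤ)

/-- The linear form that reads the register `r`. -/
def regForm (r : ℕ) : Option (Option (Fin (N + 1))) → ℤ :=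
  Pi.single (some (some (Fin.ofNat (N + 1) r))) 1

/-- The constant entry 1 makes affine updates, such as incrementing a register or setting the state,
linear. -/
def configVec (c : S × (ℕ → ℕ)) : Option (Option (Fin (N + 1))) → ℤ
  | none => 1
  | some none => num c.1
  | some (some k) => c.2 k

/-- When the numbering is injective and the registers are in range, all these forms vanish at a
configuration exactly when the transition can be taken there. -/
def transChecks (e : S × RegOp × S) : List (Option (Option (Fin (N + 1))) → ℤ) :=
  (Pi.single (some none) 1 - num e.1 • Pi.single none 1) ::
    match e.2.1 with
    | .test r s => [regForm N r - regForm N s]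
    | _ => []

def transRow (o : RegOp) (k : Fin (N + 1)) : Option (Option (Fin (N + 1))) → ℤ :=
  match o with
  | .zero r => if (k : ℕ) = r then 0 else regForm N k
  | .succ r => if (k : ℕ) = r then regForm N k + Pi.single none 1 else regForm N k
  | .copy r s => if (k : ℕ) = r then regForm N s else regForm N k
  | .test _ _ => regForm N k

def transUpdate (e : S × RegOp × S) :
    Matrix (Option (Option (Fin (N + 1)))) (Option (Option (Fin (N + 1)))) ℤ :=
  Matrix.of fun
    | none => Pi.single none 1
    | some none => num e.2.2 • Pi.single none 1
    | some (some k) => transRow N e.2.1 k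

def RegOp.bound : RegOp → ℕ
  | zero r => r
  | succ r => r
  | copy r s => max r s
  | test r s => max r s

variable {N num}

theorem regForm_dotProduct {r : ℕ} (hr : r ≤ N) (c : S × (ℕ → ℕ)) :
    regForm N r ⬝ᵥ configVec N num c = c.2 r := by
  rw [regForm, single_dotProduct, one_mul]
  simp [configVec, Nat.mod_eq_of_lt (Nat.lt_succ_of_le hr)]

theorem single_none_dotProduct (c : S × (ℕ → ℕ)) :
    (Pi.single none 1 : Option (Option (Fin (N + 1))) → ℤ) ⬝ᵥ configVec N num c = 1 := by
  rw [single_dotProduct, one_mul]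
  rfl

theorem single_some_none_dotProduct (c : S × (ℕ → ℕ)) :
    (Pi.single (some none) 1 : Option (Option (Fin (N + 1))) → ℤ) ⬝ᵥ configVec N num c =
      num c.1 := by
  rw [single_dotProduct, one_mul]
  rfl

theorem transUpdate_mulVec {e : S × RegOp × S} (he : e.2.1.bound ≤ N) {σ σ' : ℕ → ℕ}
    (h : e.2.1.Rel σ σ') (s : S) :
    transUpdate N num e *ᵥ configVec N num (s, σ) = configVec N num (e.2.2, σ') := by
  obtain ⟨s₁, o, s₂⟩ := e
  ext k
  rcases k with _ | _ | k
  · exact single_none_dotProduct _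
  · change (num s₂ • Pi.single none 1) ⬝ᵥ configVec N num (s, σ) = num s₂
    rw [smul_dotProduct]
    rw [single_none_dotProduct, smul_eq_mul, mul_one]
  · change transRow N o k ⬝ᵥ configVec N num (s, σ) = σ' k
    have hk : (k : ℕ) ≤ N := Nat.le_of_lt_succ k.2
    cases o with
    | zero r =>
      cases h
      by_cases hr : (k : ℕ) = r
      · simp [transRow, hr]
      · rw [transRow, if_neg hr, regForm_dotProduct hk, Function.update_of_ne hr]
    | succ r =>
      cases h
      by_cases hr : (k : ℕ) = r
      · rw [transRow, if_pos hr, add_dotProduct, regForm_dotProduct hk, single_none_dotProduct, hr,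
          Function.update_self]
        simp
      · rw [transRow, if_neg hr, regForm_dotProduct hk, Function.update_of_ne hr]
    | copy r q =>
      cases h
      by_cases hr : (k : ℕ) = r
      · rw [transRow, if_pos hr, regForm_dotProduct (le_of_max_le_right he), hr,
          Function.update_self]
      · rw [transRow, if_neg hr, regForm_dotProduct hk, Function.update_of_ne hr]
    | test r q =>
      obtain ⟨-, rfl⟩ := h
      exact regForm_dotProduct hk _

theorem transChecks_eq_zero {e : S × RegOp × S} (he : e.2.1.bound ≤ N) {σ σ' : ℕ → ℕ}
    (h : e.2.1.Rel σ σ') : ∀ c ∈ transChecks N num e, c ⬝ᵥ configVec N num (e.1, σ) = 0 := by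
  obtain ⟨s₁, o, s₂⟩ := e
  intro c hc
  rcases List.mem_cons.1 hc with rfl | hc
  · rw [sub_dotProduct, smul_dotProduct, single_some_none_dotProduct, single_none_dotProduct]
    simp
  · cases o with
    | test r q =>
      cases List.mem_singleton.1 hc
      rw [sub_dotProduct, regForm_dotProduct (le_of_max_le_left he),
        regForm_dotProduct (le_of_max_le_right he)]
      simp [h.1]
    | _ => exact absurd hc List.not_mem_nil

theorem exists_rel_of_transChecks (hnum : Function.Injective num) {e : S × RegOp × S}
    (he : e.2.1.bound ≤ N) {s : S} {σ : ℕ → ℕ}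
    (h : ∀ c ∈ transChecks N num e, c ⬝ᵥ configVec N num (s, σ) = 0) :
    s = e.1 ∧ ∃ σ', e.2.1.Rel σ σ' := by
  obtain ⟨s₁, o, s₂⟩ := e
  constructor
  · have h1 := h _ List.mem_cons_self
    rw [sub_dotProduct, smul_dotProduct, single_some_none_dotProduct, single_none_dotProduct,
      smul_eq_mul, mul_one, sub_eq_zero] at h1
    exact hnum h1
  · cases o with
    | test r q =>
      have h1 := h _ (List.mem_cons_of_mem _ (List.mem_singleton_self _))
      rw [sub_dotProduct, regForm_dotProduct (le_of_max_le_left he),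
        regForm_dotProduct (le_of_max_le_right he), sub_eq_zero] at h1
      exact ⟨σ, by exact_mod_cast h1, rfl⟩
    | _ => exact ⟨_, rfl⟩

theorem list_sum_sq_eq_zero_iff (l : List ℤ) :
    (l.map (· ^ 2)).sum = 0 ↔ ∀ x ∈ l, x = 0 := by
  induction l with
  | nil => simp
  | cons a l ih =>
    have h : 0 ≤ (l.map (· ^ 2)).sum := List.sum_nonneg (by
      simp only [List.mem_map, forall_exists_index, and_imp, forall_apply_eq_imp_iff₂]
      exact fun x _ => sq_nonneg x)
    rw [List.map_cons, List.sum_cons, add_eq_zero_iff_of_nonneg (sq_nonneg a) h, ih]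
    simp

/-- Runs of an automaton correspond to the zeros of a quadratic form on an orbit of a finitely
generated semigroup of integer matrices. -/
theorem exists_word_iff_automaton (hnum : Function.Injective num) (E : List (S × RegOp × S))
    (hE : ∀ e ∈ E, e.2.1.bound ≤ N) (s t : S) (σ : ℕ → ℕ) :
    (∃ w : List (Matrix (Option (Option (Option (Fin (N + 1))) × Option (Option (Fin (N + 1)))))
        (Option (Option (Option (Fin (N + 1))) × Option (Option (Fin (N + 1))))) ℤ),
      (∀ g ∈ w, g ∈ E.map fun e => squareMatrix (transChecks N num e) (transUpdate N num e)) ∧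
      squareVec (Pi.single (some none) 1 - num t • Pi.single none 1) 1 ⬝ᵥ
        (w.prod *ᵥ squareVec (configVec N num (s, σ)) 0) = 0) ↔
    ∃ σ', Relation.ReflTransGen (AutStep E) (s, σ) (t, σ') := by
  constructor
  · rintro ⟨w, hw, h0⟩
    -- The entry a is the accumulated penalty. It cannot decrease, so a = 0 says that every step so
    -- far was legal; after a violation v need not describe any configuration.
    have key : ∃ v a, w.prod *ᵥ squareVec (configVec N num (s, σ)) 0 = squareVec v a ∧ 0 ≤ a ∧
        (a = 0 → ∃ c, v = configVec N num c ∧ Relation.ReflTransGen (AutStep E) (s, σ) c) := by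
      clear h0
      induction w with
      | nil => exact ⟨_, 0, by simp, le_rfl, fun _ => ⟨_, rfl, .refl⟩⟩
      | cons g w ih =>
        obtain ⟨v, a, h1, h2, h3⟩ := ih fun g' hg' => hw g' (List.mem_cons_of_mem _ hg')
        obtain ⟨e, he, rfl⟩ := List.mem_map.1 (hw g List.mem_cons_self)
        have hnn : 0 ≤ ((transChecks N num e).map fun c => (c ⬝ᵥ v) ^ 2).sum :=
          List.sum_nonneg (by
            simp only [List.mem_map, forall_exists_index, and_imp, forall_apply_eq_imp_iff₂]
            exact fun c _ => sq_nonneg _)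
        refine ⟨_, _, by rw [List.prod_cons, ← Matrix.mulVec_mulVec, h1, squareMatrix_mulVec],
          add_nonneg h2 hnn, fun h4 => ?_⟩
        obtain ⟨⟨s', ρ⟩, rfl, h6⟩ := h3 (by omega)
        have h5 := (list_sum_sq_eq_zero_iff ((transChecks N num e).map fun c =>
          c ⬝ᵥ configVec N num (s', ρ))).1 (by
            rw [List.map_map]
            exact le_antisymm (by simp only [Function.comp_def]; omega)
              hnn)
        obtain ⟨rfl, ρ', h7⟩ := exists_rel_of_transChecks hnum (hE e he) fun c hc =>
          h5 _ (List.mem_map_of_mem hc)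
        exact ⟨(e.2.2, ρ'), transUpdate_mulVec (hE e he) h7 _, h6.tail ⟨_, he, h7⟩⟩
    obtain ⟨v, a, h1, h2, h3⟩ := key
    rw [h1, squareVec_dotProduct, one_mul] at h0
    -- The final form is the penalty plus the square of the distance of the state number from that
    -- of `t`; its vanishing forces both to be 0.
    obtain ⟨⟨s', ρ⟩, rfl, h4⟩ := h3 (by nlinarith [sq_nonneg ((Pi.single (some none) 1 -
      num t • Pi.single none 1 : Option (Option (Fin (N + 1))) → ℤ) ⬝ᵥ v)])
    have h5 := pow_eq_zero_iff (two_ne_zero) |>.1 (le_antisymm (by linarith) (sq_nonneg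
      ((Pi.single (some none) 1 - num t • Pi.single none 1 :
        Option (Option (Fin (N + 1))) → ℤ) ⬝ᵥ configVec N num (s', ρ))))
    rw [sub_dotProduct, smul_dotProduct, single_some_none_dotProduct, single_none_dotProduct,
      smul_eq_mul, mul_one, sub_eq_zero] at h5
    cases hnum h5
    exact ⟨ρ, h4⟩
  · rintro ⟨σ', h⟩
    have key : ∀ c, Relation.ReflTransGen (AutStep E) (s, σ) c → ∃ w : List (Matrix _ _ ℤ),
        (∀ g ∈ w, g ∈ E.map fun e => squareMatrix (transChecks N num e) (transUpdate N num e)) ∧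
        w.prod *ᵥ squareVec (configVec N num (s, σ)) 0 = squareVec (configVec N num c) 0 := by
      intro c h
      induction h with
      | refl => exact ⟨[], by simp, by simp⟩
      | @tail b c _ h ih =>
        obtain ⟨w, h1, h2⟩ := ih
        obtain ⟨o, h3, h4⟩ := h
        refine ⟨squareMatrix (transChecks N num (b.1, o, c.1)) (transUpdate N num (b.1, o, c.1)) :: w,
          ?_, ?_⟩
        · intro g hg
          rcases List.mem_cons.1 hg with rfl | hg
          · exact List.mem_map.2 ⟨_, h3, rfl⟩
          · exact h1 g hg
        · rw [List.prod_cons, ← Matrix.mulVec_mulVec, h2, squareMatrix_mulVec,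
            transUpdate_mulVec (hE _ h3) h4 b.1]
          have h5 := (list_sum_sq_eq_zero_iff ((transChecks N num (b.1, o, c.1)).map fun l =>
            l ⬝ᵥ configVec N num b)).2 (by
              simp only [List.mem_map, forall_exists_index, and_imp, forall_apply_eq_imp_iff₂]
              exact transChecks_eq_zero (hE _ h3) h4)
          rw [List.map_map] at h5
          simp only [Function.comp_def] at h5
          rw [h5, add_zero]
    obtain ⟨w, h1, h2⟩ := key _ h
    refine ⟨w, h1, ?_⟩
    rw [h2, squareVec_dotProduct, sub_dotProduct, smul_dotProduct, single_some_none_dotProduct,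
      single_none_dotProduct]
    simp

end

/-! ### Coding the measurements -/

/-- The code of a matrix with given entries. -/
def MatCode.ofFinFn {d : ℕ} (f : Fin d → Fin d → RatCode) : MatCode :=
  List.ofFn fun i => List.ofFn (f i)

theorem MatCode.toMatrix_ofFinFn {d : ℕ} (f : Fin d → Fin d → RatCode) :
    (MatCode.ofFinFn f).toMatrix d = Matrix.of fun i j => (f i j).val := by
  ext i j
  simp [MatCode.toMatrix, MatCode.entry, MatCode.ofFinFn, List.getD_eq_getElem?_getD]

theorem primrec_matCode_ofFinFn {α : Type} [Primcodable α] {d : ℕ}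
    {f : α → Fin d → Fin d → RatCode} (hf : ∀ i j, Primrec fun a => f a i j) :
    Primrec fun a => MatCode.ofFinFn (f a) :=
  Primrec.list_ofFn fun i => Primrec.list_ofFn (hf i)

theorem primrec_list_map_fixed {α β γ : Type} [Primcodable α] [Primcodable γ] {f : α → β → γ}
    (hf : ∀ b, Primrec fun a => f a b) (l : List β) : Primrec fun a => l.map (f a) := by
  induction l with
  | nil => exact Primrec.const []
  | cons b l ih => exact Primrec.list_cons.comp (hf b) ih

theorem exists_list_map_iff {α β : Type*} (f : α → β) (l : List α) (P : List β → Prop) :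
    (∃ w : List β, (∀ b ∈ w, b ∈ l.map f) ∧ P w) ↔ ∃ w : List α, (∀ a ∈ w, a ∈ l) ∧ P (w.map f) := by
  constructor
  · rintro ⟨w, hw, h⟩
    suffices h' : ∃ w' : List α, (∀ a ∈ w', a ∈ l) ∧ w'.map f = w by
      obtain ⟨w', h1, rfl⟩ := h'
      exact ⟨w', h1, h⟩
    clear h
    induction w with
    | nil => exact ⟨[], by simp, rfl⟩
    | cons b w ih =>
      obtain ⟨w', h1, rfl⟩ := ih fun b' hb' => hw b' (List.mem_cons_of_mem _ hb')
      obtain ⟨a, ha, rfl⟩ := List.mem_map.1 (hw b List.mem_cons_self)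
      refine ⟨a :: w', fun a' ha' => ?_, rfl⟩
      rcases List.mem_cons.1 ha' with rfl | ha'
      exacts [ha, h1 _ ha']
  · rintro ⟨w, hw, h⟩
    refine ⟨_, fun b hb => ?_, h⟩
    obtain ⟨a, ha, rfl⟩ := List.mem_map.1 hb
    exact List.mem_map_of_mem (hw a ha)

/-- A tuple of codes that describes, up to the numbering of the levels, given matrices. -/
theorem TupleCode.valid_and_yes_iff {J : Type} [Fintype J] [DecidableEq J] [Nonempty J]
    (c : TupleCode) (e : J ≃ Fin c.1) (L : List (Matrix J J ℚ))
    (hc : c.2.map (fun m => m.toMatrix c.1) = L.map (Matrix.reindexAlgEquiv ℚ ℚ e))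
    (hL : (L.map fun K => Kᵀ * K).sum = 1) :
    (MOP quantum).valid c ∧
      (MMP.yes c ↔ ∃ w : List (Matrix J J ℚ), (∀ K ∈ w, K ∈ L) ∧ w.prod = 0) := by
  refine ⟨⟨(e (Classical.arbitrary J)).pos, ?_⟩, ?_⟩
  -- Renumbering and passing to complex entries is a ring homomorphism; it turns the transpose into
  -- the adjoint because the entries are rational.
  · let ψ : Matrix J J ℚ →+* Matrix (Fin c.1) (Fin c.1) ℂ :=
      (algebraMap ℚ ℂ).mapMatrix.comp (Matrix.reindexAlgEquiv ℚ ℚ e : Matrix J J ℚ →+* _)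
    have hψ : ∀ K, (ψ K)ᴴ * ψ K = ψ (Kᵀ * K) := by
      intro K
      rw [map_mul]
      congr 1
      ext i j
      simp [ψ]
    change ∑ j : Fin c.2.length, (c.toComplex j)ᴴ * c.toComplex j = 1
    have h1 : ∑ j : Fin c.2.length, (c.toComplex j)ᴴ * c.toComplex j =
        (c.2.map fun m => (m.toComplex c.1)ᴴ * m.toComplex c.1).sum :=
      Fin.sum_univ_fun_getElem c.2 fun m => (m.toComplex c.1)ᴴ * m.toComplex c.1
    have h2 : (c.2.map fun m => (m.toComplex c.1)ᴴ * m.toComplex c.1) =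
        (c.2.map fun m => m.toMatrix c.1).map fun M =>
          (M.map fun q : ℚ => (q : ℂ))ᴴ * M.map fun q : ℚ => (q : ℂ) := by
      rw [List.map_map]
      rfl
    have h3 : (L.map ((fun M : Matrix (Fin c.1) (Fin c.1) ℚ => (M.map fun q : ℚ => (q : ℂ))ᴴ *
        M.map fun q : ℚ => (q : ℂ)) ∘ Matrix.reindexAlgEquiv ℚ ℚ e)) =
        (L.map fun K => Kᵀ * K).map ψ := by
      rw [List.map_map]
      exact List.map_congr_left fun K _ => hψ K
    rw [h1, h2, hc, List.map_map, h3, ← map_list_sum, hL, map_one]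
  · have h := exists_list_map_iff (fun m : MatCode => m.toMatrix c.1) c.2
      (fun w : List (Matrix _ _ ℚ) => w ≠ [] ∧ w.prod = 0)
    simp only [Ne, List.map_eq_nil_iff] at h
    rw [MMP_yes_iff]
    refine h.symm.trans ?_
    rw [hc, exists_list_map_iff _ _ (fun w : List (Matrix _ _ ℚ) => w ≠ [] ∧ w.prod = 0)]
    refine exists_congr fun w => and_congr_right fun _ => ?_
    rw [← map_list_prod, map_eq_zero_iff _ (AlgEquiv.injective _), Ne, List.map_eq_nil_iff]
    refine and_iff_right_of_imp ?_
    rintro h rfl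
    exact one_ne_zero h

/-- The matrices and rows of the family are fixed finite lists; the input m enters only through the
unit vector x m / (m² + 1), so the code is primitive recursive in m. -/
theorem exists_primrec_measurement {J : Type} [Fintype J] [DecidableEq J] (o : J)
    (G : List (Matrix J J ℤ)) (hG : ∀ g ∈ G, ∀ j, g o j = if j = o then 1 else 0) (τ : J → ℤ)
    (x : ℕ → J → ℤ) (hx : ∀ j, Primrec fun m => x m j) (hxo : ∀ m, x m o = 1)
    (hxx : ∀ m, x m ⬝ᵥ x m = ((m : ℤ) ^ 2 + 1) ^ 2) :
    ∃ c : ℕ → TupleCode, Primrec c ∧ ∀ m, (MOP quantum).valid (c m) ∧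
      (MMP.yes (c m) ↔
        ∃ w : List (Matrix J J ℤ), (∀ g ∈ w, g ∈ G) ∧ τ ⬝ᵥ (w.prod *ᵥ x m) = 0) := by
  obtain ⟨C, R, h⟩ := exists_kraus_family o G hG τ
  have : Nonempty J := ⟨o⟩
  let e := Fintype.equivFin J
  let fC : Matrix J J ℚ → MatCode := fun K =>
    MatCode.ofFinFn fun i j => RatCode.ofRat (K (e.symm i) (e.symm j))
  let fR : ℕ → (J → ℚ) → MatCode := fun m r =>
    -- The pair (z, m * m) codes z / (m² + 1), an entry of the normalised vector.
    MatCode.ofFinFn fun i j => RatCode.mul (x m (e.symm i), m * m) (RatCode.ofRat (r (e.symm j)))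
  refine ⟨fun m => (Fintype.card J, C.map fC ++ R.map (fR m)), ?_, fun m => ?_⟩
  · refine (Primrec.const _).pair (Primrec.list_append.comp (Primrec.const _) ?_)
    refine primrec_list_map_fixed (fun r => primrec_matCode_ofFinFn fun i j => ?_) R
    exact primrec_ratCode_mul' ((hx _).pair (Primrec.nat_mul.comp .id .id)) (Primrec.const _)
  · obtain ⟨h1, h2⟩ := h (x m) ((m : ℤ) ^ 2 + 1) (hxo m) (by positivity) (hxx m)
    rw [← h2]
    refine TupleCode.valid_and_yes_iff (Fintype.card J, C.map fC ++ R.map (fR m)) e _ ?_ h1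
    simp only [List.map_append, List.map_map]
    congr 1
    · refine List.map_congr_left fun K _ => ?_
      simp only [Function.comp, fC, MatCode.toMatrix_ofFinFn, RatCode.val_ofRat]
      rfl
    · refine List.map_congr_left fun r _ => ?_
      simp only [Function.comp, fR, MatCode.toMatrix_ofFinFn, RatCode.val_ofRat, RatCode.val_mul]
      ext i j
      simp [RatCode.val, Matrix.vecMulVec_apply, pow_two]

/-! ### Reduction of the halting problem and assembly of the scheme -/

theorem halting_reduces_MOP_quantum_and_MMP :
    Halting.Reduces (MOP quantum) ∧ Halting.Reduces MMP := by
  -- A universal function: one program, one automaton and one family of matrices serve all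
  -- instances.
  let F : ℕ →. ℕ := fun m => (Part.ofOption (Encodable.decode m : Option (Nat.Partrec.Code × ℕ))).bind
    fun i => i.1.eval i.2
  have hF : Partrec F := (Computable.decode.ofOption).bind
    (Nat.Partrec.Code.eval_part.comp (Computable.fst.comp Computable.snd)
      (Computable.snd.comp Computable.snd))
  obtain ⟨p, hp⟩ := exists_regProg_of_partrec hF
  obtain ⟨S, _, E, s, t, hE⟩ := p.exists_automaton
  let N : ℕ := (E.map fun e => e.2.1.bound).sum
  have hN : ∀ e ∈ E, e.2.1.bound ≤ N := fun e he =>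
    List.single_le_sum (fun _ _ => Nat.zero_le _) _ (List.mem_map_of_mem he)
  -- The start state receives number 0, so the starting vector has only the entries 1 and m, and
  -- squared length m² + 1.
  let num : S → ℤ := fun q => (Fintype.equivFin S q : ℤ) - (Fintype.equivFin S s : ℤ)
  have hnum : Function.Injective num := fun a b h => by
    have h1 : ((Fintype.equivFin S a : ℕ) : ℤ) = (Fintype.equivFin S b : ℕ) := by
      simpa [num] using h
    exact (Fintype.equivFin S).injective (Fin.ext (by exact_mod_cast h1))
  let v : ℕ → Option (Option (Fin (N + 1))) → ℤ := fun m =>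
    configVec N num (s, fun r => if r = 0 then m else 0)
  have hv : ∀ i, Primrec fun m => v m i := by
    intro i
    rcases i with _ | _ | k
    · exact Primrec.const 1
    · exact Primrec.const (num s)
    · by_cases hk : (k : ℕ) = 0
      · refine primrec_intCast.of_eq fun m => ?_
        simp [v, configVec, hk]
      · refine (Primrec.const 0).of_eq fun m => ?_
        simp [v, configVec, hk]
  have hvv : ∀ m, v m ⬝ᵥ v m = (m : ℤ) ^ 2 + 1 := by
    intro m
    rw [dotProduct, Fintype.sum_option, Fintype.sum_option, Fin.sum_univ_succ]
    simp [v, configVec, num]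
    ring
  -- The distinguished coordinate is the square of the constant entry 1, which every transition
  -- preserves.
  obtain ⟨c, hc1, hc2⟩ := exists_primrec_measurement (some (none, none))
    (E.map fun e => squareMatrix (transChecks N num e) (transUpdate N num e)) (by
      intro g hg j
      obtain ⟨e, -, rfl⟩ := List.mem_map.1 hg
      rcases j with _ | ⟨i, j⟩
      · rfl
      · change (Pi.single none 1 : _ → ℤ) i * (Pi.single none 1 : _ → ℤ) j = _
        cases i <;> cases j <;> simp)
    (squareVec (Pi.single (some none) 1 - num t • Pi.single none 1) 1)
    (fun m => squareVec (v m) 0) (by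
      rintro (_ | ⟨i, j⟩)
      · exact Primrec.const 0
      · exact primrec_int_mul.comp (hv i) (hv j)) (fun m => rfl) (fun m => by
      rw [squareVec_dotProduct, hvv]
      ring)
  have hc3 : ∀ i : Nat.Partrec.Code × ℕ,
      MMP.yes (c (Encodable.encode i)) ↔ (i.1.eval i.2).Dom := by
    intro i
    rw [(hc2 _).2, exists_word_iff_automaton hnum E hN]
    simp only [← hE, hp]
    change ((Part.ofOption (Encodable.decode (Encodable.encode i))).bind _).Dom ↔ _
    rw [Encodable.encodek]
    exact (congrArg Part.Dom (Part.bind_some i _)).to_iff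
  have hc4 : Computable fun i : Nat.Partrec.Code × ℕ => c (Encodable.encode i) :=
    hc1.to_comp.comp Computable.encode
  exact ⟨⟨_, hc4, fun i _ => ⟨(hc2 _).1,
      (hc3 i).symm.trans (MOP_quantum_yes_iff _ (hc2 _).1.1).symm⟩⟩,
    ⟨_, hc4, fun i _ => ⟨(hc2 _).1.1, (hc3 i).symm⟩⟩⟩

/-- General matrices are not turned into Kraus operators directly: a search for a vanishing product
is regarded as a computation, and its halting is encoded in a measurement. -/
theorem MMP_reduces_MOP_quantum : MMP.Reduces (MOP quantum) :=
  (reduces_halting_of_rePred MMP rePred_MMP).trans halting_reduces_MOP_quantum_and_MMP.1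

/-- On the quantum side everything passes through QMOP. On the classical side the scheme and `D₂`
are both decidable with both answers, hence reducible to each other. -/
theorem fitsResourceDependence {D₁ D₂ : DecisionProblem} (h1 : (MOP quantum).Reduces D₁)
    (h2 : D₂.NontriviallyDecidable) :
    FitsResourceDependence NoDestructiveInterference quantum classical D₁ D₂ MMP nonnegTuples
      entrywiseAbs where
  question_false := not_noDestructiveInterference_quantum
  question_true := noDestructiveInterference_classical
  halting_reduces := halting_reduces_MOP_quantum_and_MMP.2
  source_undecidable := not_isDecidable_of_halting_reduces halting_reduces_MOP_quantum_and_MMP.2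
  map_computable := computable_entrywiseAbs
  map_mapsTo c hc := ⟨hc, entrywiseAbs_mem c⟩
  map_onto c hc h := ⟨c, hc, entrywiseAbs_of_mem h⟩
  subset_decidable := nontriviallyDecidable_nonneg_MMP
  reduces_one := (resourceDependent_quantum_reduces.trans MMP_reduces_MOP_quantum).trans h1
  reduces_two := nontriviallyDecidable_resourceDependent_classical.1.reduces h2.2.1 h2.2.2
  reduces_two' := h2.1.reduces nontriviallyDecidable_resourceDependent_classical.2.1
    nontriviallyDecidable_resourceDependent_classical.2.2
  undecidable_one := not_isDecidable_of_halting_reduces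
    (halting_reduces_MOP_quantum_and_MMP.1.trans h1)
  decidable_two := h2

end ResUndec

theorem mainTheorem3 :
    -- quantum versus classical measurement occurrence
    ResUndec.FitsResourceDependence ResUndec.NoDestructiveInterference
      ResUndec.quantum ResUndec.classical
      (ResUndec.MOP ResUndec.quantum) (ResUndec.MOP ResUndec.classical)
      ResUndec.MMP ResUndec.nonnegTuples ResUndec.entrywiseAbs ∧
    -- on the devices of either theory, measurement occurrence is the scheme itself
    (∀ T : ResUndec.PhysicalTheory, T = ResUndec.quantum ∨ T = ResUndec.classical →
      ∀ c : ResUndec.TupleCode, (ResUndec.MOP T).valid c →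
        ((ResUndec.MOP T).yes c ↔
          (¬ ResUndec.NoDestructiveInterference T ∧ ResUndec.MMP.yes c) ∨
          (ResUndec.NoDestructiveInterference T ∧
            ResUndec.MMP.yes (ResUndec.entrywiseAbs c)))) ∧
    -- QOMDP versus POMDP goal-state reachability
    ResUndec.FitsResourceDependence ResUndec.NoDestructiveInterference
      ResUndec.quantum ResUndec.classical
      ResUndec.QOMDPReachability ResUndec.POMDPReachability
      ResUndec.MMP ResUndec.nonnegTuples ResUndec.entrywiseAbs ∧
    (ResUndec.MOP ResUndec.quantum).Reduces ResUndec.QOMDPReachability := by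
  refine ⟨ResUndec.fitsResourceDependence ⟨id, Computable.id, fun _ h => ⟨h, Iff.rfl⟩⟩
      ResUndec.nontriviallyDecidable_MOP_classical, ?_,
    ResUndec.fitsResourceDependence ResUndec.MOP_quantum_reduces_QOMDPReachability
      ResUndec.nontriviallyDecidable_POMDPReachability,
    ResUndec.MOP_quantum_reduces_QOMDPReachability⟩
  rintro T (rfl | rfl) c hc
  · simp [ResUndec.not_noDestructiveInterference_quantum, ResUndec.MOP_quantum_yes_iff c hc.1]
  · simp [ResUndec.noDestructiveInterference_classical,
      ResUndec.MOP_classical_yes_iff_supportMortal c hc, ResUndec.MMP_yes_entrywiseAbs_iff c hc.1]
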